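/- Let $\mathcal G$ be a second countable locally compact Hausdorff groupoid with base space $X$, range and source maps $r,s$, and Haar system $\lambda=(\lambda^x)_{x\in X}$ (Radon measures $\lambda^x$ with support $\mathcal G^x=r^{-1}(x)$, such that $x\mapsto\int f\,d\lambda^x$ is continuous for $f\in C_c(\mathcal G)$ and $\gamma_*\lambda^{s(\gamma)}=\lambda^{r(\gamma)}$ for all $\gamma$). Its reduced $C^*$-algebra $C^*_r(\mathcal G,\lambda)$ is the closure of $C_c(\mathcal G)$, acting by $f\cdot\phi(\gamma)=\int f(\gamma')\phi(\gamma'^{-1}\gamma)\,d\lambda^{r(\gamma)}(\gamma')$, in the $C^*$-algebra of adjointable operators of the Hilbert $C_0(X)$-module $L^2(\mathcal G,\lambda)$, the completion of $C_c(\mathcal G)$ for $\langle\phi,\phi'\rangle(x)=\int\overline{\phi(\gamma^{-1})}\,\phi'(\gamma^{-1})\,d\lambda^x(\gamma)$. Let $\alpha$ be an automorphism of $\mathcal G$, with induced homeomorphism $\alpha_X$ of $X$, that preserves $\lambda$ with density $\rho_\alpha$: $\rho_\alpha:\mathcal G\to(0,\infty)$ is continuous and $\alpha_*\lambda^x=\rho_\alpha\,\lambda^{\alpha_X(x)}$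 for all $x\in X$. Put $\rho'_\alpha(\gamma)=\rho_\alpha(\gamma^{-1})$ and assume $\rho_\alpha\circ\alpha=\rho_\alpha$. Let $\mathcal G_\alpha=(\mathcal G\times\mathbb R)/\big((\gamma,t)\sim(\alpha(\gamma),t-1)\big)$ be the suspension groupoid, with base $X_\alpha=(X\times\mathbb R)/\big((x,t)\sim(\alpha_X(x),t-1)\big)$ and structure maps $r([\gamma,t])=[r(\gamma),t]$, $s([\gamma,t])=[s(\gamma),t]$, $[\gamma,t][\gamma',t]=[\gamma\gamma',t]$, $[\gamma,t]^{-1}=[\gamma^{-1},t]$. Then: 1. $\mathcal G_\alpha$ has a Haar system $\lambda_\alpha$ given by $\lambda_\alpha^{[x,t]}(f)=\int\rho_\alpha(\gamma)^{-t}f([\gamma,t])\,d\lambda^x(\gamma)$. 2. There is a unique automorphism $\tilde\alpha$ of $C^*_r(\mathcal G,\lambda)$ with $\tilde\alpha(f)=(\rho'_\alpha\rho_\alpha)^{1/2}\,f\circ\alpha^{-1}$ for all $f\in C_c(\mathcal G)$. 3. There is a unique isomorphism of $C^*$-algebras $\Lambda_\alpha$ from $C^*_r(\mathcal G_\alpha,\lambda_\alpha)$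 onto the mapping torus $\{h\in C([0,1],C^*_r(\mathcal G,\lambda)) : \tilde\alpha(h(1))=h(0)\}$ such that $\Lambda_\alpha(f)=\hat f$ for all $f\in C_c(\mathcal G_\alpha)$, where $\hat f(t)\in C_c(\mathcal G)$ is $\hat f(t)(\gamma)=\rho_\alpha(\gamma)^{-t/2}\rho'_\alpha(\gamma)^{-t/2}f([\gamma,t])$. 4. For $s\in\mathbb R$ the automorphism $\theta_s:[\gamma,t]\mapsto[\gamma,t+s]$ of $\mathcal G_\alpha$ preserves $\lambda_\alpha$ with density $\rho_{\theta_s}([\gamma,t])=\rho_\alpha(\gamma)^s$. The automorphisms $\tilde\theta_s$ of $C^*_r(\mathcal G_\alpha,\lambda_\alpha)$ given on $C_c(\mathcal G_\alpha)$ by $\tilde\theta_s(f)=(\rho'_{\theta_s}\rho_{\theta_s})^{1/2}f\circ\theta_s^{-1}$, with $\rho'_{\theta_s}(\eta)=\rho_{\theta_s}(\eta^{-1})$, exist and form a strongly continuous action of $\mathbb R$, and $\Lambda_\alpha$ is $\mathbb R$-equivariant for this action and the translation action $(s\cdot h)(t)=h(t-s)$ on the mapping torus, whose elements $h$ are extended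 to $\mathbb R$ by $h(t)=\tilde\alpha(h(t+1))$. -/

import Mathlib

open MeasureTheory Filter Topology
open scoped ENNReal CompactlySupported ComplexConjugate

noncomputable section

set_option linter.unusedSectionVars false

/-- A topological groupoid with space of arrows `G` and base space `X`.  The product `mul g h` is
only meaningful when `s g = r h`; its value on the other pairs is irrelevant.  The base is embedded
in `G` by `unit`. -/
structure TopGroupoid (G X : Type*) [TopologicalSpace G] [TopologicalSpace X] where
  r : G → X
  s : G → X
  unit : X → G
  inv : G → G
  mul : G → G → G
  r_unit : ∀ x, r (unit x) = x
  s_unit : ∀ x, s (unit x) = x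
  r_inv : ∀ g, r (inv g) = s g
  s_inv : ∀ g, s (inv g) = r g
  r_mul : ∀ g h, s g = r h → r (mul g h) = r g
  s_mul : ∀ g h, s g = r h → s (mul g h) = s h
  mul_assoc : ∀ g h k, s g = r h → s h = r k → mul (mul g h) k = mul g (mul h k)
  unit_mul : ∀ g, mul (unit (r g)) g = g
  mul_unit : ∀ g, mul g (unit (s g)) = g
  inv_mul : ∀ g, mul (inv g) g = unit (s g)
  mul_inv : ∀ g, mul g (inv g) = unit (r g)
  continuous_r : Continuous r
  continuous_s : Continuous s
  continuous_unit : Continuous unit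
  continuous_inv : Continuous inv
  continuousOn_mul : ContinuousOn (fun p : G × G => mul p.1 p.2) {p | s p.1 = r p.2}

namespace TopGroupoid

variable {G X : Type*} [TopologicalSpace G] [TopologicalSpace X]

/-- An automorphism of a topological groupoid, together with the homeomorphism of the base that it
induces. -/
structure Aut (𝒢 : TopGroupoid G X) where
  arrow : G ≃ₜ G
  base : X ≃ₜ X
  r_arrow : ∀ g, 𝒢.r (arrow g) = base (𝒢.r g)
  s_arrow : ∀ g, 𝒢.s (arrow g) = base (𝒢.s g)
  arrow_mul : ∀ g h, 𝒢.s g = 𝒢.r h → arrow (𝒢.mul g h) = 𝒢.mul (arrow g) (arrow h)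

variable (𝒢 : TopGroupoid G X)

theorem mul_inv_cancel_right {g h : G} (hgh : 𝒢.s g = 𝒢.r h) :
    𝒢.mul (𝒢.mul g h) (𝒢.inv h) = g := by
  rw [𝒢.mul_assoc g h _ hgh (𝒢.r_inv h).symm, 𝒢.mul_inv, ← hgh, 𝒢.mul_unit]

theorem inv_mul_cancel_left {g h : G} (hgh : 𝒢.s g = 𝒢.r h) :
    𝒢.mul (𝒢.inv g) (𝒢.mul g h) = h := by
  rw [← 𝒢.mul_assoc _ g h (𝒢.s_inv g) hgh, 𝒢.inv_mul, hgh, 𝒢.unit_mul]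

theorem inv_eq_of_mul {g h : G} (hgh : 𝒢.s g = 𝒢.r h) (e : 𝒢.mul g h = 𝒢.unit (𝒢.r g)) :
    𝒢.inv g = h := by
  have := 𝒢.inv_mul_cancel_left hgh
  rw [e, ← 𝒢.s_inv g, 𝒢.mul_unit] at this
  exact this

theorem inv_inv (g : G) : 𝒢.inv (𝒢.inv g) = g :=
  𝒢.inv_eq_of_mul (𝒢.s_inv g) (by rw [𝒢.inv_mul, 𝒢.r_inv])

theorem inv_mul_rev {g h : G} (hgh : 𝒢.s g = 𝒢.r h) :
    𝒢.inv (𝒢.mul g h) = 𝒢.mul (𝒢.inv h) (𝒢.inv g) := by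
  have h1 : 𝒢.s (𝒢.inv h) = 𝒢.r (𝒢.inv g) := by rw [𝒢.s_inv, 𝒢.r_inv, hgh]
  have h2 : 𝒢.s (𝒢.mul g h) = 𝒢.r (𝒢.inv h) := by rw [𝒢.s_mul g h hgh, 𝒢.r_inv]
  refine 𝒢.inv_eq_of_mul ?_ ?_
  · rw [𝒢.r_mul _ _ h1, h2]
  · rw [← 𝒢.mul_assoc _ _ _ h2 h1, 𝒢.mul_inv_cancel_right hgh, 𝒢.mul_inv, 𝒢.r_mul g h hgh]

/-- The inversion as a homeomorphism. -/
def invHomeo : G ≃ₜ G where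
  toFun := 𝒢.inv
  invFun := 𝒢.inv
  left_inv := 𝒢.inv_inv
  right_inv := 𝒢.inv_inv
  continuous_toFun := 𝒢.continuous_inv
  continuous_invFun := 𝒢.continuous_inv

theorem t2_base (𝒢 : TopGroupoid G X) [T2Space G] : T2Space X :=
  T2Space.of_injective_continuous (Function.LeftInverse.injective 𝒢.r_unit) 𝒢.continuous_unit

/-- A Haar system: Radon measures `meas x` with support the range fibre over `x`, depending
continuously on `x`, and invariant under left translations. -/
structure HaarSystem [MeasurableSpace G] (𝒢 : TopGroupoid G X) where
  meas : X → Measure G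
  finite_on_compacts : ∀ x, IsFiniteMeasureOnCompacts (meas x)
  support_eq : ∀ x, (meas x).support = {g | 𝒢.r g = x}
  continuous_integral : ∀ f : C_c(G, ℂ), Continuous fun x => ∫ g, f g ∂(meas x)
  map_mul_left : ∀ g, (meas (𝒢.s g)).map (𝒢.mul g) = meas (𝒢.r g)

attribute [instance] HaarSystem.finite_on_compacts

variable {𝒢}
variable [T2Space G] [LocallyCompactSpace G] [SecondCountableTopology G]
  [MeasurableSpace G] [BorelSpace G]

namespace HaarSystem

/-- The measure `λ_x`, the image of `λ^x` under inversion; it lives on the source fibre. -/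
def fibre (lam : 𝒢.HaarSystem) (x : X) : Measure G := (lam.meas x).map 𝒢.inv

instance (lam : 𝒢.HaarSystem) (x : X) : IsFiniteMeasureOnCompacts (lam.fibre x) := by
  refine ⟨fun K hK => ?_⟩
  rw [fibre, Measure.map_apply 𝒢.continuous_inv.measurable hK.measurableSet]
  exact (𝒢.invHomeo.isCompact_preimage.2 hK).measure_lt_top

variable (lam : 𝒢.HaarSystem)

theorem ae_r (x : X) : ∀ᵐ g ∂(lam.meas x), 𝒢.r g = x := by
  have := Measure.support_mem_ae (μ := lam.meas x)
  rw [lam.support_eq] at this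
  exact this

theorem ae_s (x : X) : ∀ᵐ g ∂(lam.fibre x), 𝒢.s g = x := by
  have := 𝒢.t2_base
  rw [fibre, ae_map_iff 𝒢.continuous_inv.aemeasurable]
  · filter_upwards [lam.ae_r x] with g hg
    rw [𝒢.s_inv, hg]
  · exact (isClosed_singleton.preimage 𝒢.continuous_s).measurableSet

theorem integrable_meas (f : C_c(G, ℂ)) (x : X) : Integrable f (lam.meas x) :=
  f.continuous.integrable_of_hasCompactSupport f.hasCompactSupport

theorem integral_fibre {F : G → ℂ} (hF : Continuous F) (x : X) :
    ∫ g, F g ∂(lam.fibre x) = ∫ g, F (𝒢.inv g) ∂(lam.meas x) := by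
  rw [fibre, integral_map 𝒢.continuous_inv.aemeasurable hF.aestronglyMeasurable]

theorem memLp_fibre (f : C_c(G, ℂ)) (x : X) : MemLp f 2 (lam.fibre x) :=
  f.continuous.memLp_of_hasCompactSupport f.hasCompactSupport

/-- The class in `L²(G_x, λ_x)` of a function with compact support. -/
def toL2 (f : C_c(G, ℂ)) (x : X) : Lp ℂ 2 (lam.fibre x) := (lam.memLp_fibre f x).toLp f

theorem bounded_integral (f : C_c(G, ℂ)) : ∃ C : ℝ, ∀ x, ‖∫ g, f g ∂(lam.meas x)‖ ≤ C := by
  have := 𝒢.t2_base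
  have hc : HasCompactSupport fun x => ∫ g, f g ∂(lam.meas x) := by
    refine HasCompactSupport.intro (f.hasCompactSupport.image 𝒢.continuous_r) fun x hx => ?_
    refine integral_eq_zero_of_ae ?_
    filter_upwards [lam.ae_r x] with g hg
    by_contra h
    exact hx ⟨g, subset_tsupport f (by simpa using h), hg⟩
  exact hc.exists_bound_of_continuous (lam.continuous_integral f)

theorem inner_toL2 (f f' : C_c(G, ℂ)) (x : X) :
    inner ℂ (lam.toL2 f x) (lam.toL2 f' x) = ∫ g, f' g * conj (f g) ∂(lam.fibre x) := by
  rw [L2.inner_def]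
  refine integral_congr_ae ?_
  filter_upwards [(lam.memLp_fibre f x).coeFn_toLp, (lam.memLp_fibre f' x).coeFn_toLp] with g h h'
  simp only [toL2, h, h']
  rfl

theorem memℓp_toL2 (f : C_c(G, ℂ)) : Memℓp (fun x => lam.toL2 f x) ∞ := by
  obtain ⟨C, hC⟩ := lam.bounded_integral
    ⟨⟨fun g => f (𝒢.inv g) * conj (f (𝒢.inv g)), by
      have := 𝒢.continuous_inv
      fun_prop⟩, by
      have : HasCompactSupport (fun g => f (𝒢.inv g)) := f.hasCompactSupport.comp_homeomorph 𝒢.invHomeo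
      exact this.mul_right⟩
  refine memℓp_infty ⟨√C, ?_⟩
  rintro _ ⟨x, rfl⟩
  refine Real.le_sqrt_of_sq_le ?_
  have h1 := inner_self_eq_norm_sq_to_K (𝕜 := ℂ) (lam.toL2 f x)
  rw [inner_toL2, integral_fibre _ (by fun_prop)] at h1
  have h2 := hC x
  simp only [CompactlySupportedContinuousMap.coe_mk, ContinuousMap.coe_mk] at h2
  rw [h1] at h2
  simpa using h2

/-- The product of the Hilbert spaces `L²(G_x, λ_x)`: bounded families, with the norm
`sup_x ‖ξ x‖`. -/
abbrev L2Prod : Type _ := lp (fun x => Lp ℂ 2 (lam.fibre x)) ∞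

/-- A function with compact support, as a family of elements of the spaces `L²(G_x, λ_x)`. -/
def toL2Prod : C_c(G, ℂ) →ₗ[ℂ] lam.L2Prod where
  toFun f := ⟨fun x => lam.toL2 f x, lam.memℓp_toL2 f⟩
  map_add' _ _ := rfl
  map_smul' _ _ := rfl

/-- The Hilbert module `L²(G, λ)`: the completion of `C_c(G)` for the norm
`sup_x ⟨φ, φ⟩(x)^{1/2}`, realized as the closure of `C_c(G)` in the Banach space `L2Prod`, whose
norm restricts to that one. -/
def L2Module : Type _ := (LinearMap.range lam.toL2Prod).topologicalClosure

instance : NormedAddCommGroup lam.L2Module :=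
  inferInstanceAs (NormedAddCommGroup (LinearMap.range lam.toL2Prod).topologicalClosure)

instance : NormedSpace ℂ lam.L2Module :=
  inferInstanceAs (NormedSpace ℂ (LinearMap.range lam.toL2Prod).topologicalClosure)

instance : CompleteSpace lam.L2Module :=
  (Submodule.isClosed_topologicalClosure (LinearMap.range lam.toL2Prod)).completeSpace_coe

/-- The canonical map from `C_c(G)` to `L²(G, λ)`. -/
def ofCc : C_c(G, ℂ) →ₗ[ℂ] lam.L2Module :=
  LinearMap.codRestrict (LinearMap.range lam.toL2Prod).topologicalClosure lam.toL2Prod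
    fun f => subset_closure ⟨f, rfl⟩

theorem denseRange_ofCc : DenseRange lam.ofCc := by
  refine Subtype.dense_iff.2 ?_
  intro ξ hξ
  refine closure_mono ?_ hξ
  rintro _ ⟨f, rfl⟩
  exact ⟨lam.ofCc f, ⟨f, rfl⟩, rfl⟩

/-- The scalar product of `L²(G, λ)`, with values in functions on the base; on `C_c(G)` it is
`⟨φ, φ'⟩(x) = ∫ conj (φ(γ⁻¹)) φ'(γ⁻¹) dλ^x(γ)`. -/
def ip (ξ η : lam.L2Module) (x : X) : ℂ := inner ℂ (ξ.1 x) (η.1 x)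

theorem ip_ofCc (f f' : C_c(G, ℂ)) (x : X) :
    lam.ip (lam.ofCc f) (lam.ofCc f') x =
      ∫ g, conj (f (𝒢.inv g)) * f' (𝒢.inv g) ∂(lam.meas x) := by
  change inner ℂ (lam.toL2 f x) (lam.toL2 f' x) = _
  rw [inner_toL2, integral_fibre _ (by fun_prop)]
  simp only [mul_comm]

theorem norm_ip_le (ξ η : lam.L2Module) (x : X) : ‖lam.ip ξ η x‖ ≤ ‖ξ‖ * ‖η‖ :=
  (norm_inner_le_norm _ _).trans (mul_le_mul (lp.norm_apply_le_norm ENNReal.top_ne_zero ξ.1 x)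
    (lp.norm_apply_le_norm ENNReal.top_ne_zero η.1 x) (norm_nonneg _) (norm_nonneg _))

theorem ip_add_left (ξ ξ' η : lam.L2Module) (x : X) :
    lam.ip (ξ + ξ') η x = lam.ip ξ η x + lam.ip ξ' η x := inner_add_left _ _ _

theorem ip_add_right (ξ η η' : lam.L2Module) (x : X) :
    lam.ip ξ (η + η') x = lam.ip ξ η x + lam.ip ξ η' x := inner_add_right _ _ _

theorem ip_smul_left (c : ℂ) (ξ η : lam.L2Module) (x : X) :
    lam.ip (c • ξ) η x = conj c * lam.ip ξ η x := inner_smul_left _ _ _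

theorem ip_smul_right (c : ℂ) (ξ η : lam.L2Module) (x : X) :
    lam.ip ξ (c • η) x = c * lam.ip ξ η x := inner_smul_right _ _ _

theorem conj_ip (ξ η : lam.L2Module) (x : X) : conj (lam.ip ξ η x) = lam.ip η ξ x :=
  inner_conj_symm _ _

theorem norm_sq_le (ξ : lam.L2Module) {C : ℝ} (h : ∀ x, ‖lam.ip ξ ξ x‖ ≤ C) (hC : 0 ≤ C) :
    ‖ξ‖ ^ 2 ≤ C := by
  have : ‖ξ‖ ≤ √C := by
    refine lp.norm_le_of_forall_le (Real.sqrt_nonneg _) fun x => Real.le_sqrt_of_sq_le ?_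
    have h1 := inner_self_eq_norm_sq_to_K (𝕜 := ℂ) (ξ.1 x)
    have h2 := h x
    rw [ip, h1] at h2
    simpa using h2
  calc ‖ξ‖ ^ 2 ≤ √C ^ 2 := by gcongr
    _ = C := Real.sq_sqrt hC

theorem ext_ip {ξ ξ' : lam.L2Module} (h : ∀ η x, lam.ip ξ η x = lam.ip ξ' η x) : ξ = ξ' := by
  have h1 : ∀ x, lam.ip (ξ - ξ') (ξ - ξ') x = 0 := fun x => by
    have h2 : ∀ η, lam.ip (ξ - ξ') η x = lam.ip ξ η x - lam.ip ξ' η x :=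
      fun η => inner_sub_left _ _ _
    rw [h2, h, sub_self]
  have h3 := lam.norm_sq_le (ξ - ξ') (C := 0) (fun x => by simp [h1]) le_rfl
  exact sub_eq_zero.1 (norm_eq_zero.1 (pow_eq_zero_iff two_ne_zero |>.1
    (le_antisymm h3 (sq_nonneg _))))

/-- The operator `S` is an adjoint of `T` for the scalar product of `L²(G, λ)`. -/
def IsAdjoint (T S : lam.L2Module →L[ℂ] lam.L2Module) : Prop :=
  ∀ ξ η x, lam.ip (S ξ) η x = lam.ip ξ (T η) x

variable {lam} in
theorem IsAdjoint.symm {T S : lam.L2Module →L[ℂ] lam.L2Module} (h : lam.IsAdjoint T S) :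
    lam.IsAdjoint S T := fun ξ η x => by
  rw [← lam.conj_ip, ← h, lam.conj_ip]

variable {lam} in
theorem IsAdjoint.unique {T S S' : lam.L2Module →L[ℂ] lam.L2Module} (h : lam.IsAdjoint T S)
    (h' : lam.IsAdjoint T S') : S = S' :=
  ContinuousLinearMap.ext fun ξ => lam.ext_ip fun η x => by rw [h, h']

/-- The algebra of adjointable operators of `L²(G, λ)`, with the operator norm. -/
def adjointableSubalgebra : Subalgebra ℂ (lam.L2Module →L[ℂ] lam.L2Module) where
  carrier := {T | ∃ S, lam.IsAdjoint T S}
  mul_mem' := by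
    rintro T T' ⟨S, h⟩ ⟨S', h'⟩
    exact ⟨S' * S, fun ξ η x => (h' _ _ x).trans (h _ _ x)⟩
  add_mem' := by
    rintro T T' ⟨S, h⟩ ⟨S', h'⟩
    exact ⟨S + S', fun ξ η x => by
      simp only [add_apply, ip_add_left, ip_add_right, h ξ, h' ξ]⟩
  algebraMap_mem' c := ⟨conj c • 1, fun ξ η x => by
    simp [Algebra.algebraMap_eq_smul_one, ip_smul_left, ip_smul_right]⟩

/-- The algebra of adjointable operators, as a type. -/
def Adjointable : Type _ := lam.adjointableSubalgebra

instance : NormedRing lam.Adjointable := inferInstanceAs (NormedRing lam.adjointableSubalgebra)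

instance : NormedAlgebra ℂ lam.Adjointable :=
  inferInstanceAs (NormedAlgebra ℂ lam.adjointableSubalgebra)

/-- The adjoint of an adjointable operator. -/
instance : Star lam.Adjointable where
  star T := ⟨T.2.choose, T.1, T.2.choose_spec.symm⟩

variable {lam} in
theorem isAdjoint_star (T : lam.Adjointable) : lam.IsAdjoint T.1 (star T).1 := T.2.choose_spec

variable {lam} in
theorem star_eq {T S : lam.Adjointable} (h : lam.IsAdjoint T.1 S.1) : star T = S :=
  Subtype.ext ((isAdjoint_star T).unique h)

instance : StarRing lam.Adjointable where
  star_involutive T := star_eq (isAdjoint_star T).symm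
  star_mul T T' := star_eq fun ξ η x =>
    (isAdjoint_star T' _ _ x).trans (isAdjoint_star T _ _ x)
  star_add T T' := star_eq fun ξ η x => by
    have h := isAdjoint_star T ξ η x
    have h' := isAdjoint_star T' ξ η x
    change lam.ip ((star T).1 ξ + (star T').1 ξ) η x = lam.ip ξ (T.1 η + T'.1 η) x
    rw [ip_add_left, ip_add_right, h, h']

instance : StarModule ℂ lam.Adjointable where
  star_smul c T := star_eq fun ξ η x => by
    have h := isAdjoint_star T ξ η x
    change lam.ip (conj c • (star T).1 ξ) η x = lam.ip ξ (c • T.1 η) x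
    rw [ip_smul_left, ip_smul_right, h, Complex.conj_conj]

theorem norm_sq_apply_le (T : lam.Adjointable) (ξ : lam.L2Module) :
    ‖T.1 ξ‖ ^ 2 ≤ ‖(star T * T).1‖ * ‖ξ‖ ^ 2 := by
  refine lam.norm_sq_le _ (fun x => ?_) (by positivity)
  rw [← isAdjoint_star T]
  have h1 : ‖(star T).1 (T.1 ξ)‖ ≤ ‖(star T * T).1‖ * ‖ξ‖ := (star T * T).1.le_opNorm ξ
  calc ‖lam.ip ((star T).1 (T.1 ξ)) ξ x‖ ≤ ‖(star T).1 (T.1 ξ)‖ * ‖ξ‖ := lam.norm_ip_le _ _ _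
    _ ≤ (‖(star T * T).1‖ * ‖ξ‖) * ‖ξ‖ := mul_le_mul_of_nonneg_right h1 (norm_nonneg _)
    _ = ‖(star T * T).1‖ * ‖ξ‖ ^ 2 := by ring

instance : CStarRing lam.Adjointable where
  norm_mul_self_le T := by
    have h0 : ‖T.1‖ ≤ √‖(star T * T).1‖ := by
      refine ContinuousLinearMap.opNorm_le_bound _ (Real.sqrt_nonneg _) fun ξ => ?_
      refine (Real.le_sqrt_of_sq_le (lam.norm_sq_apply_le T ξ)).trans_eq ?_
      exact (Real.sqrt_mul (norm_nonneg _) _).trans (by rw [Real.sqrt_sq (norm_nonneg ξ)])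
    exact (mul_self_le_mul_self (norm_nonneg _) h0).trans_eq (Real.mul_self_sqrt (norm_nonneg _))

/-! ### Convolution -/

/-- Integrals against a Haar system depend continuously on parameters. -/
theorem continuousAt_integral {P : Type*} [TopologicalSpace P] {b : P → X} (hb : Continuous b)
    {F : G → P → ℂ} (hF : Continuous fun q : G × P => F q.1 q.2) {p₀ : P} {K : Set G}
    (hK : IsCompact K) (hFK : ∀ᶠ p in 𝓝 p₀, ∀ g ∉ K, F g p = 0) :
    ContinuousAt (fun p => ∫ g, F g p ∂(lam.meas (b p))) p₀ := by
  obtain ⟨χ, hχ1, -, hχc, hχ0⟩ := exists_continuous_one_zero_of_isCompact hK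
    isClosed_empty (Set.disjoint_empty K)
  have hχ0' : ∀ g, 0 ≤ χ g := fun g => (hχ0 g).1
  let χ' : C_c(G, ℂ) := ⟨⟨fun g => (χ g : ℂ), by fun_prop⟩, hχc.comp_left Complex.ofReal_zero⟩
  obtain ⟨C, hC⟩ := lam.bounded_integral χ'
  have hχint : ∀ x, Integrable χ (lam.meas x) := fun x =>
    χ.continuous.integrable_of_hasCompactSupport hχc
  have hC' : ∀ x, ∫ g, χ g ∂(lam.meas x) ≤ C := fun x => by
    have := hC x
    have h2 : ∫ g, χ' g ∂(lam.meas x) = ((∫ g, χ g ∂(lam.meas x) : ℝ) : ℂ) := integral_ofReal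
    rw [h2, Complex.norm_real] at this
    exact (le_abs_self _).trans this
  have hFc : ∀ p, (∀ g ∉ K, F g p = 0) → HasCompactSupport fun g => F g p := fun p hp =>
    HasCompactSupport.intro hK hp
  have hFp : ∀ p, Continuous fun g => F g p := fun p =>
    hF.comp (continuous_id.prodMk continuous_const)
  have hp₀ := hFK.self_of_nhds
  let F₀ : C_c(G, ℂ) := ⟨⟨fun g => F g p₀, hFp p₀⟩, hFc p₀ hp₀⟩
  have h1 : Tendsto (fun p => ∫ g, F g p₀ ∂(lam.meas (b p))) (𝓝 p₀)
      (𝓝 (∫ g, F g p₀ ∂(lam.meas (b p₀)))) :=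
    ((lam.continuous_integral F₀).comp hb).continuousAt
  have h2 : Tendsto (fun p => ∫ g, F g p ∂(lam.meas (b p)) - ∫ g, F g p₀ ∂(lam.meas (b p)))
      (𝓝 p₀) (𝓝 0) := by
    rw [Metric.tendsto_nhds]
    intro ε hε
    have hδ : 0 < ε / (|C| + 1) := by positivity
    have h3 : ∀ᶠ p in 𝓝 p₀, ∀ g ∈ K, ‖F g p - F g p₀‖ < ε / (|C| + 1) := by
      refine hK.eventually_forall_of_forall_eventually fun g hg => ?_
      have hc : Continuous fun q : P × G => ‖F q.2 q.1 - F q.2 p₀‖ := by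
        have h4 : Continuous fun q : P × G => F q.2 q.1 :=
          hF.comp (continuous_snd.prodMk continuous_fst)
        have h5 : Continuous fun q : P × G => F q.2 p₀ :=
          hF.comp (continuous_snd.prodMk continuous_const)
        exact (h4.sub h5).norm
      exact hc.continuousAt.eventually_lt continuousAt_const (by simpa using hδ)
    filter_upwards [h3, hFK] with p hp hpK
    rw [dist_zero_right, ← integral_sub ((hFp p).integrable_of_hasCompactSupport (hFc p hpK))
      ((hFp p₀).integrable_of_hasCompactSupport (hFc p₀ hp₀))]
    calc ‖∫ g, F g p - F g p₀ ∂(lam.meas (b p))‖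
        ≤ ∫ g, ε / (|C| + 1) * χ g ∂(lam.meas (b p)) := by
          refine norm_integral_le_of_norm_le ((hχint _).const_mul _) (Eventually.of_forall fun g => ?_)
          by_cases hg : g ∈ K
          · rw [hχ1 hg]; simpa using (hp g hg).le
          · rw [hpK g hg, hp₀ g hg]; simpa using mul_nonneg hδ.le (hχ0' g)
      _ = ε / (|C| + 1) * ∫ g, χ g ∂(lam.meas (b p)) := integral_const_mul _ _
      _ ≤ ε / (|C| + 1) * |C| := by gcongr; exact (hC' _).trans (le_abs_self C)
      _ < ε := by
          rw [div_mul_eq_mul_div, div_lt_iff₀ (by positivity)]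
          nlinarith [abs_nonneg C]
  have := h2.add h1
  simpa [ContinuousAt] using this

/-- The convolution product of two functions on a groupoid. -/
def convFun (f φ : G → ℂ) (g : G) : ℂ :=
  ∫ g', f g' * φ (𝒢.mul (𝒢.inv g') g) ∂(lam.meas (𝒢.r g))

/-- A globally continuous integrand for the convolution product. -/
theorem exists_conv_integrand (f φ : C_c(G, ℂ)) : ∃ (F : G → G → ℂ) (K : Set G), IsCompact K ∧
    Continuous (fun q : G × G => F q.1 q.2) ∧ (∀ g g', g' ∉ K → F g' g = 0) ∧
    ∀ g g', 𝒢.r g' = 𝒢.r g → F g' g = f g' * φ (𝒢.mul (𝒢.inv g') g) := by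
  have := 𝒢.t2_base
  obtain ⟨χ, hχ1, -, hχc, -⟩ := exists_continuous_one_zero_of_isCompact
    f.hasCompactSupport.isCompact isClosed_empty (Set.disjoint_empty (tsupport f))
  let S : Set (G × G) := {q | 𝒢.r q.1 = 𝒢.r q.2}
  have hS : IsClosed S := isClosed_eq (𝒢.continuous_r.comp continuous_fst)
    (𝒢.continuous_r.comp continuous_snd)
  have hcont : ContinuousOn (fun q : G × G => f q.1 * φ (𝒢.mul (𝒢.inv q.1) q.2)) S := by
    refine (f.continuous.comp continuous_fst).continuousOn.mul
      (φ.continuous.comp_continuousOn ?_)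
    exact 𝒢.continuousOn_mul.comp (f := fun q : G × G => (𝒢.inv q.1, q.2))
      ((𝒢.continuous_inv.comp continuous_fst).prodMk continuous_snd).continuousOn
      fun q hq => (𝒢.s_inv q.1).trans hq
  obtain ⟨H, hH⟩ := ContinuousMap.exists_restrict_eq hS
    (⟨S.domRestrict fun q : G × G => f q.1 * φ (𝒢.mul (𝒢.inv q.1) q.2), hcont.domRestrict⟩ :
      C(S, ℂ))
  refine ⟨fun g' g => (χ g' : ℂ) * H (g', g), tsupport χ, hχc.isCompact, by fun_prop,
    fun g g' hg => by simp [image_eq_zero_of_notMem_tsupport hg], fun g g' hg => ?_⟩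
  have h1 : H (g', g) = f g' * φ (𝒢.mul (𝒢.inv g') g) :=
    DFunLike.congr_fun hH (⟨(g', g), hg⟩ : S)
  by_cases h : g' ∈ tsupport f
  · simp [h1, hχ1 h]
  · simp [h1, image_eq_zero_of_notMem_tsupport h]

theorem integrable_conv (f φ : C_c(G, ℂ)) (g : G) :
    Integrable (fun g' => f g' * φ (𝒢.mul (𝒢.inv g') g)) (lam.meas (𝒢.r g)) := by
  obtain ⟨F, K, hK, hF, hFK, hFe⟩ := exists_conv_integrand (𝒢 := 𝒢) f φ
  have h1 : Integrable (fun g' => F g' g) (lam.meas (𝒢.r g)) :=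
    (hF.comp (by fun_prop : Continuous fun g' : G => (g', g))).integrable_of_hasCompactSupport
      (HasCompactSupport.intro hK (hFK g))
  refine h1.congr ?_
  filter_upwards [lam.ae_r (𝒢.r g)] with g' hg'
  exact hFe g g' hg'

theorem continuous_convFun (f φ : C_c(G, ℂ)) : Continuous (lam.convFun f φ) := by
  obtain ⟨F, K, hK, hF, hFK, hFe⟩ := exists_conv_integrand (𝒢 := 𝒢) f φ
  have h1 : lam.convFun f φ = fun g => ∫ g', F g' g ∂(lam.meas (𝒢.r g)) := by
    funext g
    refine integral_congr_ae ?_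
    filter_upwards [lam.ae_r (𝒢.r g)] with g' hg'
    exact (hFe g g' hg').symm
  rw [h1]
  exact continuous_iff_continuousAt.2 fun g₀ => lam.continuousAt_integral 𝒢.continuous_r hF hK
    (Eventually.of_forall fun g => hFK g)

theorem hasCompactSupport_convFun (f φ : C_c(G, ℂ)) : HasCompactSupport (lam.convFun f φ) := by
  have := 𝒢.t2_base
  let S : Set (G × G) := {q | 𝒢.s q.1 = 𝒢.r q.2}
  have hS : IsClosed S := isClosed_eq (𝒢.continuous_s.comp continuous_fst)
    (𝒢.continuous_r.comp continuous_snd)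
  have hK : IsCompact ((tsupport f ×ˢ tsupport φ) ∩ S) :=
    (f.hasCompactSupport.isCompact.prod φ.hasCompactSupport.isCompact).inter_right hS
  refine HasCompactSupport.intro (hK.image_of_continuousOn
    (𝒢.continuousOn_mul.mono Set.inter_subset_right)) fun g hg => ?_
  refine integral_eq_zero_of_ae ?_
  filter_upwards [lam.ae_r (𝒢.r g)] with g' hg'
  by_contra h
  have h' := mul_ne_zero_iff.1 h
  have hs : 𝒢.s (𝒢.inv g') = 𝒢.r g := (𝒢.s_inv g').trans hg'
  refine hg ⟨(g', 𝒢.mul (𝒢.inv g') g), ⟨⟨subset_tsupport f h'.1, subset_tsupport φ h'.2⟩, ?_⟩, ?_⟩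
  · change 𝒢.s g' = 𝒢.r (𝒢.mul (𝒢.inv g') g)
    rw [𝒢.r_mul _ _ hs, 𝒢.r_inv]
  · have := 𝒢.inv_mul_cancel_left hs
    rwa [𝒢.inv_inv] at this

/-- Left convolution by `f`, as a linear map of `C_c(G)`. -/
def conv (f : C_c(G, ℂ)) : C_c(G, ℂ) →ₗ[ℂ] C_c(G, ℂ) where
  toFun φ := ⟨⟨lam.convFun f φ, lam.continuous_convFun f φ⟩, lam.hasCompactSupport_convFun f φ⟩
  map_add' φ φ' := by
    ext g
    have := integral_add (lam.integrable_conv f φ g) (lam.integrable_conv f φ' g)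
    simp only [← mul_add] at this
    exact this
  map_smul' c φ := by
    ext g
    have := integral_const_mul (μ := lam.meas (𝒢.r g)) c
      (fun g' => f g' * φ (𝒢.mul (𝒢.inv g') g))
    simp only [mul_left_comm c] at this
    exact this

/-- The involution `f^*(γ) = conj (f(γ⁻¹))` of `C_c(G)`. -/
def involution (𝒢 : TopGroupoid G X) (f : C_c(G, ℂ)) : C_c(G, ℂ) :=
  ⟨⟨fun g => conj (f (𝒢.inv g)), by have := 𝒢.continuous_inv; fun_prop⟩,
    (f.hasCompactSupport.comp_homeomorph 𝒢.invHomeo).comp_left (map_zero _)⟩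

theorem aemeasurable_translate {g : G} {x : X} (hg : 𝒢.s g = x) :
    AEMeasurable (fun h => 𝒢.mul g (𝒢.inv h)) (lam.fibre x) := by
  have := 𝒢.t2_base
  have hS : MeasurableSet {h | 𝒢.s h = x} :=
    (isClosed_singleton.preimage 𝒢.continuous_s).measurableSet
  rw [← Measure.restrict_eq_self_of_ae_mem (lam.ae_s x)]
  refine ContinuousOn.aemeasurable ?_ hS
  exact 𝒢.continuousOn_mul.comp (f := fun h : G => (g, 𝒢.inv h))
    (continuous_const.prodMk 𝒢.continuous_inv).continuousOn
    fun h hh => hg.trans (hh.symm.trans (𝒢.r_inv h).symm)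

theorem aemeasurable_mul (g : G) : AEMeasurable (𝒢.mul g) (lam.meas (𝒢.s g)) := by
  have := 𝒢.t2_base
  have hS : MeasurableSet {h | 𝒢.r h = 𝒢.s g} :=
    (isClosed_singleton.preimage 𝒢.continuous_r).measurableSet
  rw [← Measure.restrict_eq_self_of_ae_mem (lam.ae_r (𝒢.s g))]
  refine ContinuousOn.aemeasurable ?_ hS
  exact 𝒢.continuousOn_mul.comp (f := fun h : G => (g, h))
    (continuous_const.prodMk continuous_id).continuousOn fun h hh => hh.symm

theorem map_translate {g : G} {x : X} (hg : 𝒢.s g = x) :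
    (lam.fibre x).map (fun h => 𝒢.mul g (𝒢.inv h)) = lam.meas (𝒢.r g) := by
  have h1 : lam.meas x = (lam.fibre x).map 𝒢.inv := by
    rw [fibre, Measure.map_map 𝒢.continuous_inv.measurable 𝒢.continuous_inv.measurable]
    have : 𝒢.inv ∘ 𝒢.inv = id := funext 𝒢.inv_inv
    rw [this, Measure.map_id]
  rw [← lam.map_mul_left g, hg, h1, AEMeasurable.map_map_of_aemeasurable _
    𝒢.continuous_inv.aemeasurable]
  · rfl
  · rw [← h1, ← hg]; exact lam.aemeasurable_mul g

/-- The kernel of the convolution by `f` on the source fibre over `x`. -/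
def kernel (𝒢 : TopGroupoid G X) (f : G → ℂ) (x : X) (g h : G) : ℂ :=
  Set.indicator {q : G × G | 𝒢.s q.1 = x ∧ 𝒢.s q.2 = x} (fun q => f (𝒢.mul q.1 (𝒢.inv q.2))) (g, h)

theorem kernel_eq (f : G → ℂ) {x : X} {g h : G} (hg : 𝒢.s g = x) (hh : 𝒢.s h = x) :
    kernel 𝒢 f x g h = f (𝒢.mul g (𝒢.inv h)) :=
  Set.indicator_of_mem (s := {q : G × G | 𝒢.s q.1 = x ∧ 𝒢.s q.2 = x}) ⟨hg, hh⟩ _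

theorem kernel_eq_zero (f : G → ℂ) {x : X} {g h : G} (hg : ¬ (𝒢.s g = x ∧ 𝒢.s h = x)) :
    kernel 𝒢 f x g h = 0 :=
  Set.indicator_of_notMem (s := {q : G × G | 𝒢.s q.1 = x ∧ 𝒢.s q.2 = x}) hg _

theorem measurable_kernel (f : C_c(G, ℂ)) (x : X) :
    Measurable fun q : G × G => kernel 𝒢 f x q.1 q.2 := by
  have := 𝒢.t2_base
  have hS : IsClosed {q : G × G | 𝒢.s q.1 = x ∧ 𝒢.s q.2 = x} :=
    (isClosed_singleton.preimage (𝒢.continuous_s.comp continuous_fst)).inter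
      (isClosed_singleton.preimage (𝒢.continuous_s.comp continuous_snd))
  have hc : ContinuousOn (fun q : G × G => f (𝒢.mul q.1 (𝒢.inv q.2)))
      {q : G × G | 𝒢.s q.1 = x ∧ 𝒢.s q.2 = x} :=
    f.continuous.comp_continuousOn <|
      𝒢.continuousOn_mul.comp (f := fun q : G × G => (q.1, 𝒢.inv q.2))
      (continuous_fst.prodMk (𝒢.continuous_inv.comp continuous_snd)).continuousOn
      fun q hq => hq.1.trans (hq.2.symm.trans (𝒢.r_inv q.2).symm)
  refine measurable_of_restrict_of_restrict_compl hS.measurableSet ?_ ?_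
  · have : Set.domRestrict {q : G × G | 𝒢.s q.1 = x ∧ 𝒢.s q.2 = x}
        (fun q : G × G => kernel 𝒢 f x q.1 q.2) =
        Set.domRestrict _ (fun q : G × G => f (𝒢.mul q.1 (𝒢.inv q.2))) :=
      funext fun q => kernel_eq f q.2.1 q.2.2
    rw [this]
    exact hc.domRestrict.measurable
  · have : Set.domRestrict {q : G × G | 𝒢.s q.1 = x ∧ 𝒢.s q.2 = x}ᶜ
        (fun q : G × G => kernel 𝒢 f x q.1 q.2) = fun _ => 0 :=
      funext fun q => kernel_eq_zero f q.2
    rw [this]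
    exact measurable_const

theorem kernel_involution (f : C_c(G, ℂ)) (x : X) (g h : G) :
    kernel 𝒢 (involution 𝒢 f) x g h = conj (kernel 𝒢 f x h g) := by
  by_cases hgh : 𝒢.s g = x ∧ 𝒢.s h = x
  · rw [kernel_eq _ hgh.1 hgh.2, kernel_eq _ hgh.2 hgh.1]
    change conj (f _) = _
    rw [𝒢.inv_mul_rev (by rw [𝒢.r_inv, hgh.1, hgh.2]), 𝒢.inv_inv]
  · rw [kernel_eq_zero _ hgh, kernel_eq_zero _ (fun h' => hgh h'.symm), map_zero]

theorem convFun_eq (f φ : C_c(G, ℂ)) {x : X} {g : G} (hg : 𝒢.s g = x) :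
    lam.convFun f φ g = ∫ h, kernel 𝒢 f x g h * φ h ∂(lam.fibre x) := by
  rw [convFun, ← lam.map_translate hg, integral_map (lam.aemeasurable_translate hg)]
  · refine integral_congr_ae ?_
    filter_upwards [lam.ae_s x] with h hh
    have h1 : 𝒢.s g = 𝒢.r (𝒢.inv h) := by rw [𝒢.r_inv, hg, hh]
    rw [kernel_eq _ hg hh, 𝒢.inv_mul_rev h1, 𝒢.inv_inv,
      𝒢.mul_assoc _ _ _ (by rw [𝒢.r_inv, hg, hh]) (𝒢.s_inv g), 𝒢.inv_mul, hg, ← hh, 𝒢.mul_unit]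
  · rw [lam.map_translate hg]
    exact (lam.integrable_conv f φ g).aestronglyMeasurable

/-- A uniform bound for the integrals of `‖f‖` over the range fibres. -/
theorem exists_lintegral_bound (f : C_c(G, ℂ)) :
    ∃ C : NNReal, ∀ x, ∫⁻ g, ‖f g‖ₑ ∂(lam.meas x) ≤ C := by
  obtain ⟨C, hC⟩ := lam.bounded_integral
    ⟨⟨fun g => (‖f g‖ : ℂ), by fun_prop⟩, f.hasCompactSupport.norm.comp_left Complex.ofReal_zero⟩
  refine ⟨C.toNNReal, fun x => ?_⟩
  have h1 := hC x
  have h2 : ∫ g, ((‖f g‖ : ℝ) : ℂ) ∂(lam.meas x) = ((∫ g, ‖f g‖ ∂(lam.meas x) : ℝ) : ℂ) :=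
    integral_ofReal
  simp only [CompactlySupportedContinuousMap.coe_mk, ContinuousMap.coe_mk] at h1
  rw [h2, Complex.norm_real] at h1
  rw [← ofReal_integral_norm_eq_lintegral_enorm (lam.integrable_meas f x)]
  exact ENNReal.ofReal_le_ofReal ((le_abs_self _).trans h1)

theorem exists_kernel_bound (f : C_c(G, ℂ)) :
    ∃ C : NNReal, ∀ x g, ∫⁻ h, ‖kernel 𝒢 f x g h‖ₑ ∂(lam.fibre x) ≤ C := by
  obtain ⟨C, hC⟩ := lam.exists_lintegral_bound f
  refine ⟨C, fun x g => ?_⟩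
  by_cases hg : 𝒢.s g = x
  · refine le_trans (le_of_eq ?_) (hC (𝒢.r g))
    rw [← lam.map_translate hg, lintegral_map' (by fun_prop) (lam.aemeasurable_translate hg)]
    refine lintegral_congr_ae ?_
    filter_upwards [lam.ae_s x] with h hh
    rw [kernel_eq _ hg hh]
  · have : ∀ h, kernel 𝒢 f x g h = 0 := fun h => kernel_eq_zero _ fun h' => hg h'.1
    simp [this]

theorem exists_conv_bound (f : C_c(G, ℂ)) : ∃ C : NNReal, ∀ (φ : C_c(G, ℂ)) (x : X),
    ∫⁻ g, ‖lam.convFun f φ g‖ₑ ^ (2 : ℝ) ∂(lam.fibre x) ≤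
      (C : ℝ≥0∞) ^ (2 : ℝ) * ∫⁻ g, ‖φ g‖ₑ ^ (2 : ℝ) ∂(lam.fibre x) := by
  obtain ⟨C₁, hC₁⟩ := lam.exists_kernel_bound f
  obtain ⟨C₂, hC₂⟩ := lam.exists_kernel_bound (involution 𝒢 f)
  refine ⟨C₁ + C₂, fun φ x => ?_⟩
  have hk := measurable_kernel (𝒢 := 𝒢) f x
  have hkg : ∀ g, Measurable fun h => kernel 𝒢 f x g h := fun g =>
    hk.comp (measurable_const.prodMk measurable_id)
  have hkh : ∀ h, Measurable fun g => kernel 𝒢 f x g h := fun h =>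
    hk.comp (measurable_id.prodMk measurable_const)
  have hφ : Measurable φ := φ.continuous.measurable
  have h1 : ∀ g, (∫⁻ h, ‖kernel 𝒢 f x g h‖ₑ * ‖φ h‖ₑ ∂(lam.fibre x)) ^ (2 : ℝ) ≤
      C₁ * ∫⁻ h, ‖kernel 𝒢 f x g h‖ₑ * ‖φ h‖ₑ ^ (2 : ℝ) ∂(lam.fibre x) := fun g => by
    have h2 := ENNReal.lintegral_mul_le_Lp_mul_Lq (lam.fibre x) Real.HolderConjugate.two_two
      (f := fun h => ‖kernel 𝒢 f x g h‖ₑ ^ (1 / 2 : ℝ))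
      (g := fun h => ‖kernel 𝒢 f x g h‖ₑ ^ (1 / 2 : ℝ) * ‖φ h‖ₑ)
      ((hkg g).enorm.pow_const _).aemeasurable
      (((hkg g).enorm.pow_const _).mul hφ.enorm).aemeasurable
    have e1 : ∀ a : ℝ≥0∞, a ^ (1 / 2 : ℝ) * a ^ (1 / 2 : ℝ) = a := fun a => by
      rw [← ENNReal.rpow_add_of_nonneg _ _ (by norm_num) (by norm_num)]; norm_num
    have e2 : ∀ a : ℝ≥0∞, (a ^ (1 / 2 : ℝ)) ^ (2 : ℝ) = a := fun a => by
      rw [← ENNReal.rpow_mul]; norm_num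
    simp only [Pi.mul_apply, ← _root_.mul_assoc, e1, ENNReal.mul_rpow_of_nonneg _ _ zero_le_two,
      e2] at h2
    calc _ ≤ _ := ENNReal.rpow_le_rpow h2 zero_le_two
      _ = (∫⁻ h, ‖kernel 𝒢 f x g h‖ₑ ∂(lam.fibre x)) *
          ∫⁻ h, ‖kernel 𝒢 f x g h‖ₑ * ‖φ h‖ₑ ^ (2 : ℝ) ∂(lam.fibre x) := by
        rw [ENNReal.mul_rpow_of_nonneg _ _ zero_le_two, e2, e2]
      _ ≤ _ := by gcongr; exact hC₁ x g
  calc ∫⁻ g, ‖lam.convFun f φ g‖ₑ ^ (2 : ℝ) ∂(lam.fibre x)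
      ≤ ∫⁻ g, C₁ * ∫⁻ h, ‖kernel 𝒢 f x g h‖ₑ * ‖φ h‖ₑ ^ (2 : ℝ) ∂(lam.fibre x) ∂(lam.fibre x) := by
        refine lintegral_mono_ae ?_
        filter_upwards [lam.ae_s x] with g hg
        refine le_trans (ENNReal.rpow_le_rpow ?_ zero_le_two) (h1 g)
        rw [lam.convFun_eq f φ hg]
        refine (enorm_integral_le_lintegral_enorm _).trans (le_of_eq ?_)
        simp only [enorm_mul]
    _ = C₁ * ∫⁻ h, ∫⁻ g, ‖kernel 𝒢 f x g h‖ₑ * ‖φ h‖ₑ ^ (2 : ℝ) ∂(lam.fibre x) ∂(lam.fibre x) := by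
        rw [lintegral_const_mul' _ _ ENNReal.coe_ne_top, lintegral_lintegral_swap]
        exact (hk.enorm.mul ((hφ.comp measurable_snd).enorm.pow_const _)).aemeasurable
    _ ≤ C₁ * ∫⁻ h, C₂ * ‖φ h‖ₑ ^ (2 : ℝ) ∂(lam.fibre x) := by
        gcongr with h
        rw [lintegral_mul_const _ ((hkh h).enorm)]
        gcongr
        refine le_trans (le_of_eq ?_) (hC₂ x h)
        simp only [kernel_involution, RCLike.enorm_conj]
    _ = (C₁ * C₂) * ∫⁻ h, ‖φ h‖ₑ ^ (2 : ℝ) ∂(lam.fibre x) := by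
        rw [lintegral_const_mul' _ _ ENNReal.coe_ne_top, _root_.mul_assoc]
    _ ≤ _ := by
        gcongr
        rw [ENNReal.rpow_two, sq]
        push_cast
        gcongr
        · exact le_self_add
        · exact le_add_self

theorem norm_ofCc_conv_le (f : C_c(G, ℂ)) :
    ∃ C : ℝ, ∀ φ, ‖lam.ofCc (lam.conv f φ)‖ ≤ C * ‖lam.ofCc φ‖ := by
  obtain ⟨C, hC⟩ := lam.exists_conv_bound f
  refine ⟨C, fun φ => lp.norm_le_of_forall_le (by positivity) fun x => ?_⟩
  have h1 : ‖lam.toL2 φ x‖ ≤ ‖lam.ofCc φ‖ :=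
    lp.norm_apply_le_norm ENNReal.top_ne_zero (lam.toL2Prod φ) x
  refine le_trans ?_ (mul_le_mul_of_nonneg_left h1 C.2)
  change ‖lam.toL2 (lam.conv f φ) x‖ ≤ _
  rw [toL2, toL2, Lp.norm_toLp, Lp.norm_toLp,
    eLpNorm_eq_lintegral_rpow_enorm_toReal two_ne_zero ENNReal.ofNat_ne_top,
    eLpNorm_eq_lintegral_rpow_enorm_toReal two_ne_zero ENNReal.ofNat_ne_top]
  have h2 := ENNReal.rpow_le_rpow (hC φ x) (by norm_num : (0 : ℝ) ≤ 1 / 2)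
  have e : ((C : ℝ≥0∞) ^ (2 : ℝ)) ^ (1 / 2 : ℝ) = C := by rw [← ENNReal.rpow_mul]; norm_num
  have hfin : (∫⁻ g, ‖φ g‖ₑ ^ (2 : ℝ) ∂(lam.fibre x)) ^ (1 / 2 : ℝ) ≠ ∞ := by
    have h3 := (lam.memLp_fibre φ x).eLpNorm_ne_top
    rwa [eLpNorm_eq_lintegral_rpow_enorm_toReal two_ne_zero ENNReal.ofNat_ne_top] at h3
  rw [ENNReal.mul_rpow_of_nonneg _ _ (by norm_num), e] at h2
  have h4 := ENNReal.toReal_mono (ENNReal.mul_ne_top ENNReal.coe_ne_top hfin) h2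
  rw [ENNReal.toReal_mul, ENNReal.coe_toReal] at h4
  exact h4

theorem ip_conv (f φ ψ : C_c(G, ℂ)) (x : X) :
    lam.ip (lam.ofCc (lam.conv (involution 𝒢 f) φ)) (lam.ofCc ψ) x =
      lam.ip (lam.ofCc φ) (lam.ofCc (lam.conv f ψ)) x := by
  have hk := measurable_kernel (𝒢 := 𝒢) f x
  have hφ : Measurable φ := φ.continuous.measurable
  have hψ : Measurable ψ := ψ.continuous.measurable
  change inner ℂ (lam.toL2 _ x) (lam.toL2 ψ x) = inner ℂ (lam.toL2 φ x) (lam.toL2 _ x)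
  rw [inner_toL2, inner_toL2]
  have e1 : ∫ g, ψ g * conj (lam.conv (involution 𝒢 f) φ g) ∂(lam.fibre x) =
      ∫ g, ∫ h, conj (φ h) * kernel 𝒢 f x h g * ψ g ∂(lam.fibre x) ∂(lam.fibre x) := by
    refine integral_congr_ae ?_
    filter_upwards [lam.ae_s x] with g hg
    change ψ g * conj (lam.convFun _ φ g) = _
    rw [lam.convFun_eq _ φ hg, ← integral_conj, ← integral_const_mul]
    refine integral_congr_ae (Eventually.of_forall fun h => ?_)
    simp only [kernel_involution, map_mul, Complex.conj_conj]
    ring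
  have e2 : ∫ h, lam.conv f ψ h * conj (φ h) ∂(lam.fibre x) =
      ∫ h, ∫ g, conj (φ h) * kernel 𝒢 f x h g * ψ g ∂(lam.fibre x) ∂(lam.fibre x) := by
    refine integral_congr_ae ?_
    filter_upwards [lam.ae_s x] with h hh
    change lam.convFun _ ψ h * conj (φ h) = _
    rw [lam.convFun_eq _ ψ hh, ← integral_mul_const]
    refine integral_congr_ae (Eventually.of_forall fun g => ?_)
    ring
  rw [e1, e2]
  refine (integral_integral_swap (f := fun h g => conj (φ h) * kernel 𝒢 f x h g * ψ g) ?_).symm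
  have hm : Measurable (Function.uncurry fun h g => conj (φ h) * kernel 𝒢 f x h g * ψ g) :=
    ((Complex.continuous_conj.measurable.comp (hφ.comp measurable_fst)).mul hk).mul
      (hψ.comp measurable_snd)
  refine ⟨hm.aestronglyMeasurable, ?_⟩
  obtain ⟨C, hC⟩ := lam.exists_kernel_bound f
  obtain ⟨M, hM⟩ := ψ.hasCompactSupport.exists_bound_of_continuous ψ.continuous
  have hM' : ∀ g, ‖ψ g‖ₑ ≤ ENNReal.ofReal M := fun g => by
    rw [← ofReal_norm]; exact ENNReal.ofReal_le_ofReal (hM g)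
  have hφi : Integrable φ (lam.fibre x) :=
    φ.continuous.integrable_of_hasCompactSupport φ.hasCompactSupport
  rw [hasFiniteIntegral_iff_enorm, lintegral_prod _ hm.enorm.aemeasurable]
  have hkg : ∀ h, Measurable fun g => kernel 𝒢 f x h g := fun g =>
    hk.comp (measurable_const.prodMk measurable_id)
  calc ∫⁻ h, ∫⁻ g, ‖conj (φ h) * kernel 𝒢 f x h g * ψ g‖ₑ ∂(lam.fibre x) ∂(lam.fibre x)
      ≤ ∫⁻ h, ‖φ h‖ₑ * (C * ENNReal.ofReal M) ∂(lam.fibre x) := by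
        refine lintegral_mono fun h => ?_
        calc ∫⁻ g, ‖conj (φ h) * kernel 𝒢 f x h g * ψ g‖ₑ ∂(lam.fibre x)
            ≤ ∫⁻ g, ‖φ h‖ₑ * (‖kernel 𝒢 f x h g‖ₑ * ENNReal.ofReal M) ∂(lam.fibre x) := by
              refine lintegral_mono fun g => ?_
              rw [enorm_mul, enorm_mul, RCLike.enorm_conj, _root_.mul_assoc]
              gcongr
              exact hM' g
          _ = ‖φ h‖ₑ * ((∫⁻ g, ‖kernel 𝒢 f x h g‖ₑ ∂(lam.fibre x)) * ENNReal.ofReal M) := by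
              rw [lintegral_const_mul' _ _ enorm_ne_top, lintegral_mul_const' _ _ ENNReal.ofReal_ne_top]
          _ ≤ _ := by
              gcongr
              exact hC x h
    _ = (∫⁻ h, ‖φ h‖ₑ ∂(lam.fibre x)) * (C * ENNReal.ofReal M) := by
        rw [lintegral_mul_const' _ _ (ENNReal.mul_ne_top ENNReal.coe_ne_top ENNReal.ofReal_ne_top)]
    _ < ∞ := ENNReal.mul_lt_top hφi.2
        (ENNReal.mul_lt_top ENNReal.coe_lt_top ENNReal.ofReal_lt_top)

/-- The bounded operator of `L²(G, λ)` extending the left convolution by `f`. -/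
def convCLM (f : C_c(G, ℂ)) : lam.L2Module →L[ℂ] lam.L2Module :=
  (lam.ofCc ∘ₗ lam.conv f).extendOfNorm lam.ofCc

theorem convCLM_ofCc (f φ : C_c(G, ℂ)) :
    lam.convCLM f (lam.ofCc φ) = lam.ofCc (lam.conv f φ) :=
  LinearMap.extendOfNorm_eq lam.denseRange_ofCc (lam.norm_ofCc_conv_le f) φ

theorem continuous_ip (x : X) :
    Continuous fun q : lam.L2Module × lam.L2Module => lam.ip q.1 q.2 x := by
  have h1 : Continuous fun ξ : lam.L2Module => ξ.1 x :=
    (LipschitzWith.of_dist_le_mul (K := 1) fun ξ η => by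
      rw [dist_eq_norm, dist_eq_norm, NNReal.coe_one, one_mul]
      exact lp.norm_apply_le_norm ENNReal.top_ne_zero (ξ.1 - η.1) x).continuous
  exact (h1.comp continuous_fst).inner (h1.comp continuous_snd)

theorem isAdjoint_convCLM (f : C_c(G, ℂ)) :
    lam.IsAdjoint (lam.convCLM f) (lam.convCLM (involution 𝒢 f)) := fun ξ η x => by
  refine DenseRange.induction_on₂ (p := fun ξ η =>
    lam.ip (lam.convCLM (involution 𝒢 f) ξ) η x = lam.ip ξ (lam.convCLM f η) x)
    lam.denseRange_ofCc ?_ (fun φ ψ => ?_) ξ η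
  · refine isClosed_eq ?_ ?_
    · exact (lam.continuous_ip x).comp
        (((lam.convCLM _).continuous.comp continuous_fst).prodMk continuous_snd)
    · exact (lam.continuous_ip x).comp
        (continuous_fst.prodMk ((lam.convCLM _).continuous.comp continuous_snd))
  · rw [convCLM_ofCc, convCLM_ofCc, ip_conv]

instance : CompleteSpace lam.Adjointable := by
  refine Metric.complete_of_cauchySeq_tendsto fun u hu => ?_
  have h1 : CauchySeq fun n => (u n).1 := by
    rw [Metric.cauchySeq_iff] at hu ⊢
    exact hu
  have h2 : CauchySeq fun n => (star (u n)).1 := by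
    rw [Metric.cauchySeq_iff] at hu ⊢
    intro ε hε
    obtain ⟨N, hN⟩ := hu ε hε
    refine ⟨N, fun m hm n hn => ?_⟩
    have h3 : dist (star (u m)) (star (u n)) < ε := by
      rw [dist_eq_norm, ← star_sub, norm_star, ← dist_eq_norm]
      exact hN m hm n hn
    exact h3
  obtain ⟨T, hT⟩ := cauchySeq_tendsto_of_complete h1
  obtain ⟨S, hS⟩ := cauchySeq_tendsto_of_complete h2
  have hTS : lam.IsAdjoint T S := fun ξ η x => by
    have hTη : Tendsto (fun n => (u n).1 η) atTop (𝓝 (T η)) :=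
      ((ContinuousLinearMap.apply ℂ lam.L2Module η).continuous.tendsto T).comp hT
    have hSξ : Tendsto (fun n => (star (u n)).1 ξ) atTop (𝓝 (S ξ)) :=
      ((ContinuousLinearMap.apply ℂ lam.L2Module ξ).continuous.tendsto S).comp hS
    have h3 := ((lam.continuous_ip x).tendsto (S ξ, η)).comp (hSξ.prodMk_nhds tendsto_const_nhds)
    have h4 := ((lam.continuous_ip x).tendsto (ξ, T η)).comp
      ((tendsto_const_nhds (x := ξ)).prodMk_nhds hTη)
    refine tendsto_nhds_unique h3 (h4.congr fun n => ?_)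
    exact (isAdjoint_star (u n) ξ η x).symm
  exact ⟨⟨T, S, hTS⟩, tendsto_subtype_rng.2 hT⟩

instance : CStarAlgebra lam.Adjointable where

/-- The adjointable operator of `L²(G, λ)` given by the left convolution by `f`. -/
def rep (f : C_c(G, ℂ)) : lam.Adjointable := ⟨lam.convCLM f, _, lam.isAdjoint_convCLM f⟩

/-- The closure of (the star-algebra consisting of the convolution operators by elements of)
`C_c(G)` in the `C^*`-algebra of adjointable operators of `L²(G, λ)`. -/
def reducedSubalgebra : NonUnitalStarSubalgebra ℂ lam.Adjointable :=
  (NonUnitalStarAlgebra.adjoin ℂ (Set.range lam.rep)).topologicalClosure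

/-- The reduced `C^*`-algebra `C^*_r(G, λ)` of a groupoid with Haar system. -/
def Reduced : Type _ := lam.reducedSubalgebra

instance : NonUnitalCStarAlgebra lam.Reduced :=
  NonUnitalStarSubalgebra.nonUnitalCStarAlgebra lam.reducedSubalgebra
    (h_closed := NonUnitalStarSubalgebra.isClosed_topologicalClosure _)

/-- The inclusion of `C_c(G)` in the reduced `C^*`-algebra. -/
def toReduced (f : C_c(G, ℂ)) : lam.Reduced :=
  ⟨lam.rep f, subset_closure (NonUnitalStarAlgebra.subset_adjoin ℂ _ ⟨f, rfl⟩)⟩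

end HaarSystem

end TopGroupoid

/-! ### Suspensions -/

/-- The orbit relation on `Y × ℝ` of the homeomorphism `(y, t) ↦ (f y, t - 1)`. -/
def suspensionSetoid {Y : Type*} [TopologicalSpace Y] (f : Y ≃ₜ Y) : Setoid (Y × ℝ) where
  r p q := ∃ n : ℤ, q = ((f ^ n) p.1, p.2 - n)
  iseqv :=
    { refl := fun p => ⟨0, by simp⟩
      symm := by
        rintro p _ ⟨n, rfl⟩
        exact ⟨-n, by simp [← Homeomorph.mul_apply]⟩
      trans := by
        rintro p _ _ ⟨n, rfl⟩ ⟨m, rfl⟩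
        exact ⟨m + n, by simp [zpow_add]; ring⟩ }

/-- The suspension `(Y × ℝ) / (y, t) ~ (f y, t - 1)` of a homeomorphism. -/
def Suspension {Y : Type*} [TopologicalSpace Y] (f : Y ≃ₜ Y) : Type _ :=
  Quotient (suspensionSetoid f)

namespace Suspension

variable {Y Z : Type*} [TopologicalSpace Y] [TopologicalSpace Z]

instance (f : Y ≃ₜ Y) : TopologicalSpace (Suspension f) :=
  inferInstanceAs (TopologicalSpace (Quotient (suspensionSetoid f)))

instance (f : Y ≃ₜ Y) : MeasurableSpace (Suspension f) := borel _

instance (f : Y ≃ₜ Y) : BorelSpace (Suspension f) := ⟨rfl⟩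

/-- The class `[y, t]` in the suspension. -/
def mk (f : Y ≃ₜ Y) (y : Y) (t : ℝ) : Suspension f := Quotient.mk (suspensionSetoid f) (y, t)

variable {f : Y ≃ₜ Y} {f' : Z ≃ₜ Z}

theorem ind {p : Suspension f → Prop} (h : ∀ y t, p (mk f y t)) (a : Suspension f) : p a :=
  Quotient.ind (fun q => h q.1 q.2) a

theorem mk_eq_iff {y y' : Y} {t t' : ℝ} :
    mk f y t = mk f y' t' ↔ ∃ n : ℤ, y' = (f ^ n) y ∧ t' = t - n := by
  refine Quotient.eq.trans (exists_congr fun n => ?_)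
  simp [Prod.ext_iff]

theorem mk_zpow (n : ℤ) (y : Y) (t : ℝ) : mk f ((f ^ n) y) (t - n) = mk f y t :=
  (mk_eq_iff.2 ⟨n, rfl, rfl⟩).symm

theorem mk_apply (y : Y) (t : ℝ) : mk f (f y) (t - 1) = mk f y t := by
  have := mk_zpow (f := f) 1 y t
  simpa using this

theorem continuous_mk : Continuous fun q : Y × ℝ => mk f q.1 q.2 := continuous_quotient_mk'

theorem isOpenQuotientMap_mk : IsOpenQuotientMap fun q : Y × ℝ => mk f q.1 q.2 := by
  refine ⟨Quotient.mk_surjective, continuous_mk, fun U hU => ?_⟩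
  refine isOpen_coinduced.2 ?_
  have : (fun q : Y × ℝ => mk f q.1 q.2) ⁻¹' ((fun q : Y × ℝ => mk f q.1 q.2) '' U) =
      ⋃ n : ℤ, (fun q : Y × ℝ => ((f ^ n) q.1, q.2 - n)) ⁻¹' U := by
    ext ⟨y, t⟩
    simp only [Set.mem_preimage, Set.mem_image, Prod.exists, Set.mem_iUnion]
    constructor
    · rintro ⟨y', t', h, e⟩
      obtain ⟨n, rfl, rfl⟩ := mk_eq_iff.1 e.symm
      exact ⟨n, h⟩
    · rintro ⟨n, h⟩
      exact ⟨_, _, h, mk_zpow n y t⟩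
  refine this ▸ isOpen_iUnion fun n => hU.preimage ?_
  exact ((f ^ n).continuous.comp continuous_fst).prodMk (continuous_snd.sub continuous_const)

instance [LocallyCompactSpace Y] : LocallyCompactSpace (Suspension f) :=
  (isOpenQuotientMap_mk (f := f)).locallyCompactSpace

instance [SecondCountableTopology Y] : SecondCountableTopology (Suspension f) :=
  (isOpenQuotientMap_mk (f := f)).isQuotientMap.secondCountableTopology
    (isOpenQuotientMap_mk (f := f)).isOpenMap

instance [T2Space Y] : T2Space (Suspension f) := by
  rw [t2Space_iff_of_isOpenQuotientMap (isOpenQuotientMap_mk (f := f))]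
  have : {q : (Y × ℝ) × (Y × ℝ) | mk f q.1.1 q.1.2 = mk f q.2.1 q.2.2} =
      ⋃ n : ℤ, {q : (Y × ℝ) × (Y × ℝ) | q.2.1 = (f ^ n) q.1.1 ∧ q.1.2 - q.2.2 = n} := by
    ext q
    simp only [Set.mem_ofPred_eq, mk_eq_iff, Set.mem_iUnion]
    refine exists_congr fun n => and_congr_right fun _ => ?_
    constructor <;> intro h <;> linarith
  rw [this]
  have hd : Continuous fun q : (Y × ℝ) × (Y × ℝ) => q.1.2 - q.2.2 := by fun_prop
  refine LocallyFinite.isClosed_iUnion ?_ fun n => ?_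
  · have h1 : LocallyFinite fun n : ℤ => ({(n : ℝ)} : Set ℝ) := by
      intro a
      refine ⟨Metric.ball a 1, Metric.ball_mem_nhds _ one_pos, ?_⟩
      refine (Set.finite_Icc ⌊a - 1⌋ ⌈a + 1⌉).subset ?_
      rintro n ⟨b, rfl, hb⟩
      rw [Metric.mem_ball, Real.dist_eq, abs_lt] at hb
      exact ⟨Int.cast_le.1 ((Int.floor_le _).trans (by linarith) : ((⌊a - 1⌋ : ℤ) : ℝ) ≤ n),
        Int.cast_le.1 (le_trans (by linarith) (Int.le_ceil _) : (n : ℝ) ≤ (⌈a + 1⌉ : ℤ))⟩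
    exact (h1.preimage_continuous hd).subset fun n q hq => hq.2
  · exact (isClosed_eq (by fun_prop) ((f ^ n).continuous.comp (by fun_prop))).inter
      (isClosed_eq hd continuous_const)

theorem semiconj_zpow {φ : Y → Z} (hφ : ∀ y, φ (f y) = f' (φ y)) (n : ℤ) (y : Y) :
    φ ((f ^ n) y) = (f' ^ n) (φ y) := by
  induction n generalizing y with
  | zero => rfl
  | succ n ih => simp only [zpow_add_one, Homeomorph.mul_apply, ih, hφ]
  | pred n ih =>
    simp only [zpow_sub_one, Homeomorph.mul_apply, ih]
    congr 1
    apply f'.injective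
    rw [← hφ]
    change φ (f (f.symm y)) = f' (f'.symm (φ y))
    simp

/-- The map induced on suspensions by a map intertwining two homeomorphisms. -/
def map (φ : Y → Z) (hφ : ∀ y, φ (f y) = f' (φ y)) : Suspension f → Suspension f' :=
  Quotient.lift (fun q : Y × ℝ => mk f' (φ q.1) q.2) (by
    rintro q _ ⟨n, rfl⟩
    exact mk_eq_iff.2 ⟨n, semiconj_zpow hφ n q.1, rfl⟩)

@[simp]
theorem map_mk (φ : Y → Z) (hφ : ∀ y, φ (f y) = f' (φ y)) (y : Y) (t : ℝ) :
    map φ hφ (mk f y t) = mk f' (φ y) t := rfl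

theorem continuous_map {φ : Y → Z} (hφ : ∀ y, φ (f y) = f' (φ y)) (hc : Continuous φ) :
    Continuous (map φ hφ) :=
  Continuous.quotient_lift (continuous_mk.comp (by fun_prop : Continuous
    fun q : Y × ℝ => (φ q.1, q.2))) _

/-- The flow on the suspension: `s • [y, t] = [y, t + s]`. -/
def flow (f : Y ≃ₜ Y) (s : ℝ) : Suspension f ≃ₜ Suspension f where
  toFun := Quotient.map (fun q : Y × ℝ => (q.1, q.2 + s)) (by
    rintro q _ ⟨n, rfl⟩
    exact ⟨n, by simp; ring⟩)
  invFun := Quotient.map (fun q : Y × ℝ => (q.1, q.2 - s)) (by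
    rintro q _ ⟨n, rfl⟩
    exact ⟨n, by simp; ring⟩)
  left_inv := ind fun y t => congrArg (mk f y) (add_sub_cancel_right t s)
  right_inv := ind fun y t => congrArg (mk f y) (sub_add_cancel t s)
  continuous_toFun := Continuous.quotient_map' (by fun_prop) _
  continuous_invFun := Continuous.quotient_map' (by fun_prop) _

@[simp]
theorem flow_mk (s : ℝ) (y : Y) (t : ℝ) : flow f s (mk f y t) = mk f y (t + s) := rfl

/-- The maps `y ↦ [y, t]` are proper. -/
theorem isCompact_preimage_mk [LocallyCompactSpace Y] [T2Space Y] {K : Set (Suspension f)}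
    (hK : IsCompact K) (t : ℝ) : IsCompact ((fun y => mk f y t) ⁻¹' K) := by
  have hc : Continuous fun y => mk f y t :=
    continuous_mk.comp (by fun_prop : Continuous fun y : Y => (y, t))
  obtain ⟨L, hL, hKL⟩ : ∃ L : Set (Y × ℝ), IsCompact L ∧
      K ⊆ (fun q : Y × ℝ => mk f q.1 q.2) '' L := by
    choose C hC hC' using fun q : Y × ℝ => exists_compact_mem_nhds q
    obtain ⟨T, hT⟩ := hK.elim_nhds_subcover'
      (fun a _ => (fun q : Y × ℝ => mk f q.1 q.2) '' C a.out) (fun a _ => by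
        have := (isOpenQuotientMap_mk (f := f)).isOpenMap.image_mem_nhds (hC' a.out)
        have e : mk f a.out.1 a.out.2 = a := Quotient.out_eq a
        rwa [e] at this)
    refine ⟨⋃ a ∈ T, C (a : Suspension f).out, T.isCompact_biUnion fun a _ => hC _, ?_⟩
    rwa [Set.image_iUnion₂]
  obtain ⟨N, hN⟩ := (hL.image continuous_snd).isBounded.exists_norm_le
  have hfin : Set.Finite {n : ℤ | |t - n| ≤ N} := by
    refine (Set.finite_Icc ⌊t - N⌋ ⌈t + N⌉).subset fun n hn => ?_
    have hn' := abs_le.1 (show |t - n| ≤ N from hn)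
    exact ⟨Int.cast_le.1 ((Int.floor_le _).trans (by linarith) : ((⌊t - N⌋ : ℤ) : ℝ) ≤ n),
      Int.cast_le.1 (le_trans (by linarith) (Int.le_ceil _) : (n : ℝ) ≤ (⌈t + N⌉ : ℤ))⟩
  refine (hfin.isCompact_biUnion (f := fun n : ℤ => (f ^ n) ⁻¹' (Prod.fst '' L)) fun n _ =>
    (f ^ n).isCompact_preimage.2 (hL.image continuous_fst)).of_isClosed_subset
    (hK.isClosed.preimage hc) fun y hy => ?_
  obtain ⟨q, hq, e⟩ := hKL hy
  obtain ⟨n, h1, h2⟩ := mk_eq_iff.1 e.symm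
  refine Set.mem_biUnion (x := n) ?_ ⟨q, hq, h1⟩
  have := hN q.2 ⟨q, hq, rfl⟩
  rwa [h2, Real.norm_eq_abs] at this

end Suspension

namespace TopGroupoid

variable {G X : Type*} [TopologicalSpace G] [TopologicalSpace X] {𝒢 : TopGroupoid G X}

namespace Aut

variable (α : 𝒢.Aut)

theorem unit_base (x : X) : 𝒢.unit (α.base x) = α.arrow (𝒢.unit x) := by
  have h1 : 𝒢.s (𝒢.unit x) = 𝒢.r (𝒢.unit x) := by rw [𝒢.s_unit, 𝒢.r_unit]
  have h2 : 𝒢.s (α.arrow (𝒢.unit x)) = 𝒢.r (α.arrow (𝒢.unit x)) := by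
    rw [α.s_arrow, α.r_arrow, h1]
  have h3 : 𝒢.mul (𝒢.unit x) (𝒢.unit x) = 𝒢.unit x := by
    have := 𝒢.mul_unit (𝒢.unit x)
    rwa [𝒢.s_unit] at this
  have h4 := 𝒢.mul_inv_cancel_right h2
  rw [← α.arrow_mul _ _ h1, h3, 𝒢.mul_inv, α.r_arrow, 𝒢.r_unit] at h4
  exact h4

theorem inv_arrow (g : G) : 𝒢.inv (α.arrow g) = α.arrow (𝒢.inv g) := by
  have h1 : 𝒢.s g = 𝒢.r (𝒢.inv g) := (𝒢.r_inv g).symm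
  refine 𝒢.inv_eq_of_mul (by rw [α.s_arrow, α.r_arrow, h1]) ?_
  rw [← α.arrow_mul _ _ h1, 𝒢.mul_inv, ← α.unit_base, α.r_arrow]

theorem mul_zpow {g h : G} (hgh : 𝒢.s g = 𝒢.r h) (n : ℤ) :
    (α.arrow ^ n) (𝒢.mul g h) = 𝒢.mul ((α.arrow ^ n) g) ((α.arrow ^ n) h) := by
  induction n generalizing g h with
  | zero => rfl
  | succ n ih =>
    simp only [zpow_add_one, Homeomorph.mul_apply]
    rw [α.arrow_mul _ _ hgh, ih (by rw [α.s_arrow, α.r_arrow, hgh])]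
  | pred n ih =>
    simp only [zpow_sub_one, Homeomorph.mul_apply]
    have hs : α.base (𝒢.s (α.arrow⁻¹ g)) = α.base (𝒢.r (α.arrow⁻¹ h)) := by
      rw [← α.s_arrow, ← α.r_arrow]
      simpa using hgh
    have hs' := α.base.injective hs
    rw [← ih hs']
    congr 1
    apply α.arrow.injective
    rw [α.arrow_mul _ _ hs']
    simp

open Classical in
/-- The product of the suspension groupoid: `[g, t] [h, t] = [g h, t]`. -/
def suspensionMul (p q : Suspension α.arrow) : Suspension α.arrow :=
  if H : ∃ a : G × G × ℝ, 𝒢.s a.1 = 𝒢.r a.2.1 ∧ p = .mk _ a.1 a.2.2 ∧ q = .mk _ a.2.1 a.2.2 then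
    .mk _ (𝒢.mul H.choose.1 H.choose.2.1) H.choose.2.2
  else p

theorem suspensionMul_mk {g h : G} (hgh : 𝒢.s g = 𝒢.r h) (t : ℝ) :
    α.suspensionMul (.mk _ g t) (.mk _ h t) = .mk _ (𝒢.mul g h) t := by
  have H : ∃ a : G × G × ℝ, 𝒢.s a.1 = 𝒢.r a.2.1 ∧
      Suspension.mk α.arrow g t = .mk _ a.1 a.2.2 ∧
      Suspension.mk α.arrow h t = .mk _ a.2.1 a.2.2 := ⟨(g, h, t), hgh, rfl, rfl⟩
  rw [suspensionMul, dif_pos H]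
  obtain ⟨-, h1, h2⟩ := H.choose_spec
  generalize H.choose = a at h1 h2
  obtain ⟨g', h', t'⟩ := a
  obtain ⟨n, rfl, rfl⟩ := Suspension.mk_eq_iff.1 h1
  obtain ⟨m, rfl, e⟩ := Suspension.mk_eq_iff.1 h2
  obtain rfl : m = n := by
    have : (m : ℝ) = n := by simp only at e; linarith
    exact_mod_cast this
  rw [← α.mul_zpow hgh, Suspension.mk_zpow]

theorem exists_rep {p q : Suspension α.arrow}
    (hpq : Suspension.map (f' := α.base) 𝒢.s α.s_arrow p = Suspension.map 𝒢.r α.r_arrow q) :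
    ∃ g h t, 𝒢.s g = 𝒢.r h ∧ p = .mk _ g t ∧ q = .mk _ h t := by
  induction p using Suspension.ind with | _ g t
  induction q using Suspension.ind with | _ h t'
  obtain ⟨n, h1, rfl⟩ := Suspension.mk_eq_iff.1 hpq
  exact ⟨_, h, _, (Suspension.semiconj_zpow α.s_arrow n g).trans h1.symm,
    (Suspension.mk_zpow n g t).symm, rfl⟩

theorem mk_eq_mk {g g' : G} {t : ℝ} (h : Suspension.mk α.arrow g t = .mk _ g' t) : g = g' := by
  obtain ⟨n, rfl, e⟩ := Suspension.mk_eq_iff.1 h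
  obtain rfl : n = 0 := by
    have : (n : ℝ) = 0 := by linarith
    exact_mod_cast this
  rfl

/-- The suspension of a groupoid with respect to an automorphism. -/
def suspension : TopGroupoid (Suspension α.arrow) (Suspension α.base) where
  r := Suspension.map 𝒢.r α.r_arrow
  s := Suspension.map 𝒢.s α.s_arrow
  unit := Suspension.map 𝒢.unit α.unit_base
  inv := Suspension.map 𝒢.inv α.inv_arrow
  mul := α.suspensionMul
  r_unit := Suspension.ind fun x t => by simp [𝒢.r_unit]
  s_unit := Suspension.ind fun x t => by simp [𝒢.s_unit]
  r_inv := Suspension.ind fun g t => by simp [𝒢.r_inv]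
  s_inv := Suspension.ind fun g t => by simp [𝒢.s_inv]
  r_mul p q hpq := by
    obtain ⟨g, h, t, hgh, rfl, rfl⟩ := α.exists_rep hpq
    simp [α.suspensionMul_mk hgh, 𝒢.r_mul g h hgh]
  s_mul p q hpq := by
    obtain ⟨g, h, t, hgh, rfl, rfl⟩ := α.exists_rep hpq
    simp [α.suspensionMul_mk hgh, 𝒢.s_mul g h hgh]
  mul_assoc p q u hpq hqu := by
    obtain ⟨g, h, t, hgh, rfl, rfl⟩ := α.exists_rep hpq
    obtain ⟨h', k, t', hk, e, rfl⟩ := α.exists_rep hqu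
    obtain ⟨n, rfl, rfl⟩ := Suspension.mk_eq_iff.1 e
    rw [← Suspension.mk_zpow n g t, ← Suspension.mk_zpow n h t]
    have hgh' : 𝒢.s ((α.arrow ^ n) g) = 𝒢.r ((α.arrow ^ n) h) := by
      rw [Suspension.semiconj_zpow α.s_arrow, Suspension.semiconj_zpow α.r_arrow, hgh]
    rw [α.suspensionMul_mk hgh', α.suspensionMul_mk hk, α.suspensionMul_mk, α.suspensionMul_mk,
      𝒢.mul_assoc _ _ _ hgh' hk]
    · rw [𝒢.r_mul _ _ hk, hgh']
    · rw [𝒢.s_mul _ _ hgh', hk]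
  unit_mul := Suspension.ind fun g t => by
    simp only [Suspension.map_mk]
    rw [α.suspensionMul_mk (𝒢.s_unit _), 𝒢.unit_mul]
  mul_unit := Suspension.ind fun g t => by
    simp only [Suspension.map_mk]
    rw [α.suspensionMul_mk (𝒢.r_unit _).symm, 𝒢.mul_unit]
  inv_mul := Suspension.ind fun g t => by
    simp only [Suspension.map_mk]
    rw [α.suspensionMul_mk (𝒢.s_inv _), 𝒢.inv_mul]
  mul_inv := Suspension.ind fun g t => by
    simp only [Suspension.map_mk]
    rw [α.suspensionMul_mk (𝒢.r_inv _).symm, 𝒢.mul_inv]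
  continuous_r := Suspension.continuous_map _ 𝒢.continuous_r
  continuous_s := Suspension.continuous_map _ 𝒢.continuous_s
  continuous_unit := Suspension.continuous_map _ 𝒢.continuous_unit
  continuous_inv := Suspension.continuous_map _ 𝒢.continuous_inv
  continuousOn_mul := by
    rintro ⟨p, q⟩ hpq
    obtain ⟨g, h, t, hgh, rfl, rfl⟩ := α.exists_rep hpq
    intro W hW
    simp only [α.suspensionMul_mk hgh] at hW
    have hW' := Suspension.continuous_mk.continuousAt (x := (𝒢.mul g h, t)) hW
    rw [Filter.mem_map, nhds_prod_eq, Filter.mem_prod_iff] at hW'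
    obtain ⟨V, hV, I, hI, hVI⟩ := hW'
    have hm := 𝒢.continuousOn_mul (g, h) hgh hV
    rw [Filter.mem_map, mem_nhdsWithin_iff_exists_mem_nhds_inter] at hm
    obtain ⟨U, hU, hUV⟩ := hm
    rw [nhds_prod_eq, Filter.mem_prod_iff] at hU
    obtain ⟨A, hA, B, hB, hAB⟩ := hU
    have hJ : I ∩ Metric.ball t (1 / 2) ∈ 𝓝 t :=
      Filter.inter_mem hI (Metric.ball_mem_nhds _ (by norm_num))
    have hA' := (Suspension.isOpenQuotientMap_mk (f := α.arrow)).isOpenMap.image_mem_nhds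
      (prod_mem_nhds hA hJ)
    have hB' := (Suspension.isOpenQuotientMap_mk (f := α.arrow)).isOpenMap.image_mem_nhds
      (prod_mem_nhds hB hJ)
    rw [Filter.mem_map, mem_nhdsWithin_iff_exists_mem_nhds_inter]
    refine ⟨_, prod_mem_nhds hA' hB', ?_⟩
    rintro ⟨_, _⟩ ⟨⟨⟨⟨a, u⟩, ⟨ha, hu⟩, rfl⟩, ⟨⟨b, v⟩, ⟨hb, hv⟩, rfl⟩⟩, hc⟩
    obtain ⟨n, e1, e2⟩ := Suspension.mk_eq_iff.1 hc
    have hu2 := hu.2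
    have hv2 := hv.2
    rw [Metric.mem_ball, Real.dist_eq, abs_lt] at hu2 hv2
    simp only at hu2 hv2 e1 e2
    obtain rfl : n = 0 := by
      have h1 : (n : ℝ) < 1 := by linarith [hu2.2, hv2.1]
      have h2 : (-1 : ℝ) < n := by linarith [hu2.1, hv2.2]
      have h1' : n < 1 := by exact_mod_cast h1
      have h2' : -1 < n := by exact_mod_cast h2
      omega
    obtain rfl : v = u := by simpa using e2
    have hab : 𝒢.s a = 𝒢.r b := by simpa using e1.symm
    change α.suspensionMul _ _ ∈ W
    rw [α.suspensionMul_mk hab]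
    exact hVI (Set.mk_mem_prod (hUV ⟨hAB (Set.mk_mem_prod ha hb), hab⟩) hu.1)

/-- The automorphism `θ_s : [g, t] ↦ [g, t + s]` of the suspension groupoid. -/
def suspensionFlow (s : ℝ) : α.suspension.Aut where
  arrow := Suspension.flow α.arrow s
  base := Suspension.flow α.base s
  r_arrow := Suspension.ind fun _ _ => rfl
  s_arrow := Suspension.ind fun _ _ => rfl
  arrow_mul p q hpq := by
    obtain ⟨g, h, t, hgh, rfl, rfl⟩ := α.exists_rep hpq
    change Suspension.flow α.arrow s (α.suspensionMul _ _) =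
      α.suspensionMul (Suspension.flow α.arrow s _) (Suspension.flow α.arrow s _)
    rw [α.suspensionMul_mk hgh]
    simp only [Suspension.flow_mk]
    rw [α.suspensionMul_mk hgh]

end Aut

namespace HaarSystem

variable [MeasurableSpace G]

/-- The automorphism `α` preserves the Haar system `lam` with density `ρ`: a continuous function
with values in `(0, ∞)` whose restriction to each range fibre `G^{α(x)}` is the Radon-Nikodym
derivative of `α_* λ^x` with respect to `λ^{α(x)}`.  As `ρ` is positive, the two measures are then
in the same class. -/
structure Density (lam : 𝒢.HaarSystem) (α : 𝒢.Aut) where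
  ρ : G → ℝ
  continuous_ρ : Continuous ρ
  pos : ∀ g, 0 < ρ g
  map_eq : ∀ x, (lam.meas x).map α.arrow =
    (lam.meas (α.base x)).withDensity fun g => ENNReal.ofReal (ρ g)

namespace Density

variable {lam : 𝒢.HaarSystem} {α : 𝒢.Aut} (d : lam.Density α)

theorem continuous_rpow {u : G → G} (hu : Continuous u) (c : ℝ) :
    Continuous fun g => d.ρ (u g) ^ c :=
  (d.continuous_ρ.comp hu).rpow_const fun g => Or.inl (d.pos (u g)).ne'

/-- The function `γ ↦ (ρ(γ⁻¹) ρ(γ))^{1/2} f(α⁻¹(γ))`. -/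
def twist (f : C_c(G, ℂ)) : C_c(G, ℂ) where
  toFun g := ((d.ρ (𝒢.inv g) ^ (1 / 2 : ℝ) * d.ρ g ^ (1 / 2 : ℝ) : ℝ) : ℂ) * f (α.arrow.symm g)
  continuous_toFun := (Complex.continuous_ofReal.comp
    ((d.continuous_rpow 𝒢.continuous_inv _).mul (d.continuous_rpow continuous_id _))).mul
    (f.continuous.comp α.arrow.symm.continuous)
  hasCompactSupport' := (f.hasCompactSupport.comp_homeomorph α.arrow.symm).mul_left

/-- The function `f̂(t, ·) : γ ↦ ρ(γ)^{-t/2} ρ(γ⁻¹)^{-t/2} f([γ, t])`. -/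
def hat [T2Space G] [LocallyCompactSpace G] (f : C_c(Suspension α.arrow, ℂ)) (t : ℝ) :
    C_c(G, ℂ) where
  toFun g := ((d.ρ g ^ (-t / 2) * d.ρ (𝒢.inv g) ^ (-t / 2) : ℝ) : ℂ) * f (.mk α.arrow g t)
  continuous_toFun := (Complex.continuous_ofReal.comp
    ((d.continuous_rpow continuous_id _).mul (d.continuous_rpow 𝒢.continuous_inv _))).mul
    (f.continuous.comp (Suspension.continuous_mk.comp (continuous_id.prodMk continuous_const)))
  hasCompactSupport' := HasCompactSupport.intro
    (Suspension.isCompact_preimage_mk f.hasCompactSupport t) fun g hg => by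
      rw [image_eq_zero_of_notMem_tsupport (f := f) (x := .mk α.arrow g t) hg, mul_zero]

end Density

end HaarSystem

end TopGroupoid

/-! ### Mapping tori -/

section MappingTorus

variable {A : Type*} [NonUnitalCStarAlgebra A]

/-- The mapping torus `{h ∈ C([0,1], A) : β(h(1)) = h(0)}` of an automorphism `β` of `A`. -/
def mappingTorus (β : A ≃⋆ₐ[ℂ] A) : NonUnitalStarSubalgebra ℂ C(unitInterval, A) where
  carrier := {h | β (h 1) = h 0}
  add_mem' {a b} ha hb := by
    change β (a 1 + b 1) = a 0 + b 0
    rw [map_add, ha, hb]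
  zero_mem' := map_zero β
  mul_mem' {a b} ha hb := by
    change β (a 1 * b 1) = a 0 * b 0
    rw [map_mul, ha, hb]
  smul_mem' c a ha := by
    change β (c • a 1) = c • a 0
    rw [map_smul, ha]
  star_mem' {a} ha := by
    change β (star (a 1)) = star (a 0)
    rw [map_star, ha]

/-- The extension of an element `h` of the mapping torus of `β` to the function on `ℝ` with
`h(u) = β(h(u + 1))` for all `u`. -/
def mappingTorusExtend {β : A ≃⋆ₐ[ℂ] A} (h : mappingTorus β) (u : ℝ) : A :=
  (β ^ (-⌊u⌋)) (h.1 ⟨Int.fract u, Int.fract_nonneg u, (Int.fract_lt_one u).le⟩)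

theorem mappingTorusExtend_add_one {β : A ≃⋆ₐ[ℂ] A} (h : mappingTorus β) (u : ℝ) :
    β (mappingTorusExtend h (u + 1)) = mappingTorusExtend h u := by
  simp only [mappingTorusExtend, Int.floor_add_one, Int.fract_add_one]
  rw [← StarAlgEquiv.mul_apply, ← zpow_one_add]
  congr 2
  ring

theorem mappingTorusExtend_coe {β : A ≃⋆ₐ[ℂ] A} (h : mappingTorus β) (t : unitInterval) :
    mappingTorusExtend h t = h.1 t := by
  obtain ⟨t, ht⟩ := t
  rcases ht.2.lt_or_eq with h1 | rfl
  · have e : ⌊t⌋ = 0 := Int.floor_eq_zero_iff.2 ⟨ht.1, h1⟩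
    simp [mappingTorusExtend, e, Int.fract_eq_self.2 ⟨ht.1, h1⟩]
  · have h2 : β (h.1 1) = h.1 0 := h.2
    simp only [mappingTorusExtend, Int.floor_one, Int.fract_one, zpow_neg, zpow_one]
    change β.symm (h.1 0) = h.1 1
    rw [← h2, StarAlgEquiv.symm_apply_apply]

end MappingTorus

end

/-! Two facts carry the proof.

The reduced norm is fibrewise. Left convolution commutes with multiplication by functions of the
source, so it acts on each `L²(G_x, λ_x)` separately, and the norm of `f` in the reduced algebra is
the supremum over `x` of the norms of these actions (`norm_toReduced_le`, `norm_toL2_conv_le`).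

The density is a function of the source. Both `λ` and its image under `α` are left invariant, hence
so is `ρ` (`ρ_mul`). With `w(x) = ρ(unit x)` this gives `ρ(γ) = w(s γ)` and `ρ(γ⁻¹) = w(r γ)`, so
each factor `(ρ'ρ)^c` is a symmetric weight `w(r γ)^c w(s γ)^c`.

Consequently `f ↦ twist f` and `f ↦ f̂(t)` are two instances of one construction, `Pullback`:
composition with a proper injective homomorphism, times a symmetric weight. The weight turns one
Haar system into the other, so such a map respects convolution and involution and multiplies the
norm on each fibre by a constant. Constants cancel in operator bounds, so the operator norm over `x`
upstairs equals the one over the image of `x`.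

For `α⁻¹` the map on bases is onto, and the twist extends to an isometric automorphism. For the
slices, the images of `X × {t}` with `t ∈ [0, 1]` cover the base of the suspension, whence `‖f‖ =
sup_t ‖f̂(t)‖` and `f ↦ f̂` extends to an isometry. The gluing `[γ, t + 1] = [α(γ), t]` becomes
`α̃(f̂(t + 1)) = f̂(t)` (`twist_hat`), so the image lies in the mapping torus. It is closed, and it
is dense by a partition of unity on the circle (`exists_norm_hat_sub_le`). The flow acts by `f̂(t) ↦
f̂(t - s)` (`hat_flow_twist`), which gives equivariance on `C_c` and then everywhere. Strong
continuity is read off in the mapping torus. -/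

noncomputable section

namespace TopGroupoid

variable {G X : Type*} [TopologicalSpace G] [TopologicalSpace X] {𝒢 : TopGroupoid G X}
variable [T2Space G] [LocallyCompactSpace G] [SecondCountableTopology G]
  [MeasurableSpace G] [BorelSpace G]

namespace HaarSystem

variable (lam : 𝒢.HaarSystem)

/-! ### The convolution algebra -/

/-- Left invariance: substitute `k⁻¹h` for the integration variable. All integrals then run over the
single fibre of `r g`, the form needed for Fubini in `conv_assoc`. -/
theorem convFun_inv_mul (f φ : C_c(G, ℂ)) {k g : G} (hk : 𝒢.r k = 𝒢.r g) :
    lam.convFun f φ (𝒢.mul (𝒢.inv k) g) =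
      ∫ h, f (𝒢.mul (𝒢.inv k) h) * φ (𝒢.mul (𝒢.inv h) g) ∂(lam.meas (𝒢.r g)) := by
  have hkg : 𝒢.s (𝒢.inv k) = 𝒢.r g := (𝒢.s_inv k).trans hk
  have h1 : 𝒢.r (𝒢.mul (𝒢.inv k) g) = 𝒢.r (𝒢.inv k) := 𝒢.r_mul _ _ hkg
  have hi := (lam.integrable_conv f φ (𝒢.mul (𝒢.inv k) g)).aestronglyMeasurable
  rw [h1, ← lam.map_mul_left (𝒢.inv k)] at hi
  rw [convFun, h1, ← lam.map_mul_left (𝒢.inv k), integral_map (lam.aemeasurable_mul _) hi, hkg]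
  refine integral_congr_ae ?_
  filter_upwards [lam.ae_r (𝒢.r g)] with h hh
  have h2 : 𝒢.s (𝒢.inv k) = 𝒢.r h := hkg.trans hh.symm
  have h3 : 𝒢.s (𝒢.inv h) = 𝒢.r k := by rw [𝒢.s_inv, hh, hk]
  rw [𝒢.inv_mul_rev h2, 𝒢.inv_inv, 𝒢.mul_assoc _ _ _ h3 (by rw [𝒢.r_mul _ _ hkg, 𝒢.r_inv])]
  congr 3
  have := 𝒢.inv_mul_cancel_left hkg
  rwa [𝒢.inv_inv] at this

/-- Fubini for `f(k) g(k⁻¹h) φ(h⁻¹γ)`. The products make sense only on a fibre, so the integrand is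
first replaced by a continuous compactly supported function on `G × G` that agrees with it there. -/
theorem conv_assoc (f g φ : C_c(G, ℂ)) :
    lam.conv (lam.conv f g) φ = lam.conv f (lam.conv g φ) := by
  have := 𝒢.t2_base
  ext γ
  let S : Set (G × G) := {q | 𝒢.s q.1 = 𝒢.r q.2}
  have hS : IsClosed S := isClosed_eq (𝒢.continuous_s.comp continuous_fst)
    (𝒢.continuous_r.comp continuous_snd)
  have hL : IsCompact ((fun p : G × G => 𝒢.mul p.1 p.2) '' ((tsupport f ×ˢ tsupport g) ∩ S)) :=
    ((f.hasCompactSupport.isCompact.prod g.hasCompactSupport.isCompact).inter_right hS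
      ).image_of_continuousOn (𝒢.continuousOn_mul.mono Set.inter_subset_right)
  -- The integrand vanishes unless `h` lies in the product of the supports of `f` and `g`, where `χ
  -- = 1`. Inserting `χ(h)` is therefore harmless, and it supplies the compactly supported first
  -- factor that `exists_conv_integrand` requires for `φ(h⁻¹γ)`.
  obtain ⟨χ, hχ1, -, hχc, -⟩ := exists_continuous_one_zero_of_isCompact
    hL isClosed_empty (Set.disjoint_empty _)
  let χ' : C_c(G, ℂ) := ⟨⟨fun g => (χ g : ℂ), by fun_prop⟩, hχc.comp_left Complex.ofReal_zero⟩
  obtain ⟨F, K, hK, hF, hFK, hFe⟩ := exists_conv_integrand (𝒢 := 𝒢) f g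
  obtain ⟨F', K', hK', hF', hFK', hFe'⟩ := exists_conv_integrand (𝒢 := 𝒢) χ' φ
  have key : ∀ k h, 𝒢.r k = 𝒢.r γ → 𝒢.r h = 𝒢.r γ →
      F k h * F' h γ = f k * (g (𝒢.mul (𝒢.inv k) h) * φ (𝒢.mul (𝒢.inv h) γ)) := by
    intro k h hk hh
    rw [hFe h k (hk.trans hh.symm), hFe' γ h hh]
    by_cases h0 : f k * g (𝒢.mul (𝒢.inv k) h) = 0
    · rw [h0, zero_mul, ← _root_.mul_assoc, h0, zero_mul]
    · have h0' := mul_ne_zero_iff.1 h0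
      have hs : 𝒢.s (𝒢.inv k) = 𝒢.r h := by rw [𝒢.s_inv, hk, hh]
      have h1 : h ∈ (fun p : G × G => 𝒢.mul p.1 p.2) '' ((tsupport f ×ˢ tsupport g) ∩ S) := by
        refine ⟨(k, 𝒢.mul (𝒢.inv k) h),
          ⟨⟨subset_tsupport f h0'.1, subset_tsupport g h0'.2⟩, ?_⟩, ?_⟩
        · change 𝒢.s k = 𝒢.r (𝒢.mul (𝒢.inv k) h)
          rw [𝒢.r_mul _ _ hs, 𝒢.r_inv]
        · have := 𝒢.inv_mul_cancel_left hs
          rwa [𝒢.inv_inv] at this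
      have h2 : χ' h = 1 := by
        change ((χ h : ℝ) : ℂ) = 1
        rw [hχ1 h1]; simp
      rw [h2]; ring
  have e1 : lam.convFun (lam.conv f g) φ γ =
      ∫ h, ∫ k, F k h * F' h γ ∂(lam.meas (𝒢.r γ)) ∂(lam.meas (𝒢.r γ)) := by
    refine integral_congr_ae ?_
    filter_upwards [lam.ae_r (𝒢.r γ)] with h hh
    change lam.convFun f g h * _ = _
    rw [convFun, ← integral_mul_const, hh]
    refine integral_congr_ae ?_
    filter_upwards [lam.ae_r (𝒢.r γ)] with k hk
    rw [key k h hk hh, _root_.mul_assoc]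
  have e2 : lam.convFun f (lam.conv g φ) γ =
      ∫ k, ∫ h, F k h * F' h γ ∂(lam.meas (𝒢.r γ)) ∂(lam.meas (𝒢.r γ)) := by
    refine integral_congr_ae ?_
    filter_upwards [lam.ae_r (𝒢.r γ)] with k hk
    change f k * lam.convFun g φ (𝒢.mul (𝒢.inv k) γ) = _
    rw [lam.convFun_inv_mul g φ hk, ← integral_const_mul]
    refine integral_congr_ae ?_
    filter_upwards [lam.ae_r (𝒢.r γ)] with h hh
    rw [key k h hk hh]
  change lam.convFun _ φ γ = lam.convFun f _ γ
  rw [e1, e2]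
  refine (integral_integral_swap_of_hasCompactSupport
    (f := fun k h => F k h * F' h γ) ?_ ?_).symm
  · have : Continuous fun q : G × G => F' q.2 γ :=
      hF'.comp (by fun_prop : Continuous fun q : G × G => (q.2, γ))
    exact hF.mul this
  · refine HasCompactSupport.intro (hK.prod hK') fun q hq => ?_
    rw [Set.mem_prod, not_and_or] at hq
    rcases hq with hq | hq
    · simp [Function.uncurry, hFK _ _ hq]
    · simp [Function.uncurry, hFK' _ _ hq]

theorem conv_add_left (f f' φ : C_c(G, ℂ)) :
    lam.conv (f + f') φ = lam.conv f φ + lam.conv f' φ := by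
  ext g
  have := integral_add (lam.integrable_conv f φ g) (lam.integrable_conv f' φ g)
  simp only [← add_mul] at this
  exact this

theorem conv_smul_left (c : ℂ) (f φ : C_c(G, ℂ)) :
    lam.conv (c • f) φ = c • lam.conv f φ := by
  ext g
  have := integral_const_mul (μ := lam.meas (𝒢.r g)) c
    (fun g' => f g' * φ (𝒢.mul (𝒢.inv g') g))
  simp only [← _root_.mul_assoc] at this
  exact this

/-- `C_c(G)` is dense in `L²(G, λ)`; this reduces the algebraic identities for `rep` to identities
for `conv`. -/
theorem rep_eq {f : C_c(G, ℂ)} {T : lam.Adjointable}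
    (h : ∀ φ, T.1 (lam.ofCc φ) = lam.ofCc (lam.conv f φ)) : T = lam.rep f := by
  refine Subtype.ext (ContinuousLinearMap.coeFn_injective ?_)
  refine lam.denseRange_ofCc.equalizer T.1.continuous (lam.rep f).1.continuous ?_
  funext φ
  exact (h φ).trans (lam.convCLM_ofCc f φ).symm

theorem rep_add (f f' : C_c(G, ℂ)) : lam.rep (f + f') = lam.rep f + lam.rep f' := by
  refine (lam.rep_eq fun φ => ?_).symm
  change lam.convCLM f (lam.ofCc φ) + lam.convCLM f' (lam.ofCc φ) = _
  rw [convCLM_ofCc, convCLM_ofCc, conv_add_left, map_add]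

theorem rep_smul (c : ℂ) (f : C_c(G, ℂ)) : lam.rep (c • f) = c • lam.rep f := by
  refine (lam.rep_eq fun φ => ?_).symm
  change c • lam.convCLM f (lam.ofCc φ) = _
  rw [convCLM_ofCc, conv_smul_left, map_smul]

theorem rep_conv (f f' : C_c(G, ℂ)) : lam.rep (lam.conv f f') = lam.rep f * lam.rep f' := by
  refine (lam.rep_eq fun φ => ?_).symm
  change lam.convCLM f (lam.convCLM f' (lam.ofCc φ)) = _
  rw [convCLM_ofCc, convCLM_ofCc, conv_assoc]

theorem rep_involution (f : C_c(G, ℂ)) : lam.rep (involution 𝒢 f) = star (lam.rep f) := by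
  have h : lam.IsAdjoint (lam.rep f).1 (lam.rep (involution 𝒢 f)).1 := lam.isAdjoint_convCLM f
  exact (star_eq h).symm

/-- The inclusion of `C_c(G)` in the reduced `C^*`-algebra, as a linear map. -/
def toReducedₗ : C_c(G, ℂ) →ₗ[ℂ] lam.Reduced where
  toFun := lam.toReduced
  map_add' f f' := Subtype.ext (lam.rep_add f f')
  map_smul' c f := Subtype.ext (lam.rep_smul c f)

theorem toReduced_add (f f' : C_c(G, ℂ)) :
    lam.toReduced (f + f') = lam.toReduced f + lam.toReduced f' := lam.toReducedₗ.map_add f f'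

theorem toReduced_smul (c : ℂ) (f : C_c(G, ℂ)) :
    lam.toReduced (c • f) = c • lam.toReduced f := lam.toReducedₗ.map_smul c f

theorem toReduced_sub (f f' : C_c(G, ℂ)) :
    lam.toReduced (f - f') = lam.toReduced f - lam.toReduced f' := lam.toReducedₗ.map_sub f f'

theorem toReduced_conv (f f' : C_c(G, ℂ)) :
    lam.toReduced (lam.conv f f') = lam.toReduced f * lam.toReduced f' :=
  Subtype.ext (lam.rep_conv f f')

theorem toReduced_involution (f : C_c(G, ℂ)) :
    lam.toReduced (involution 𝒢 f) = star (lam.toReduced f) :=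
  Subtype.ext (lam.rep_involution f)

/-- The convolution operators already form a star subalgebra, so `adjoin` adds nothing before the
closure is taken. -/
theorem denseRange_toReduced : DenseRange lam.toReduced := by
  let S : NonUnitalStarSubalgebra ℂ lam.Adjointable :=
    { carrier := Set.range lam.rep
      add_mem' := by
        rintro _ _ ⟨f, rfl⟩ ⟨f', rfl⟩
        exact ⟨f + f', lam.rep_add f f'⟩
      zero_mem' := ⟨0, by have := lam.rep_smul 0 0; simpa using this⟩
      mul_mem' := by
        rintro _ _ ⟨f, rfl⟩ ⟨f', rfl⟩
        exact ⟨lam.conv f f', lam.rep_conv f f'⟩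
      smul_mem' := by
        rintro c _ ⟨f, rfl⟩
        exact ⟨c • f, lam.rep_smul c f⟩
      star_mem' := by
        rintro _ ⟨f, rfl⟩
        exact ⟨involution 𝒢 f, lam.rep_involution f⟩ }
  refine Subtype.dense_iff.2 fun T hT => ?_
  refine closure_mono ?_ hT
  intro T' hT'
  have h1 : NonUnitalStarAlgebra.adjoin ℂ (Set.range lam.rep) ≤ S :=
    NonUnitalStarAlgebra.adjoin_le le_rfl
  obtain ⟨f, rfl⟩ := h1 hT'
  exact ⟨lam.toReduced f, ⟨f, rfl⟩, rfl⟩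

/-! ### The norm of the reduced algebra -/

/-- The product of `φ` with the function `k ∘ s`. -/
def mulSource (𝒢 : TopGroupoid G X) (k : C(X, ℂ)) (φ : C_c(G, ℂ)) : C_c(G, ℂ) where
  toFun g := k (𝒢.s g) * φ g
  continuous_toFun := (k.continuous.comp 𝒢.continuous_s).mul φ.continuous
  hasCompactSupport' := φ.hasCompactSupport.mul_left

/-- `h⁻¹g` and `g` have the same source. This linearity over functions on the base is what localizes
operator bounds to single fibres. -/
theorem conv_mulSource (k : C(X, ℂ)) (f φ : C_c(G, ℂ)) :
    lam.conv f (mulSource 𝒢 k φ) = mulSource 𝒢 k (lam.conv f φ) := by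
  ext g
  change lam.convFun f _ g = k (𝒢.s g) * lam.convFun f φ g
  rw [convFun, convFun, ← integral_const_mul]
  refine integral_congr_ae ?_
  filter_upwards [lam.ae_r (𝒢.r g)] with h hh
  change f h * (k (𝒢.s _) * φ _) = _
  rw [𝒢.s_mul _ _ ((𝒢.s_inv h).trans hh)]
  ring

theorem toL2_mulSource (k : C(X, ℂ)) (φ : C_c(G, ℂ)) (x : X) :
    lam.toL2 (mulSource 𝒢 k φ) x = k x • lam.toL2 φ x := by
  rw [toL2, toL2, ← MemLp.toLp_const_smul, MemLp.toLp_eq_toLp_iff]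
  filter_upwards [lam.ae_s x] with g hg
  change k (𝒢.s g) * φ g = k x * φ g
  rw [hg]

/-- The function `g ↦ ‖φ(g⁻¹)‖²`. -/
def normSqInv (𝒢 : TopGroupoid G X) (φ : C_c(G, ℂ)) : C_c(G, ℂ) where
  toFun g := φ (𝒢.inv g) * conj (φ (𝒢.inv g))
  continuous_toFun := by
    have := 𝒢.continuous_inv
    fun_prop
  hasCompactSupport' :=
    HasCompactSupport.mul_right (φ.hasCompactSupport.comp_homeomorph 𝒢.invHomeo)

theorem norm_toL2_sq (φ : C_c(G, ℂ)) (x : X) :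
    ((‖lam.toL2 φ x‖ ^ 2 : ℝ) : ℂ) = ∫ g, normSqInv 𝒢 φ g ∂(lam.meas x) := by
  have h1 := inner_self_eq_norm_sq_to_K (𝕜 := ℂ) (lam.toL2 φ x)
  rw [inner_toL2, integral_fibre _ (by fun_prop)] at h1
  push_cast
  exact h1.symm

theorem continuous_norm_toL2_sq (φ : C_c(G, ℂ)) : Continuous fun x => ‖lam.toL2 φ x‖ ^ 2 := by
  have h := Complex.continuous_re.comp (lam.continuous_integral (normSqInv 𝒢 φ))
  refine h.congr fun x => ?_
  simp only [Function.comp, ← norm_toL2_sq, Complex.ofReal_re]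

theorem norm_toL2_le (φ : C_c(G, ℂ)) (x : X) : ‖lam.toL2 φ x‖ ≤ ‖lam.ofCc φ‖ :=
  lp.norm_apply_le_norm ENNReal.top_ne_zero (lam.toL2Prod φ) x

theorem norm_ofCc_le {φ : C_c(G, ℂ)} {C : ℝ} (hC : 0 ≤ C) (h : ∀ x, ‖lam.toL2 φ x‖ ≤ C) :
    ‖lam.ofCc φ‖ ≤ C := lp.norm_le_of_forall_le hC h

/-- The module norm is the supremum of the fibre norms, so a bound uniform in the fibre bounds the
operator. `norm_toL2_conv_le` is the converse. -/
theorem norm_toReduced_le {f : C_c(G, ℂ)} {C : ℝ} (hC : 0 ≤ C)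
    (h : ∀ φ x, ‖lam.toL2 (lam.conv f φ) x‖ ≤ C * ‖lam.toL2 φ x‖) : ‖lam.toReduced f‖ ≤ C := by
  change ‖lam.convCLM f‖ ≤ C
  refine ContinuousLinearMap.opNorm_le_bound _ hC fun ξ => ?_
  refine lam.denseRange_ofCc.induction_on ξ ?_ fun φ => ?_
  · exact isClosed_le (lam.convCLM f).continuous.norm (continuous_const.mul continuous_norm)
  · rw [convCLM_ofCc]
    refine lam.norm_ofCc_le (by positivity) fun x => (h φ x).trans ?_
    gcongr
    exact lam.norm_toL2_le φ x

/-- Rescale `φ` by the continuous function `k(y) = (‖φ‖_y² + ε)^{-1/2}` of the source. The result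
has norm at most one in every fibre, so the global operator bound applies. Since `k` passes through
the convolution, evaluation at `x` gives the claim up to `ε`, which then tends to zero. The `ε`
guards against fibres where `φ` vanishes. -/
theorem norm_toL2_conv_le (f φ : C_c(G, ℂ)) (x : X) :
    ‖lam.toL2 (lam.conv f φ) x‖ ≤ ‖lam.toReduced f‖ * ‖lam.toL2 φ x‖ := by
  have h1 : ∀ ε : ℝ, 0 < ε → ‖lam.toL2 (lam.conv f φ) x‖ ≤
      ‖lam.toReduced f‖ * √(‖lam.toL2 φ x‖ ^ 2 + ε) := by
    intro ε hε
    have hpos : ∀ y, 0 < √(‖lam.toL2 φ y‖ ^ 2 + ε) := fun y => Real.sqrt_pos.2 (by positivity)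
    let k : C(X, ℂ) := ⟨fun y => (((√(‖lam.toL2 φ y‖ ^ 2 + ε))⁻¹ : ℝ) : ℂ), by
      refine Complex.continuous_ofReal.comp (Continuous.inv₀ ?_ fun y => (hpos y).ne')
      exact ((lam.continuous_norm_toL2_sq φ).add continuous_const).sqrt⟩
    have hk : ∀ y, ‖k y‖ = (√(‖lam.toL2 φ y‖ ^ 2 + ε))⁻¹ := fun y => by
      change ‖((_ : ℝ) : ℂ)‖ = _
      rw [Complex.norm_real, Real.norm_of_nonneg (inv_nonneg.2 (hpos y).le)]
    have h2 : ‖lam.ofCc (mulSource 𝒢 k φ)‖ ≤ 1 := by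
      refine lam.norm_ofCc_le zero_le_one fun y => ?_
      rw [toL2_mulSource, norm_smul, hk, inv_mul_le_iff₀ (hpos y), mul_one]
      exact Real.le_sqrt_of_sq_le (by linarith)
    have h3 : ‖lam.convCLM f (lam.ofCc (mulSource 𝒢 k φ))‖ ≤ ‖lam.toReduced f‖ :=
      ((lam.convCLM f).le_opNorm _).trans (mul_le_of_le_one_right (norm_nonneg _) h2)
    rw [convCLM_ofCc, conv_mulSource] at h3
    have h4 := (lam.norm_toL2_le _ x).trans h3
    rwa [toL2_mulSource, norm_smul, hk, inv_mul_le_iff₀ (hpos x), mul_comm] at h4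
  have h2 : Tendsto (fun ε : ℝ => ‖lam.toReduced f‖ * √(‖lam.toL2 φ x‖ ^ 2 + ε)) (𝓝[>] 0)
      (𝓝 (‖lam.toReduced f‖ * ‖lam.toL2 φ x‖)) := by
    have hc : Continuous fun ε : ℝ => ‖lam.toReduced f‖ * √(‖lam.toL2 φ x‖ ^ 2 + ε) := by fun_prop
    have := (hc.tendsto 0).mono_left (nhdsWithin_le_nhds (s := Set.Ioi 0))
    simpa using this
  exact ge_of_tendsto h2 (eventually_mem_nhdsWithin.mono fun ε hε => h1 ε hε)

/-- The pointwise absolute value of a function with compact support. -/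
def absCc (φ : C_c(G, ℂ)) : C_c(G, ℂ) where
  toFun g := (‖φ g‖ : ℂ)
  continuous_toFun := by fun_prop
  hasCompactSupport' := φ.hasCompactSupport.norm.comp_left Complex.ofReal_zero

/-- Functions dominated by small multiples of a fixed function have small norms. -/
theorem exists_norm_toReduced_le_of_dominated (χ : C_c(G, ℂ)) :
    ∃ C : ℝ, 0 ≤ C ∧ ∀ (f : C_c(G, ℂ)) (ε : ℝ), 0 ≤ ε → (∀ g, ‖f g‖ ≤ ε * ‖χ g‖) →
      ‖lam.toReduced f‖ ≤ ε * C := by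
  refine ⟨‖lam.toReduced (absCc χ)‖, norm_nonneg _, fun f ε hε hf => ?_⟩
  refine lam.norm_toReduced_le (by positivity) fun φ x => ?_
  -- Pointwise, `|f * φ| ≤ ε (|χ| * |φ|)`, and passing to absolute values leaves the fibre norm of
  -- `φ` unchanged. So the operator norm of `|χ|` serves as the constant.
  have h1 : ‖lam.toL2 (lam.conv f φ) x‖ ≤ ε * ‖lam.toL2 (lam.conv (absCc χ) (absCc φ)) x‖ := by
    refine Lp.norm_le_mul_norm_of_ae_le_mul ?_
    filter_upwards [(lam.memLp_fibre (lam.conv f φ) x).coeFn_toLp,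
      (lam.memLp_fibre (lam.conv (absCc χ) (absCc φ)) x).coeFn_toLp] with g hg hg'
    simp only [toL2, hg, hg']
    change ‖lam.convFun f φ g‖ ≤ ε * ‖lam.convFun (absCc χ) (absCc φ) g‖
    have e : lam.convFun (absCc χ) (absCc φ) g =
        ((∫ h, ‖χ h‖ * ‖φ (𝒢.mul (𝒢.inv h) g)‖ ∂(lam.meas (𝒢.r g)) : ℝ) : ℂ) := by
      refine Eq.trans ?_ integral_ofReal
      refine integral_congr_ae (Eventually.of_forall fun h => ?_)
      simp [absCc]
    have hχφ : Integrable (fun h => ‖χ h‖ * ‖φ (𝒢.mul (𝒢.inv h) g)‖) (lam.meas (𝒢.r g)) := by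
      have := (lam.integrable_conv χ φ g).norm
      simpa only [norm_mul] using this
    rw [e, Complex.norm_real, Real.norm_of_nonneg (integral_nonneg fun h => by positivity),
      ← integral_const_mul]
    refine norm_integral_le_of_norm_le (hχφ.const_mul _) (Eventually.of_forall fun h => ?_)
    rw [norm_mul, ← _root_.mul_assoc]
    gcongr
    exact hf h
  have h2 : ‖lam.toL2 (absCc φ) x‖ = ‖lam.toL2 φ x‖ := by
    rw [toL2, toL2, Lp.norm_toLp, Lp.norm_toLp]
    congr 1
    exact eLpNorm_congr_norm_ae (Eventually.of_forall fun g => by simp [absCc])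
  calc _ ≤ _ := h1
    _ ≤ ε * (‖lam.toReduced (absCc χ)‖ * ‖lam.toL2 φ x‖) := by
        gcongr
        rw [← h2]
        exact lam.norm_toL2_conv_le _ _ _
    _ = _ := by ring

/-! ### Homomorphisms of reduced algebras -/

variable {lam} in
/-- Star homomorphisms that agree on `C_c(G)` are equal. -/
theorem Reduced.hom_ext {B F F' : Type*} [NonUnitalCStarAlgebra B]
    [FunLike F lam.Reduced B] [NonUnitalAlgHomClass F ℂ lam.Reduced B]
    [StarHomClass F lam.Reduced B]
    [FunLike F' lam.Reduced B] [NonUnitalAlgHomClass F' ℂ lam.Reduced B]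
    [StarHomClass F' lam.Reduced B] {Φ : F} {Ψ : F'}
    (h : ∀ f, Φ (lam.toReduced f) = Ψ (lam.toReduced f)) (a : lam.Reduced) : Φ a = Ψ a := by
  -- Star homomorphisms of `C^*`-algebras are contractive, hence determined on a dense subset.
  have h1 : Continuous Φ := AddMonoidHomClass.continuous_of_bound Φ 1 fun a => by
    rw [one_mul]; exact NonUnitalStarAlgHom.norm_apply_le Φ a
  have h2 : Continuous Ψ := AddMonoidHomClass.continuous_of_bound Ψ 1 fun a => by
    rw [one_mul]; exact NonUnitalStarAlgHom.norm_apply_le Ψ a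
  exact congrFun (lam.denseRange_toReduced.equalizer h1 h2 (funext h)) a

/-- A norm preserving representation of the convolution algebra `C_c(G)` extends to the reduced
algebra. -/
theorem exists_isometric_extension {B : Type*} [NonUnitalCStarAlgebra B]
    (j : C_c(G, ℂ) →ₗ[ℂ] B) (hn : ∀ f, ‖j f‖ = ‖lam.toReduced f‖)
    (hm : ∀ f f', j (lam.conv f f') = j f * j f')
    (hs : ∀ f, j (involution 𝒢 f) = star (j f)) :
    ∃ Φ : lam.Reduced →⋆ₙₐ[ℂ] B, Isometry Φ ∧ ∀ f, Φ (lam.toReduced f) = j f := by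
  have hd : DenseRange lam.toReducedₗ := lam.denseRange_toReduced
  let T : lam.Reduced →L[ℂ] B := j.extendOfNorm lam.toReducedₗ
  have hT : ∀ f, T (lam.toReduced f) = j f :=
    LinearMap.extendOfNorm_eq hd ⟨1, fun f => by rw [one_mul]; exact (hn f).le⟩
  let Φ : lam.Reduced →⋆ₙₐ[ℂ] B :=
    { toFun := T
      map_smul' := T.map_smul
      map_zero' := T.map_zero
      map_add' := T.map_add
      map_mul' := fun a b => by
        refine lam.denseRange_toReduced.induction_on₂
          (p := fun a b => T (a * b) = T a * T b) ?_ (fun f f' => ?_) a b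
        · exact isClosed_eq (T.continuous.comp (continuous_fst.mul continuous_snd))
            ((T.continuous.comp continuous_fst).mul (T.continuous.comp continuous_snd))
        · rw [← toReduced_conv, hT, hT, hT, hm]
      map_star' := fun a => by
        refine lam.denseRange_toReduced.induction_on
          (p := fun a => T (star a) = star (T a)) a ?_ fun f => ?_
        · exact isClosed_eq (T.continuous.comp continuous_star) (continuous_star.comp T.continuous)
        · rw [← toReduced_involution, hT, hT, hs] }
  refine ⟨Φ, AddMonoidHomClass.isometry_of_norm Φ fun a => ?_, hT⟩
  refine lam.denseRange_toReduced.induction_on (p := fun a => ‖T a‖ = ‖a‖) a ?_ fun f => ?_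
  · exact isClosed_eq T.continuous.norm continuous_norm
  · rw [hT, hn]

end HaarSystem

end TopGroupoid

end

/-! ### Weighted pull-backs along proper groupoid homomorphisms, and invariance of the density. -/

noncomputable section

set_option linter.unusedSectionVars false

/-- The image of a measure with density, when the density factors through the map. -/
theorem map_withDensity_comp {α β : Type*} [MeasurableSpace α] [MeasurableSpace β] (μ : Measure α)
    {T : α → β} (hT : AEMeasurable T μ) {k : β → ℝ≥0∞} (hk : Measurable k) :
    (μ.withDensity fun a => k (T a)).map T = (μ.map T).withDensity k := by
  have hT' : AEMeasurable T (μ.withDensity fun a => k (T a)) :=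
    hT.mono_ac (withDensity_absolutelyContinuous _ _)
  refine Measure.ext fun s hs => ?_
  have hs' : NullMeasurableSet (T ⁻¹' s) μ := hT.nullMeasurable hs
  rw [Measure.map_apply_of_aemeasurable hT' hs, withDensity_apply _ hs,
    withDensity_apply₀ _ hs', ← lintegral_indicator hs, ← lintegral_indicator₀ hs',
    lintegral_map' (hk.indicator hs).aemeasurable hT]
  rfl

namespace TopGroupoid

variable {G X G' X' : Type*} [TopologicalSpace G] [TopologicalSpace X] [TopologicalSpace G']
  [TopologicalSpace X'] {𝒢 : TopGroupoid G X} {𝒢' : TopGroupoid G' X'}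

namespace HaarSystem

/-- A proper continuous homomorphism of groupoids that maps the Haar system `lam`, weighted by the
function `weight² ∘ s`, onto the Haar system `lam'`. -/
structure Pullback [MeasurableSpace G] [MeasurableSpace G'] (lam : 𝒢.HaarSystem)
    (lam' : 𝒢'.HaarSystem) where
  arrow : G → G'
  base : X → X'
  weight : X → ℝ
  continuous_arrow : Continuous arrow
  isCompact_preimage : ∀ K, IsCompact K → IsCompact (arrow ⁻¹' K)
  continuous_weight : Continuous weight
  weight_pos : ∀ x, 0 < weight x
  r_arrow : ∀ g, 𝒢'.r (arrow g) = base (𝒢.r g)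
  s_arrow : ∀ g, 𝒢'.s (arrow g) = base (𝒢.s g)
  arrow_mul : ∀ g h, 𝒢.s g = 𝒢.r h → arrow (𝒢.mul g h) = 𝒢'.mul (arrow g) (arrow h)
  map_eq : ∀ x, ((lam.meas x).withDensity fun g =>
    ENNReal.ofReal (weight (𝒢.s g) ^ 2)).map arrow = lam'.meas (base x)

variable [T2Space G] [LocallyCompactSpace G] [SecondCountableTopology G]
  [MeasurableSpace G] [BorelSpace G]
  [T2Space G'] [LocallyCompactSpace G'] [SecondCountableTopology G']
  [MeasurableSpace G'] [BorelSpace G']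

namespace Pullback

variable {lam : 𝒢.HaarSystem} {lam' : 𝒢'.HaarSystem} (P : lam.Pullback lam')

theorem arrow_inv (g : G) : P.arrow (𝒢.inv g) = 𝒢'.inv (P.arrow g) := by
  have e : 𝒢'.s (P.arrow g) = 𝒢'.r (P.arrow (𝒢.inv g)) := by
    rw [P.s_arrow, P.r_arrow, 𝒢.r_inv]
  have hu : ∀ x, P.arrow (𝒢.unit x) = 𝒢'.unit (P.base x) := fun x => by
    have h1 : 𝒢.s (𝒢.unit x) = 𝒢.r (𝒢.unit x) := by rw [𝒢.s_unit, 𝒢.r_unit]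
    have h2 : 𝒢'.s (P.arrow (𝒢.unit x)) = 𝒢'.r (P.arrow (𝒢.unit x)) := by
      rw [P.s_arrow, P.r_arrow, h1]
    have h3 : 𝒢.mul (𝒢.unit x) (𝒢.unit x) = 𝒢.unit x := by
      have := 𝒢.mul_unit (𝒢.unit x)
      rwa [𝒢.s_unit] at this
    have h4 := 𝒢'.mul_inv_cancel_right h2
    rw [← P.arrow_mul _ _ h1, h3, 𝒢'.mul_inv, P.r_arrow, 𝒢.r_unit] at h4
    exact h4.symm
  refine (𝒢'.inv_eq_of_mul e ?_).symm
  rw [← P.arrow_mul _ _ (𝒢.r_inv g).symm, 𝒢.mul_inv, hu, P.r_arrow]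

/-- The function `g ↦ weight (r g) * weight (s g) * f (arrow g)`. -/
def pull : C_c(G', ℂ) →ₗ[ℂ] C_c(G, ℂ) where
  toFun f :=
    { toFun := fun g => ((P.weight (𝒢.r g) * P.weight (𝒢.s g) : ℝ) : ℂ) * f (P.arrow g)
      continuous_toFun := (Complex.continuous_ofReal.comp
        ((P.continuous_weight.comp 𝒢.continuous_r).mul
          (P.continuous_weight.comp 𝒢.continuous_s))).mul (f.continuous.comp P.continuous_arrow)
      hasCompactSupport' := HasCompactSupport.intro
        (P.isCompact_preimage _ f.hasCompactSupport) fun g hg => by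
          rw [image_eq_zero_of_notMem_tsupport (f := f) hg, mul_zero] }
  map_add' f f' := by
    ext g
    exact mul_add _ (f _) (f' _)
  map_smul' c f := by
    ext g
    exact mul_left_comm _ c (f _)

theorem pull_apply (f : C_c(G', ℂ)) (g : G) :
    P.pull f g = ((P.weight (𝒢.r g) * P.weight (𝒢.s g) : ℝ) : ℂ) * f (P.arrow g) := rfl

theorem integral_base {x : X} {F : G' → ℂ}
    (hF : AEStronglyMeasurable F (lam'.meas (P.base x))) :
    ∫ g, F g ∂(lam'.meas (P.base x)) =
      ∫ g, ((P.weight (𝒢.s g) ^ 2 : ℝ) : ℂ) * F (P.arrow g) ∂(lam.meas x) := by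
  have hw : Measurable fun g => ENNReal.ofReal (P.weight (𝒢.s g) ^ 2) :=
    (((P.continuous_weight.comp 𝒢.continuous_s).pow 2).measurable).ennreal_ofReal
  rw [← P.map_eq x] at hF ⊢
  rw [integral_map P.continuous_arrow.aemeasurable hF,
    integral_withDensity_eq_integral_toReal_smul hw (Eventually.of_forall fun _ =>
      ENNReal.ofReal_lt_top)]
  refine integral_congr_ae (Eventually.of_forall fun g => ?_)
  simp only [ENNReal.toReal_ofReal (sq_nonneg _)]
  rfl

/-- In the convolution of two pull-backs the inner weights meet at the intermediate point: `weight
(s h)` occurs once in each factor. Their product is the density that carries `lam` to `lam'`, and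
the outer weights `weight (r g)`, `weight (s g)` come out of the integral. -/
theorem pull_conv (f φ : C_c(G', ℂ)) :
    P.pull (lam'.conv f φ) = lam.conv (P.pull f) (P.pull φ) := by
  ext g
  change _ * lam'.convFun f φ (P.arrow g) = lam.convFun _ _ g
  have hi := (lam'.integrable_conv f φ (P.arrow g)).aestronglyMeasurable
  rw [P.r_arrow] at hi
  rw [convFun, convFun, P.r_arrow, P.integral_base hi, ← integral_const_mul]
  refine integral_congr_ae ?_
  filter_upwards [lam.ae_r (𝒢.r g)] with h hh
  have hs : 𝒢.s (𝒢.inv h) = 𝒢.r g := (𝒢.s_inv h).trans hh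
  rw [pull_apply, pull_apply, P.arrow_mul _ _ hs, P.arrow_inv, 𝒢.r_mul _ _ hs, 𝒢.s_mul _ _ hs,
    𝒢.r_inv, hh]
  push_cast
  ring

theorem pull_involution (f : C_c(G', ℂ)) :
    P.pull (involution 𝒢' f) = involution 𝒢 (P.pull f) := by
  ext g
  change _ * conj (f _) = conj (_ * f _)
  rw [map_mul, Complex.conj_ofReal, P.arrow_inv, 𝒢.r_inv, 𝒢.s_inv,
    mul_comm (P.weight (𝒢.r g))]

/-- On the source fibre over `x` the weight at the source is the constant `weight x`, while the
square of the weight at the range is absorbed by the change of measure. The constant occurs on both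
sides of any operator bound and cancels there. -/
theorem norm_toL2_pull (φ : C_c(G', ℂ)) (x : X) :
    ‖lam.toL2 (P.pull φ) x‖ = P.weight x * ‖lam'.toL2 φ (P.base x)‖ := by
  have h1 : ((‖lam.toL2 (P.pull φ) x‖ ^ 2 : ℝ) : ℂ) =
      (((P.weight x * ‖lam'.toL2 φ (P.base x)‖) ^ 2 : ℝ) : ℂ) := by
    rw [mul_pow, Complex.ofReal_mul, norm_toL2_sq, norm_toL2_sq,
      P.integral_base (F := normSqInv 𝒢' φ) (normSqInv 𝒢' φ).continuous.aestronglyMeasurable,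
      ← integral_const_mul]
    refine integral_congr_ae ?_
    filter_upwards [lam.ae_r x] with g hg
    change P.pull φ (𝒢.inv g) * conj (P.pull φ (𝒢.inv g)) =
      _ * (_ * (φ (𝒢'.inv (P.arrow g)) * conj (φ (𝒢'.inv (P.arrow g)))))
    rw [pull_apply, map_mul, Complex.conj_ofReal, P.arrow_inv, 𝒢.r_inv, 𝒢.s_inv, hg]
    push_cast
    ring
  have h2 := Complex.ofReal_injective h1
  exact (pow_left_inj₀ (norm_nonneg _)
    (mul_nonneg (P.weight_pos x).le (norm_nonneg _)) two_ne_zero).1 h2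

/-- A proper continuous injection is a closed embedding. Divide by the weights, extend by Tietze,
and cut off by a function equal to one on the image of the support. -/
theorem pull_surjective (hP : Function.Injective P.arrow) : Function.Surjective P.pull := by
  intro ψ
  have hce : IsClosedEmbedding P.arrow := by
    refine .of_continuous_injective_isClosedMap P.continuous_arrow hP ?_
    exact (isProperMap_iff_isCompact_preimage.2
      ⟨P.continuous_arrow, fun K hK => P.isCompact_preimage K hK⟩).isClosedMap
  have hw : ∀ g, 0 < P.weight (𝒢.r g) * P.weight (𝒢.s g) := fun g =>
    mul_pos (P.weight_pos _) (P.weight_pos _)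
  let ψ' : C(G, ℂ) := ⟨fun g => (((P.weight (𝒢.r g) * P.weight (𝒢.s g))⁻¹ : ℝ) : ℂ) * ψ g, by
    refine Continuous.mul (Complex.continuous_ofReal.comp (Continuous.inv₀ ?_ fun g => (hw g).ne'))
      ψ.continuous
    exact (P.continuous_weight.comp 𝒢.continuous_r).mul (P.continuous_weight.comp 𝒢.continuous_s)⟩
  obtain ⟨E, hE⟩ := ContinuousMap.exists_extension hce ψ'
  obtain ⟨χ, hχ1, -, hχc, -⟩ := exists_continuous_one_zero_of_isCompact
    (ψ.hasCompactSupport.isCompact.image P.continuous_arrow) isClosed_empty (Set.disjoint_empty _)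
  have hχc' : HasCompactSupport fun g => (χ g : ℂ) := hχc.comp_left Complex.ofReal_zero
  refine ⟨⟨⟨fun g => (χ g : ℂ) * E g, by fun_prop⟩, hχc'.mul_right⟩, ?_⟩
  ext g
  have h1 : E (P.arrow g) = (((P.weight (𝒢.r g) * P.weight (𝒢.s g))⁻¹ : ℝ) : ℂ) * ψ g :=
    DFunLike.congr_fun hE g
  change ((P.weight (𝒢.r g) * P.weight (𝒢.s g) : ℝ) : ℂ) * ((χ (P.arrow g) : ℂ) * E (P.arrow g))
    = ψ g
  rw [h1]
  by_cases hg : g ∈ tsupport ψ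
  · have h2 : ((P.weight (𝒢.r g) * P.weight (𝒢.s g) : ℝ) : ℂ) ≠ 0 :=
      Complex.ofReal_ne_zero.2 (hw g).ne'
    rw [hχ1 (Set.mem_image_of_mem _ hg), Complex.ofReal_inv]
    simp only [Pi.one_apply, Complex.ofReal_one, one_mul]
    rw [mul_inv_cancel_left₀ h2]
  · simp [image_eq_zero_of_notMem_tsupport hg]

/-- Injectivity of `arrow` makes every test function on `G` a pull-back, so each fibre bound
transfers from `G'`. -/
theorem norm_toReduced_pull_le (hP : Function.Injective P.arrow) (f : C_c(G', ℂ)) :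
    ‖lam.toReduced (P.pull f)‖ ≤ ‖lam'.toReduced f‖ := by
  refine lam.norm_toReduced_le (norm_nonneg _) fun ψ x => ?_
  obtain ⟨φ, rfl⟩ := P.pull_surjective hP ψ
  rw [← pull_conv, norm_toL2_pull, norm_toL2_pull, mul_left_comm]
  exact mul_le_mul_of_nonneg_left (lam'.norm_toL2_conv_le f φ _) (P.weight_pos x).le

/-- The reverse estimate, available only over the image of `base`; a bound on the whole norm needs
these images to cover the base of `𝒢'`. -/
theorem norm_toL2_conv_base_le (f φ : C_c(G', ℂ)) (x : X) :
    ‖lam'.toL2 (lam'.conv f φ) (P.base x)‖ ≤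
      ‖lam.toReduced (P.pull f)‖ * ‖lam'.toL2 φ (P.base x)‖ := by
  have h := lam.norm_toL2_conv_le (P.pull f) (P.pull φ) x
  rw [← pull_conv, norm_toL2_pull, norm_toL2_pull, mul_left_comm] at h
  exact le_of_mul_le_mul_left h (P.weight_pos x)

end Pullback

/-! ### The automorphism of the reduced algebra induced by an automorphism of the groupoid -/

namespace Density

variable {lam : 𝒢.HaarSystem} {α : 𝒢.Aut} (d : lam.Density α)

theorem measurable_ofReal_ρ : Measurable fun g => ENNReal.ofReal (d.ρ g) :=
  d.continuous_ρ.measurable.ennreal_ofReal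

/-- The density is invariant under left translations. -/
theorem ρ_mul {g h : G} (hgh : 𝒢.s g = 𝒢.r h) : d.ρ (𝒢.mul g h) = d.ρ h := by
  have := 𝒢.t2_base
  -- Writing the translating element as `α(k)` turns translation after `α` into `α` after
  -- translation by `k`, so the invariance of `λ` can be used on both sides of `map_eq`.
  obtain ⟨k, rfl⟩ := α.arrow.surjective g
  have hm : AEMeasurable (𝒢.mul (α.arrow k)) (lam.meas (α.base (𝒢.s k))) := by
    rw [← α.s_arrow]; exact lam.aemeasurable_mul _
  have hm' : AEMeasurable (𝒢.mul (α.arrow k)) ((lam.meas (𝒢.s k)).map α.arrow) := by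
    rw [d.map_eq]; exact hm.mono_ac (withDensity_absolutelyContinuous _ _)
  -- both sides are the image of `λ^{s(k)}` under `h ↦ α(k h)`
  have e : ((lam.meas (α.base (𝒢.s k))).withDensity fun h =>
        ENNReal.ofReal (d.ρ h)).map (𝒢.mul (α.arrow k)) =
      ((lam.meas (α.base (𝒢.s k))).withDensity fun h =>
        ENNReal.ofReal (d.ρ (𝒢.mul (α.arrow k) h))).map (𝒢.mul (α.arrow k)) := by
    rw [map_withDensity_comp _ hm d.measurable_ofReal_ρ, ← d.map_eq, ← α.s_arrow, lam.map_mul_left,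
      α.r_arrow, ← d.map_eq, ← lam.map_mul_left,
      AEMeasurable.map_map_of_aemeasurable hm' α.arrow.continuous.aemeasurable,
      AEMeasurable.map_map_of_aemeasurable α.arrow.continuous.aemeasurable (lam.aemeasurable_mul k)]
    refine Measure.map_congr ?_
    filter_upwards [lam.ae_r (𝒢.s k)] with h hh
    exact (α.arrow_mul k h hh.symm).symm
  -- translation back by `α(k)⁻¹`
  have hinv : ∀ ν : Measure G, ν ≪ lam.meas (α.base (𝒢.s k)) →
      (ν.map (𝒢.mul (α.arrow k))).map (𝒢.mul (𝒢.inv (α.arrow k))) = ν := by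
    intro ν hν
    have hm2 : AEMeasurable (𝒢.mul (𝒢.inv (α.arrow k))) (ν.map (𝒢.mul (α.arrow k))) := by
      have h1 : AEMeasurable (𝒢.mul (𝒢.inv (α.arrow k)))
          ((lam.meas (α.base (𝒢.s k))).map (𝒢.mul (α.arrow k))) := by
        rw [← α.s_arrow, lam.map_mul_left, ← 𝒢.s_inv]
        exact lam.aemeasurable_mul _
      refine h1.mono_ac (.mk fun s hs h0 => ?_)
      rw [Measure.map_apply_of_aemeasurable hm hs] at h0
      rw [Measure.map_apply_of_aemeasurable (hm.mono_ac hν) hs, hν h0]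
    rw [AEMeasurable.map_map_of_aemeasurable hm2 (hm.mono_ac hν)]
    refine (Measure.map_congr (g := id) ?_).trans Measure.map_id
    filter_upwards [hν.ae_le (lam.ae_r (α.base (𝒢.s k)))] with h hh
    exact 𝒢.inv_mul_cancel_left ((α.s_arrow k).trans hh.symm)
  have e2 := congrArg (Measure.map (𝒢.mul (𝒢.inv (α.arrow k)))) e
  rw [hinv _ (withDensity_absolutelyContinuous _ _),
    hinv _ (withDensity_absolutelyContinuous _ _)] at e2
  replace e2 := (withDensity_eq_iff_of_sigmaFinite d.measurable_ofReal_ρ.aemeasurable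
      (d.measurable_ofReal_ρ.comp_aemeasurable hm)).1 e2
  -- two continuous functions on the fibre that agree almost everywhere
  by_contra hne
  rw [α.s_arrow] at hgh
  have hc : ContinuousOn (fun h => d.ρ (𝒢.mul (α.arrow k) h)) {h | 𝒢.r h = α.base (𝒢.s k)} :=
    d.continuous_ρ.comp_continuousOn (𝒢.continuousOn_mul.comp (f := fun h : G => (α.arrow k, h))
      (continuous_const.prodMk continuous_id).continuousOn
      fun h hh => (α.s_arrow k).trans hh.symm)
  have hU : ∀ᶠ h' in 𝓝[{h | 𝒢.r h = α.base (𝒢.s k)}] h,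
      d.ρ (𝒢.mul (α.arrow k) h') ≠ d.ρ h' :=
    (((hc h hgh.symm).sub d.continuous_ρ.continuousWithinAt).eventually_ne
      (sub_ne_zero.2 hne)).mono fun _ => sub_ne_zero.1
  rw [eventually_nhdsWithin_iff] at hU
  -- Full support enters here: a neighbourhood of `h` on which the functions differ would have
  -- positive measure, against their equality almost everywhere.
  have hh : h ∈ (lam.meas (α.base (𝒢.s k))).support := by
    rw [lam.support_eq]; exact hgh.symm
  have hpos := (Measure.mem_support_iff_forall h).1 hh _ hU
  refine hpos.ne' (measure_mono_null ?_ (ae_iff.1 (e2.and (lam.ae_r (α.base (𝒢.s k))))))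
  intro h' hh' hcon
  refine hh' hcon.2 ?_
  exact ((ENNReal.ofReal_eq_ofReal_iff (d.pos _).le (d.pos _).le).1 hcon.1).symm

/-- Left invariance applied to `g⁻¹g`. This allows powers of `ρ` to serve as weights on the base. -/
theorem ρ_eq (g : G) : d.ρ g = d.ρ (𝒢.unit (𝒢.s g)) := by
  rw [← 𝒢.inv_mul, d.ρ_mul (𝒢.s_inv g)]

theorem ρ_inv (g : G) : d.ρ (𝒢.inv g) = d.ρ (𝒢.unit (𝒢.r g)) := by
  rw [d.ρ_eq, 𝒢.s_inv]

/-- The function `γ ↦ (ρ(γ⁻¹) ρ(γ))^{1/2} f(α⁻¹(γ))` as the pull-back of `f` by `α⁻¹`. -/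
def twistPullback : lam.Pullback lam where
  arrow := α.arrow.symm
  base := α.base.symm
  weight x := d.ρ (𝒢.unit x) ^ (1 / 2 : ℝ)
  continuous_arrow := α.arrow.symm.continuous
  isCompact_preimage _ hK := α.arrow.symm.isCompact_preimage.2 hK
  continuous_weight := (d.continuous_ρ.comp 𝒢.continuous_unit).rpow_const
    fun _ => Or.inl (d.pos _).ne'
  weight_pos _ := Real.rpow_pos_of_pos (d.pos _) _
  r_arrow g := by
    apply α.base.injective
    rw [← α.r_arrow]; simp
  s_arrow g := by
    apply α.base.injective
    rw [← α.s_arrow]; simp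
  arrow_mul g h hgh := by
    apply α.arrow.injective
    rw [α.arrow_mul]
    · simp
    · apply α.base.injective
      rw [← α.s_arrow, ← α.r_arrow]
      simpa using hgh
  map_eq x := by
    have h1 : ∀ g, (d.ρ (𝒢.unit (𝒢.s g)) ^ (1 / 2 : ℝ)) ^ 2 = d.ρ g := fun g => by
      rw [← d.ρ_eq, ← Real.sqrt_eq_rpow, Real.sq_sqrt (d.pos g).le]
    simp only [h1]
    have h2 := d.map_eq (α.base.symm x)
    rw [α.base.apply_symm_apply] at h2
    rw [← h2, Measure.map_map α.arrow.symm.continuous.measurable α.arrow.continuous.measurable]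
    have : α.arrow.symm ∘ α.arrow = id := funext α.arrow.symm_apply_apply
    rw [this, Measure.map_id]

theorem pull_twistPullback (f : C_c(G, ℂ)) : d.twistPullback.pull f = d.twist f := by
  ext g
  change ((d.ρ (𝒢.unit (𝒢.r g)) ^ (1 / 2 : ℝ) * d.ρ (𝒢.unit (𝒢.s g)) ^ (1 / 2 : ℝ) : ℝ) : ℂ) * _ =
    ((d.ρ (𝒢.inv g) ^ (1 / 2 : ℝ) * d.ρ g ^ (1 / 2 : ℝ) : ℝ) : ℂ) * _
  rw [← d.ρ_eq, ← d.ρ_inv]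
  rfl

/-- The automorphism of the reduced algebra induced by an automorphism of the groupoid. -/
theorem exists_twist_automorphism : ∃ αt : lam.Reduced ≃⋆ₐ[ℂ] lam.Reduced,
    ∀ f : C_c(G, ℂ), αt (lam.toReduced f) = lam.toReduced (d.twist f) := by
  let P := d.twistPullback
  have hP : Function.Injective P.arrow := α.arrow.symm.injective
  obtain ⟨Φ, hΦ, hf⟩ := lam.exists_isometric_extension (lam.toReducedₗ ∘ₗ P.pull)
    (fun f => by
      refine le_antisymm (P.norm_toReduced_pull_le hP f) ?_
      refine lam.norm_toReduced_le (norm_nonneg _) fun φ x => ?_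
      -- Every point `x` is the image under `P.base` of `α.base x`, so the reverse estimate covers
      -- all fibres.
      have h := P.norm_toL2_conv_base_le f φ (α.base x)
      rwa [show P.base (α.base x) = x from α.base.symm_apply_apply x] at h)
    (fun f f' => by
      change lam.toReduced (P.pull _) = lam.toReduced (P.pull f) * lam.toReduced (P.pull f')
      rw [P.pull_conv, toReduced_conv])
    (fun f => by
      change lam.toReduced (P.pull _) = star (lam.toReduced (P.pull f))
      rw [P.pull_involution, toReduced_involution])
  -- The range of an isometry from a complete space is closed, and this one contains the dense image
  -- of `C_c(G)`.
  have hs : Function.Surjective Φ := by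
    have hc : IsClosed (Set.range Φ) := hΦ.isClosedEmbedding.isClosed_range
    have hd : DenseRange Φ := by
      refine lam.denseRange_toReduced.mono ?_
      rintro _ ⟨ψ, rfl⟩
      obtain ⟨φ, rfl⟩ := P.pull_surjective hP ψ
      exact ⟨lam.toReduced φ, hf φ⟩
    exact Set.range_eq_univ.1 (hc.closure_eq ▸ hd.closure_range)
  refine ⟨StarAlgEquiv.ofBijective Φ ⟨hΦ.injective, hs⟩, fun f => ?_⟩
  exact (hf f).trans (congrArg lam.toReduced (d.pull_twistPullback f))

end Density

end HaarSystem

end TopGroupoid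

end

/-! ### Topology of suspensions, and the Haar system of the suspension groupoid. -/

noncomputable section

set_option linter.unusedSectionVars false

namespace Suspension

variable {Y : Type*} [TopologicalSpace Y] {f : Y ≃ₜ Y}

/-- Joint continuity can be tested on `(Y × ℝ) × ℝ`, because the quotient map is open and stays a
quotient map after multiplication by the identity of `ℝ`. -/
theorem continuous_flow : Continuous fun q : Suspension f × ℝ => flow f q.2 q.1 := by
  rw [((isOpenQuotientMap_mk (f := f)).prodMap
    (IsOpenQuotientMap.id (X := ℝ))).isQuotientMap.continuous_iff]
  exact continuous_mk.comp (by fun_prop : Continuous fun q : (Y × ℝ) × ℝ => (q.1.1, q.1.2 + q.2))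

/-- The part over a bounded interval of the preimage of a compact set is relatively compact. -/
theorem exists_isCompact_of_mk_mem [LocallyCompactSpace Y] [T2Space Y] {K : Set (Suspension f)}
    (hK : IsCompact K) (t₀ : ℝ) : ∃ L : Set Y, IsCompact L ∧
      ∀ y t, t ∈ Metric.closedBall t₀ 1 → mk f y t ∈ K → y ∈ L := by
  -- Flowing for the time `t₀ - t`, of absolute value at most one, moves `[y, t]` into the slice
  -- `t₀`. The set swept out by `K` is compact and the inclusion of the slice is proper.
  have h1 : IsCompact ((fun q : Suspension f × ℝ => flow f q.2 q.1) ''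
      (K ×ˢ Metric.closedBall 0 1)) :=
    (hK.prod (isCompact_closedBall 0 1)).image continuous_flow
  refine ⟨_, isCompact_preimage_mk h1 t₀, fun y t ht hy => ⟨(mk f y t, t₀ - t), ⟨hy, ?_⟩, ?_⟩⟩
  · rw [mem_closedBall_zero_iff, ← dist_eq_norm, dist_comm]
    exact ht
  · simp

/-- The projection `[y, t] ↦ t` of a suspension to the circle. -/
def toCircle (f : Y ≃ₜ Y) : Suspension f → AddCircle (1 : ℝ) :=
  Quotient.lift (fun q : Y × ℝ => (q.2 : AddCircle (1 : ℝ))) (by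
    rintro q _ ⟨n, rfl⟩
    have : ((n : ℝ) : AddCircle (1 : ℝ)) = 0 := (AddCircle.coe_eq_zero_iff 1).2 ⟨n, by simp⟩
    simp [this])

theorem continuous_toCircle : Continuous (toCircle f) :=
  Continuous.quotient_lift ((AddCircle.continuous_mk' 1).comp continuous_snd) _

/-- The product of `φ` with a function on the circle. -/
def mulCircle (k : C(AddCircle (1 : ℝ), ℝ)) (φ : C_c(Suspension f, ℂ)) :
    C_c(Suspension f, ℂ) where
  toFun q := (k (toCircle f q) : ℂ) * φ q
  continuous_toFun := (Complex.continuous_ofReal.comp (k.continuous.comp continuous_toCircle)).mul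
    φ.continuous
  hasCompactSupport' := φ.hasCompactSupport.mul_left

end Suspension

namespace TopGroupoid

variable {G X : Type*} [TopologicalSpace G] [TopologicalSpace X] {𝒢 : TopGroupoid G X}
  [T2Space G] [LocallyCompactSpace G] [SecondCountableTopology G]
  [MeasurableSpace G] [BorelSpace G]

namespace HaarSystem

namespace Density

variable {lam : 𝒢.HaarSystem} {α : 𝒢.Aut} (d : lam.Density α)

theorem continuous_mk_left (t : ℝ) : Continuous fun g : G => Suspension.mk α.arrow g t :=
  Suspension.continuous_mk.comp (by fun_prop : Continuous fun g : G => (g, t))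

theorem measurable_ofReal_rpow (c : ℝ) : Measurable fun g => ENNReal.ofReal (d.ρ g ^ c) :=
  (d.continuous_rpow continuous_id c).measurable.ennreal_ofReal

/-- The measure `f ↦ ∫ ρ(γ)^{-t} f([γ, t]) dλ^x(γ)` on the suspension. -/
def suspensionMeas (x : X) (t : ℝ) : Measure (Suspension α.arrow) :=
  ((lam.meas x).withDensity fun g => ENNReal.ofReal (d.ρ g ^ (-t))).map
    fun g => .mk α.arrow g t

/-- Split `ρ^{-(t-1)} = ρ · ρ^{-t}`. The first factor turns `λ^{α(x)}` into the image of `λ^x` under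
`α`, and the second passes through `α` because `ρ ∘ α = ρ`. Independence of representatives dictates
the exponent `-t`. -/
theorem suspensionMeas_base (hd : ∀ g, d.ρ (α.arrow g) = d.ρ g) (x : X) (t : ℝ) :
    d.suspensionMeas (α.base x) (t - 1) = d.suspensionMeas x t := by
  have h1 : (fun g => ENNReal.ofReal (d.ρ g ^ (-(t - 1)))) =
      (fun g => ENNReal.ofReal (d.ρ g)) * fun g => ENNReal.ofReal (d.ρ g ^ (-t)) := by
    funext g
    rw [Pi.mul_apply, ← ENNReal.ofReal_mul (d.pos g).le]
    congr 1
    rw [show -(t - 1) = 1 + -t by ring, Real.rpow_add (d.pos g), Real.rpow_one]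
  have h2 := map_withDensity_comp (lam.meas x) α.arrow.continuous.aemeasurable
    (d.measurable_ofReal_rpow (-t))
  simp only [hd] at h2
  rw [suspensionMeas, h1, withDensity_mul _ d.measurable_ofReal_ρ (d.measurable_ofReal_rpow _),
    ← d.map_eq, ← h2, Measure.map_map (continuous_mk_left _).measurable
      α.arrow.continuous.measurable]
  congr 1
  funext g
  exact Suspension.mk_apply g t

theorem suspensionMeas_zpow (hd : ∀ g, d.ρ (α.arrow g) = d.ρ g) (n : ℤ) (x : X) (t : ℝ) :
    d.suspensionMeas ((α.base ^ n) x) (t - n) = d.suspensionMeas x t := by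
  induction n generalizing x t with
  | zero => simp
  | succ n ih =>
    rw [zpow_add_one, Homeomorph.mul_apply, ← d.suspensionMeas_base hd x t,
      ← ih (α.base x) (t - 1), Int.cast_add, Int.cast_one, add_comm, sub_add_eq_sub_sub]
  | pred n ih =>
    rw [zpow_sub_one, Homeomorph.mul_apply, ← ih x t, ← d.suspensionMeas_base hd]
    have h : α.base ((α.base ^ (-(n : ℤ))) (α.base⁻¹ x)) = (α.base ^ (-(n : ℤ))) x := by
      rw [← Homeomorph.mul_apply, ← Homeomorph.mul_apply, ← zpow_one_add, ← zpow_sub_one]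
      congr 2
      ring
    rw [h]
    congr 1
    push_cast
    ring

theorem ae_suspensionMeas (x : X) (t : ℝ) :
    ∀ᵐ q ∂(d.suspensionMeas x t), α.suspension.r q = .mk α.base x t := by
  have := 𝒢.t2_base
  rw [suspensionMeas, ae_map_iff (continuous_mk_left _).aemeasurable]
  · filter_upwards [(withDensity_absolutelyContinuous _ _).ae_le (lam.ae_r x)] with g hg
    change Suspension.mk α.base (𝒢.r g) t = _
    rw [hg]
  · exact (isClosed_singleton.preimage α.suspension.continuous_r).measurableSet

theorem exists_rep_of_r_eq {q : Suspension α.arrow} {x : X} {t : ℝ}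
    (h : α.suspension.r q = .mk α.base x t) : ∃ g, 𝒢.r g = x ∧ q = .mk α.arrow g t := by
  induction q using Suspension.ind with | _ g u
  obtain ⟨n, rfl, rfl⟩ := Suspension.mk_eq_iff.1 h
  exact ⟨(α.arrow ^ n) g, Suspension.semiconj_zpow α.r_arrow n g, (Suspension.mk_zpow n g u).symm⟩

/-- The density is strictly positive, so it creates no new null sets, and the range fibre over `[x,
t]` is exactly the copy of `G^x` in the slice `t`. -/
theorem support_suspensionMeas (x : X) (t : ℝ) :
    (d.suspensionMeas x t).support = {q | α.suspension.r q = .mk α.base x t} := by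
  have := 𝒢.t2_base
  refine Set.Subset.antisymm (Measure.support_subset_of_isClosed
    (isClosed_singleton.preimage α.suspension.continuous_r) (d.ae_suspensionMeas x t)) ?_
  intro q hq
  obtain ⟨g, rfl, rfl⟩ := exists_rep_of_r_eq hq
  rw [Measure.mem_support_iff_forall]
  intro U hU
  obtain ⟨V, hVU, hV, hgV⟩ := mem_nhds_iff.1 hU
  refine lt_of_lt_of_le ?_ (measure_mono hVU)
  rw [suspensionMeas, Measure.map_apply (continuous_mk_left _).measurable hV.measurableSet]
  have hg : g ∈ (lam.meas (𝒢.r g)).support := by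
    rw [lam.support_eq]; rfl
  have hpos := (Measure.mem_support_iff_forall g).1 hg _
    ((continuous_mk_left (α := α) t).continuousAt (hV.mem_nhds hgV))
  refine pos_iff_ne_zero.2 fun h0 => hpos.ne' ?_
  exact withDensity_absolutelyContinuous' (d.measurable_ofReal_rpow (-t)).aemeasurable
    (Eventually.of_forall fun g => (ENNReal.ofReal_pos.2 (Real.rpow_pos_of_pos (d.pos g) _)).ne') h0

theorem continuous_integral_suspensionMeas (f : C_c(Suspension α.arrow, ℂ)) :
    Continuous fun p : X × ℝ => ∫ q, f q ∂(d.suspensionMeas p.1 p.2) := by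
  have h1 : ∀ p : X × ℝ, ∫ q, f q ∂(d.suspensionMeas p.1 p.2) =
      ∫ g, ((d.ρ g ^ (-p.2) : ℝ) : ℂ) * f (.mk α.arrow g p.2) ∂(lam.meas p.1) := fun p => by
    rw [suspensionMeas, integral_map (f := f) (continuous_mk_left _).aemeasurable
      f.continuous.aestronglyMeasurable, integral_withDensity_eq_integral_toReal_smul
      (d.measurable_ofReal_rpow _) (Eventually.of_forall fun _ => ENNReal.ofReal_lt_top)]
    refine integral_congr_ae (Eventually.of_forall fun g => ?_)
    simp only [ENNReal.toReal_ofReal (Real.rpow_pos_of_pos (d.pos g) _).le]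
    rfl
  simp only [h1]
  refine continuous_iff_continuousAt.2 fun p₀ => ?_
  -- For times within distance one of that of `p₀`, all integrands are supported in the same compact
  -- set `L`, as `continuousAt_integral` requires.
  obtain ⟨L, hL, hL'⟩ := Suspension.exists_isCompact_of_mk_mem f.hasCompactSupport.isCompact p₀.2
  refine lam.continuousAt_integral
    (F := fun g p => ((d.ρ g ^ (-p.2) : ℝ) : ℂ) * f (.mk α.arrow g p.2)) continuous_fst ?_ hL ?_
  · refine (Complex.continuous_ofReal.comp ?_).mul (f.continuous.comp ?_)
    · exact (d.continuous_ρ.comp continuous_fst).rpow (by fun_prop) fun q => Or.inl (d.pos _).ne'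
    · exact Suspension.continuous_mk.comp
        (by fun_prop : Continuous fun q : G × (X × ℝ) => (q.1, q.2.2))
  · filter_upwards [continuous_snd.continuousAt (Metric.closedBall_mem_nhds p₀.2 one_pos)]
      with p hp g hg
    have : f (.mk α.arrow g p.2) = 0 := by
      by_contra h
      exact hg (hL' g p.2 hp (subset_tsupport f h))
    rw [this, mul_zero]

/-- The weight `ρ^{-t}` is unchanged by left translations (`ρ_mul`), so the invariance of `λ`
survives the weighting. -/
theorem map_mul_left_suspensionMeas (g : G) (t : ℝ) :
    (d.suspensionMeas (𝒢.s g) t).map (α.suspension.mul (.mk α.arrow g t)) =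
      d.suspensionMeas (𝒢.r g) t := by
  have := 𝒢.t2_base
  have hm : AEMeasurable (α.suspension.mul (.mk α.arrow g t)) (d.suspensionMeas (𝒢.s g) t) := by
    rw [← Measure.restrict_eq_self_of_ae_mem (d.ae_suspensionMeas (𝒢.s g) t)]
    refine ContinuousOn.aemeasurable ?_
      (isClosed_singleton.preimage α.suspension.continuous_r).measurableSet
    exact α.suspension.continuousOn_mul.comp
      (f := fun h : Suspension α.arrow => (Suspension.mk α.arrow g t, h))
      (continuous_const.prodMk continuous_id).continuousOn
      fun h (hh : α.suspension.r h = .mk α.base (𝒢.s g) t) => hh.symm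
  have hmg : AEMeasurable (𝒢.mul g) ((lam.meas (𝒢.s g)).withDensity
      fun g => ENNReal.ofReal (d.ρ g ^ (-t))) :=
    (lam.aemeasurable_mul g).mono_ac (withDensity_absolutelyContinuous _ _)
  have h1 : ((lam.meas (𝒢.s g)).withDensity fun g => ENNReal.ofReal (d.ρ g ^ (-t))).map
      (𝒢.mul g) = (lam.meas (𝒢.r g)).withDensity fun g => ENNReal.ofReal (d.ρ g ^ (-t)) := by
    rw [← lam.map_mul_left g, ← map_withDensity_comp _ (lam.aemeasurable_mul g)
      (d.measurable_ofReal_rpow (-t))]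
    congr 1
    refine withDensity_congr_ae ?_
    filter_upwards [lam.ae_r (𝒢.s g)] with h hh
    rw [d.ρ_mul hh.symm]
  rw [suspensionMeas, AEMeasurable.map_map_of_aemeasurable hm (continuous_mk_left _).aemeasurable,
    suspensionMeas, ← h1, AEMeasurable.map_map_of_aemeasurable
      (continuous_mk_left _).aemeasurable hmg]
  refine Measure.map_congr ?_
  filter_upwards [(withDensity_absolutelyContinuous _ _).ae_le (lam.ae_r (𝒢.s g))] with h hh
  exact α.suspensionMul_mk hh.symm t

/-- The Haar system of the suspension groupoid. -/
def suspensionHaar (hd : ∀ g, d.ρ (α.arrow g) = d.ρ g) : α.suspension.HaarSystem where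
  meas := Quotient.lift (fun p : X × ℝ => d.suspensionMeas p.1 p.2) (by
    rintro p _ ⟨n, rfl⟩
    exact (d.suspensionMeas_zpow hd n p.1 p.2).symm)
  finite_on_compacts := Suspension.ind fun x t => ⟨fun K hK => by
    change d.suspensionMeas x t K < ∞
    rw [suspensionMeas, Measure.map_apply (continuous_mk_left _).measurable hK.measurableSet]
    have : IsLocallyFiniteMeasure
        ((lam.meas x).withDensity fun g => ENNReal.ofReal (d.ρ g ^ (-t))) :=
      IsLocallyFiniteMeasure.withDensity_ofReal (d.continuous_rpow continuous_id _)
    exact (Suspension.isCompact_preimage_mk hK t).measure_lt_top⟩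
  support_eq := Suspension.ind fun x t => d.support_suspensionMeas x t
  continuous_integral f := by
    rw [(Suspension.isOpenQuotientMap_mk (f := α.base)).isQuotientMap.continuous_iff]
    exact d.continuous_integral_suspensionMeas f
  map_mul_left := Suspension.ind fun g t => d.map_mul_left_suspensionMeas g t

variable (hd : ∀ g, d.ρ (α.arrow g) = d.ρ g)

/-! ### Restriction to the slices of the suspension -/

theorem sq_rpow_neg_half (g : G) (t : ℝ) : (d.ρ g ^ (-t / 2)) ^ 2 = d.ρ g ^ (-t) := by
  rw [← Real.rpow_natCast, ← Real.rpow_mul (d.pos g).le]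
  congr 1
  push_cast
  ring

/-- The inclusion of the slice `G × {t}` in the suspension groupoid. -/
def hatPullback (t : ℝ) : lam.Pullback (d.suspensionHaar hd) where
  arrow g := .mk α.arrow g t
  base x := .mk α.base x t
  -- Composed with the source and squared, this is the density `ρ^{-t}` in the Haar system of the
  -- suspension.
  weight x := d.ρ (𝒢.unit x) ^ (-t / 2)
  continuous_arrow := continuous_mk_left t
  isCompact_preimage _ hK := Suspension.isCompact_preimage_mk hK t
  continuous_weight := (d.continuous_ρ.comp 𝒢.continuous_unit).rpow_const
    fun _ => Or.inl (d.pos _).ne'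
  weight_pos _ := Real.rpow_pos_of_pos (d.pos _) _
  r_arrow _ := rfl
  s_arrow _ := rfl
  arrow_mul _ _ hgh := (α.suspensionMul_mk hgh t).symm
  map_eq x := by
    simp only [← d.ρ_eq, d.sq_rpow_neg_half]
    rfl

theorem pull_hatPullback (f : C_c(Suspension α.arrow, ℂ)) (t : ℝ) :
    (d.hatPullback hd t).pull f = d.hat f t := by
  ext g
  change ((d.ρ (𝒢.unit (𝒢.r g)) ^ (-t / 2) * d.ρ (𝒢.unit (𝒢.s g)) ^ (-t / 2) : ℝ) : ℂ) * _ =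
    ((d.ρ g ^ (-t / 2) * d.ρ (𝒢.inv g) ^ (-t / 2) : ℝ) : ℂ) * _
  rw [← d.ρ_eq, ← d.ρ_inv, mul_comm (d.ρ (𝒢.inv g) ^ _)]
  rfl

theorem injective_hatPullback (t : ℝ) : Function.Injective (d.hatPullback hd t).arrow :=
  fun _ _ h => α.mk_eq_mk h

theorem hat_surjective (hd : ∀ g, d.ρ (α.arrow g) = d.ρ g) (t : ℝ) :
    Function.Surjective fun f => d.hat f t := by
  intro ψ
  obtain ⟨f, rfl⟩ := (d.hatPullback hd t).pull_surjective (d.injective_hatPullback hd t) ψ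
  exact ⟨f, (d.pull_hatPullback hd f t).symm⟩

theorem hat_add (f f' : C_c(Suspension α.arrow, ℂ)) (t : ℝ) :
    d.hat (f + f') t = d.hat f t + d.hat f' t := by
  ext g
  exact mul_add _ (f _) (f' _)

theorem hat_smul (c : ℂ) (f : C_c(Suspension α.arrow, ℂ)) (t : ℝ) :
    d.hat (c • f) t = c • d.hat f t := by
  ext g
  exact mul_left_comm _ c (f _)

/-- Functions on the circle act by scalars on each slice; this is what allows patching by a
partition of unity. -/
theorem hat_mulCircle (k : C(AddCircle (1 : ℝ), ℝ)) (f : C_c(Suspension α.arrow, ℂ)) (t : ℝ) :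
    d.hat (Suspension.mulCircle k f) t = ((k (t : AddCircle (1 : ℝ)) : ℝ) : ℂ) • d.hat f t := by
  ext g
  exact mul_left_comm _ _ (f _)

theorem norm_toReduced_hat_le (f : C_c(Suspension α.arrow, ℂ)) (t : ℝ) :
    ‖lam.toReduced (d.hat f t)‖ ≤ ‖(d.suspensionHaar hd).toReduced f‖ := by
  rw [← d.pull_hatPullback hd]
  exact (d.hatPullback hd t).norm_toReduced_pull_le (d.injective_hatPullback hd t) f

/-- Each `[x, u]` has a representative whose real coordinate is the fractional part of `u`. Thus the
slices over `[0, 1]` meet all fibres, and the reverse estimate for pull-backs applies to each. -/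
theorem norm_toReduced_le_of_hat {f : C_c(Suspension α.arrow, ℂ)} {C : ℝ} (hC : 0 ≤ C)
    (h : ∀ t : unitInterval, ‖lam.toReduced (d.hat f t)‖ ≤ C) :
    ‖(d.suspensionHaar hd).toReduced f‖ ≤ C := by
  refine norm_toReduced_le _ hC fun φ => Suspension.ind fun x u => ?_
  obtain ⟨y, t, e⟩ : ∃ (y : X) (t : unitInterval),
      Suspension.mk α.base x u = Suspension.mk α.base y t :=
    ⟨(α.base ^ ⌊u⌋) x, ⟨Int.fract u, Int.fract_nonneg u, (Int.fract_lt_one u).le⟩,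
      (Suspension.mk_zpow ⌊u⌋ x u).symm⟩
  rw [e]
  have h1 := (d.hatPullback hd t).norm_toL2_conv_base_le f φ y
  rw [pull_hatPullback] at h1
  exact h1.trans (mul_le_mul_of_nonneg_right (h t) (norm_nonneg _))

/-- For `t` near `t₀` the functions `f̂(t)` are supported in one compact set and converge uniformly
there. Their differences are dominated by small multiples of a fixed cut-off, hence small in the
reduced norm. -/
theorem continuous_toReduced_hat (f : C_c(Suspension α.arrow, ℂ)) :
    Continuous fun t : ℝ => lam.toReduced (d.hat f t) := by
  have hc : Continuous fun q : ℝ × G => d.hat f q.1 q.2 := by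
    refine (Complex.continuous_ofReal.comp (Continuous.mul ?_ ?_)).mul (f.continuous.comp
      (Suspension.continuous_mk.comp (continuous_snd.prodMk continuous_fst)))
    · exact (d.continuous_ρ.comp continuous_snd).rpow (by fun_prop) fun q => Or.inl (d.pos _).ne'
    · exact (d.continuous_ρ.comp (𝒢.continuous_inv.comp continuous_snd)).rpow (by fun_prop)
        fun q => Or.inl (d.pos _).ne'
  refine continuous_iff_continuousAt.2 fun t₀ => ?_
  obtain ⟨L, hL, hL'⟩ := Suspension.exists_isCompact_of_mk_mem f.hasCompactSupport.isCompact t₀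
  obtain ⟨χ, hχ1, -, hχc, -⟩ := exists_continuous_one_zero_of_isCompact hL
    isClosed_empty (Set.disjoint_empty L)
  let χ' : C_c(G, ℂ) := ⟨⟨fun g => (χ g : ℂ), by fun_prop⟩, hχc.comp_left Complex.ofReal_zero⟩
  obtain ⟨C, hC, hCf⟩ := lam.exists_norm_toReduced_le_of_dominated χ'
  have h0 : ∀ t ∈ Metric.closedBall t₀ 1, ∀ g ∉ L, d.hat f t g = 0 := fun t ht g hg => by
    have : f (.mk α.arrow g t) = 0 := by
      by_contra h
      exact hg (hL' g t ht (subset_tsupport f h))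
    change _ * f _ = 0
    rw [this, mul_zero]
  rw [ContinuousAt, Metric.tendsto_nhds]
  intro ε hε
  have hδ : 0 < ε / (C + 1) := by positivity
  have h1 : ∀ᶠ t in 𝓝 t₀, ∀ g ∈ L, ‖d.hat f t g - d.hat f t₀ g‖ < ε / (C + 1) := by
    refine hL.eventually_forall_of_forall_eventually fun g hg => ?_
    have h2 : Continuous fun q : ℝ × G => ‖d.hat f q.1 q.2 - d.hat f t₀ q.2‖ :=
      (hc.sub ((d.hat f t₀).continuous.comp continuous_snd)).norm
    exact h2.continuousAt.eventually_lt continuousAt_const (by simpa using hδ)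
  filter_upwards [h1, Metric.closedBall_mem_nhds t₀ one_pos] with t ht htb
  rw [dist_eq_norm, ← toReduced_sub]
  refine (hCf _ _ hδ.le fun g => ?_).trans_lt ?_
  · change ‖d.hat f t g - d.hat f t₀ g‖ ≤ _ * ‖((χ g : ℝ) : ℂ)‖
    by_cases hg : g ∈ L
    · rw [hχ1 hg]; simpa using (ht g hg).le
    · rw [h0 t htb g hg, h0 t₀ (Metric.mem_closedBall_self zero_le_one) g hg, sub_zero, norm_zero]
      positivity
  · rw [div_mul_eq_mul_div, div_lt_iff₀ (by positivity)]
    nlinarith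

/-- The boundary condition of the mapping torus, from `[γ, t + 1] = [α(γ), t]`. The exponents match
because `1/2 - (t + 1)/2 = -t/2`, and `ρ ∘ α = ρ` identifies the values of `ρ` at `γ` and `α(γ)`. -/
theorem twist_hat (hd : ∀ g, d.ρ (α.arrow g) = d.ρ g) (f : C_c(Suspension α.arrow, ℂ)) (t : ℝ) :
    d.twist (d.hat f (t + 1)) = d.hat f t := by
  ext g
  obtain ⟨g, rfl⟩ := α.arrow.surjective g
  have e : Suspension.mk α.arrow g (t + 1) = .mk α.arrow (α.arrow g) t := by
    have := Suspension.mk_apply (f := α.arrow) g (t + 1)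
    rw [← this, add_sub_cancel_right]
  have hr : ∀ h : G, d.ρ h ^ (1 / 2 : ℝ) * d.ρ h ^ (-(t + 1) / 2) = d.ρ h ^ (-t / 2) := fun h => by
    rw [← Real.rpow_add (d.pos h)]
    congr 1
    ring
  change ((d.ρ (𝒢.inv (α.arrow g)) ^ (1 / 2 : ℝ) * d.ρ (α.arrow g) ^ (1 / 2 : ℝ) : ℝ) : ℂ) *
    (((d.ρ (α.arrow.symm (α.arrow g)) ^ (-(t + 1) / 2) *
      d.ρ (𝒢.inv (α.arrow.symm (α.arrow g))) ^ (-(t + 1) / 2) : ℝ) : ℂ) *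
      f (.mk α.arrow (α.arrow.symm (α.arrow g)) (t + 1))) =
    ((d.ρ (α.arrow g) ^ (-t / 2) * d.ρ (𝒢.inv (α.arrow g)) ^ (-t / 2) : ℝ) : ℂ) * f _
  rw [α.arrow.symm_apply_apply, α.inv_arrow, hd, hd, e, ← hr g, ← hr (𝒢.inv g)]
  push_cast
  ring

/-! ### The flow on the suspension -/

/-- The function `[γ, t] ↦ ρ(γ)^s` on the suspension. -/
def flowρ (hd : ∀ g, d.ρ (α.arrow g) = d.ρ g) (s : ℝ) : Suspension α.arrow → ℝ :=
  Quotient.lift (fun q : G × ℝ => d.ρ q.1 ^ s) (by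
    rintro q _ ⟨n, rfl⟩
    -- Invariance of `ρ` under `α` is a semiconjugacy to the identity of `ℝ`, so it passes to all
    -- integer powers.
    have h := Suspension.semiconj_zpow (f := α.arrow) (f' := Homeomorph.refl ℝ) (φ := d.ρ) hd n q.1
    have h1 : (Homeomorph.refl ℝ) ^ n = 1 := one_zpow n
    rw [h1] at h
    exact congrArg (· ^ s) h.symm)

theorem continuous_flowρ (s : ℝ) : Continuous (d.flowρ hd s) :=
  Continuous.quotient_lift ((d.continuous_rpow continuous_id s).comp continuous_fst) _

/-- The density `[γ, t] ↦ ρ(γ)^s` of the flow on the suspension. -/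
def flowDensity (s : ℝ) : (d.suspensionHaar hd).Density (α.suspensionFlow s) where
  ρ := d.flowρ hd s
  continuous_ρ := d.continuous_flowρ hd s
  pos := Suspension.ind fun g _ => Real.rpow_pos_of_pos (d.pos g) s
  map_eq := Suspension.ind fun x t => by
    change (d.suspensionMeas x t).map (Suspension.flow α.arrow s) =
      (d.suspensionMeas x (t + s)).withDensity fun q => ENNReal.ofReal (d.flowρ hd s q)
    -- The flow moves the slice `t` to the slice `t + s` without changing `γ`, so the density only
    -- has to convert `ρ^{-(t+s)}` into `ρ^{-t}`.
    have e : ((fun g => ENNReal.ofReal (d.ρ g ^ (-(t + s)))) *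
        fun g => ENNReal.ofReal (d.ρ g ^ s)) = fun g => ENNReal.ofReal (d.ρ g ^ (-t)) := by
      funext g
      rw [Pi.mul_apply, ← ENNReal.ofReal_mul (Real.rpow_pos_of_pos (d.pos g) _).le,
        ← Real.rpow_add (d.pos g), neg_add_rev, neg_add_cancel_comm]
    rw [suspensionMeas, Measure.map_map (Suspension.flow α.arrow s).continuous.measurable
      (continuous_mk_left _).measurable, suspensionMeas, ← map_withDensity_comp _
      (continuous_mk_left _).aemeasurable (d.continuous_flowρ hd s).measurable.ennreal_ofReal, ← e,
      withDensity_mul _ (d.measurable_ofReal_rpow _) (d.measurable_ofReal_rpow s)]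
    rfl

theorem flow_twist_mk (s : ℝ) (f : C_c(Suspension α.arrow, ℂ)) (g : G) (t : ℝ) :
    (d.flowDensity hd s).twist f (.mk α.arrow g t) =
      ((d.ρ (𝒢.inv g) ^ (s / 2) * d.ρ g ^ (s / 2) : ℝ) : ℂ) * f (.mk α.arrow g (t - s)) := by
  have h : ∀ g : G, (d.ρ g ^ s) ^ (1 / 2 : ℝ) = d.ρ g ^ (s / 2) := fun g => by
    rw [← Real.rpow_mul (d.pos g).le, mul_one_div]
  rw [← h, ← h]
  rfl

theorem flow_twist_zero (f : C_c(Suspension α.arrow, ℂ)) :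
    (d.flowDensity hd 0).twist f = f := by
  ext q
  induction q using Suspension.ind with | _ g t
  rw [flow_twist_mk]
  simp

theorem flow_twist_add (s s' : ℝ) (f : C_c(Suspension α.arrow, ℂ)) :
    (d.flowDensity hd (s + s')).twist f =
      (d.flowDensity hd s).twist ((d.flowDensity hd s').twist f) := by
  ext q
  induction q using Suspension.ind with | _ g t
  rw [flow_twist_mk, flow_twist_mk, flow_twist_mk, sub_sub, add_div, Real.rpow_add (d.pos _),
    Real.rpow_add (d.pos _)]
  push_cast
  ring

/-- Equivariance on `C_c`: the exponents add up, `-t/2 + s/2 = -(t - s)/2`. -/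
theorem hat_flow_twist (s : ℝ) (f : C_c(Suspension α.arrow, ℂ)) (t : ℝ) :
    d.hat ((d.flowDensity hd s).twist f) t = d.hat f (t - s) := by
  ext g
  change ((d.ρ g ^ (-t / 2) * d.ρ (𝒢.inv g) ^ (-t / 2) : ℝ) : ℂ) *
    (d.flowDensity hd s).twist f (.mk α.arrow g t) =
    ((d.ρ g ^ (-(t - s) / 2) * d.ρ (𝒢.inv g) ^ (-(t - s) / 2) : ℝ) : ℂ) * f (.mk α.arrow g (t - s))
  rw [flow_twist_mk, show -(t - s) / 2 = -t / 2 + s / 2 by ring, Real.rpow_add (d.pos _),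
    Real.rpow_add (d.pos _)]
  push_cast
  ring

end Density

end HaarSystem

end TopGroupoid

end

/-! ### Elements of the mapping torus as quasi-periodic functions on `ℝ`. -/

noncomputable section

section MappingTorusExtend

variable {A : Type*} [NonUnitalCStarAlgebra A] {β : A ≃⋆ₐ[ℂ] A}

theorem zpow_apply_add_intCast {F : ℝ → A} (hF : ∀ u, β (F (u + 1)) = F u) (n : ℤ) (u : ℝ) :
    (β ^ n) (F (u + n)) = F u := by
  induction n generalizing u with
  | zero => simp
  | succ n ih =>
    rw [zpow_add_one, StarAlgEquiv.mul_apply]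
    push_cast
    rw [← add_assoc, hF]
    exact ih u
  | pred n ih =>
    rw [zpow_sub_one, StarAlgEquiv.mul_apply]
    push_cast
    have h : β⁻¹ (F (u + (-(n : ℝ) - 1))) = F (u + -(n : ℝ)) := by
      have h1 := hF (u + (-(n : ℝ) - 1))
      rw [← h1, show u + (-(n : ℝ) - 1) + 1 = u + -(n : ℝ) by ring]
      exact β.symm_apply_apply _
    rw [h]
    have := ih u
    push_cast at this
    exact this

/-- A function `F` with `F(u) = β(F(u + 1))` is the extension of its restriction to `[0, 1]`. -/
theorem mappingTorusExtend_eq {F : ℝ → A} (hF : ∀ u, β (F (u + 1)) = F u) {h : mappingTorus β}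
    (hh : ∀ t : unitInterval, h.1 t = F t) (u : ℝ) : mappingTorusExtend h u = F u := by
  rw [mappingTorusExtend, hh, ← zpow_apply_add_intCast hF (-⌊u⌋) u]
  push_cast
  rfl

/-- On each closed interval `[n, n + 1]` the extension is `β^{-n}` applied to a translate of `h`,
also at the right end point thanks to the boundary condition. These closed intervals form a locally
finite cover. -/
theorem continuous_mappingTorusExtend (h : mappingTorus β) : Continuous (mappingTorusExtend h) := by
  have hE := mappingTorusExtend_add_one h
  refine LocallyFinite.continuous (f := fun n : ℤ => Set.Icc (n : ℝ) (n + 1)) ?_ ?_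
    (fun n => isClosed_Icc) fun n => ?_
  · intro a
    refine ⟨Metric.ball a 1, Metric.ball_mem_nhds _ one_pos, ?_⟩
    refine (Set.finite_Icc ⌊a - 2⌋ ⌈a + 1⌉).subset ?_
    rintro n ⟨b, hbn, hb⟩
    rw [Metric.mem_ball, Real.dist_eq, abs_lt] at hb
    exact ⟨Int.cast_le.1 ((Int.floor_le _).trans (by linarith [hbn.2]) : ((⌊a - 2⌋ : ℤ) : ℝ) ≤ n),
      Int.cast_le.1 (le_trans (by linarith [hbn.1]) (Int.le_ceil _) : (n : ℝ) ≤ (⌈a + 1⌉ : ℤ))⟩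
  · exact Set.iUnion_eq_univ_iff.2 fun u => ⟨⌊u⌋, Int.floor_le u, (Int.lt_floor_add_one u).le⟩
  · have h1 : Continuous fun u : ℝ =>
        (β ^ (-n)) (h.1 (Set.projIcc 0 1 zero_le_one (u - n))) :=
      (StarAlgEquiv.isometry (β ^ (-n))).continuous.comp
        (h.1.continuous.comp (continuous_projIcc.comp (by fun_prop)))
    refine h1.continuousOn.congr fun u hu => ?_
    have hu' : u - n ∈ Set.Icc (0 : ℝ) 1 := ⟨by linarith [hu.1], by linarith [hu.2]⟩
    have h2 := zpow_apply_add_intCast hE (-n) u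
    rw [← h2]
    congr 1
    rw [Set.projIcc_of_mem _ hu', ← mappingTorusExtend_coe]
    push_cast
    rfl

/-- The distance of two functions with `F(u) = β(F(u + 1))` is periodic. -/
theorem norm_sub_add_intCast {F F' : ℝ → A} (hF : ∀ u, β (F (u + 1)) = F u)
    (hF' : ∀ u, β (F' (u + 1)) = F' u) (n : ℤ) (u : ℝ) :
    ‖F (u + n) - F' (u + n)‖ = ‖F u - F' u‖ := by
  rw [← zpow_apply_add_intCast hF n u, ← zpow_apply_add_intCast hF' n u, ← map_sub,
    StarAlgEquiv.norm_map]

/-- The point evaluations of an isomorphism onto the mapping torus, as star homomorphisms. -/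
def mappingTorusEval {B : Type*} [NonUnitalCStarAlgebra B] (Λ : B ≃⋆ₐ[ℂ] mappingTorus β)
    (t : unitInterval) : B →⋆ₙₐ[ℂ] A where
  toFun a := (Λ a).1 t
  map_smul' c a := by rw [map_smul]; rfl
  map_zero' := by rw [map_zero]; rfl
  map_add' a b := by rw [map_add]; rfl
  map_mul' a b := by rw [map_mul]; rfl
  map_star' a := by rw [map_star]; rfl

end MappingTorusExtend

/-! ### The isomorphism with the mapping torus and the action of `ℝ`. -/

namespace TopGroupoid.HaarSystem.Density

variable {G X : Type*} [TopologicalSpace G] [TopologicalSpace X] {𝒢 : TopGroupoid G X}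
  [T2Space G] [LocallyCompactSpace G] [SecondCountableTopology G]
  [MeasurableSpace G] [BorelSpace G] {lam : 𝒢.HaarSystem} {α : 𝒢.Aut} (d : lam.Density α)
  (hd : ∀ g, d.ρ (α.arrow g) = d.ρ g)

/-- The map `f ↦ f̂` from `C_c` of the suspension groupoid to the continuous functions on `[0, 1]`
with values in the reduced algebra. -/
def hatₗ : C_c(Suspension α.arrow, ℂ) →ₗ[ℂ] C(unitInterval, lam.Reduced) where
  toFun f := ⟨fun t => lam.toReduced (d.hat f t),
    (d.continuous_toReduced_hat f).comp continuous_subtype_val⟩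
  map_add' f f' := by
    ext t
    change lam.toReduced (d.hat (f + f') t) = lam.toReduced _ + lam.toReduced _
    rw [hat_add, toReduced_add]
  map_smul' c f := by
    ext t
    change lam.toReduced (d.hat (c • f) t) = c • lam.toReduced _
    rw [hat_smul, toReduced_smul]

/-- Restriction to a slice does not increase norms, and the slices over `[0, 1]` together recover
the norm. Products and adjoints are computed slicewise as pull-backs. -/
theorem exists_isometric_hat :
    ∃ Φ : (d.suspensionHaar hd).Reduced →⋆ₙₐ[ℂ] C(unitInterval, lam.Reduced), Isometry Φ ∧
      ∀ f, Φ ((d.suspensionHaar hd).toReduced f) = d.hatₗ f := by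
  refine exists_isometric_extension _ d.hatₗ (fun f => ?_) (fun f f' => ?_) fun f => ?_
  · refine le_antisymm ((ContinuousMap.norm_le _ (norm_nonneg _)).2 fun t =>
      d.norm_toReduced_hat_le hd f t) ?_
    exact d.norm_toReduced_le_of_hat hd (norm_nonneg _) fun t => (d.hatₗ f).norm_coe_le_norm t
  · ext t
    change lam.toReduced (d.hat _ t) = lam.toReduced (d.hat f t) * lam.toReduced (d.hat f' t)
    rw [← d.pull_hatPullback hd, ← d.pull_hatPullback hd, ← d.pull_hatPullback hd,
      Pullback.pull_conv, toReduced_conv]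
  · ext t
    change lam.toReduced (d.hat _ t) = star (lam.toReduced (d.hat f t))
    rw [← d.pull_hatPullback hd, ← d.pull_hatPullback hd, Pullback.pull_involution,
      toReduced_involution]

theorem toReduced_hat_add_one (hd : ∀ g, d.ρ (α.arrow g) = d.ρ g)
    {αt : lam.Reduced ≃⋆ₐ[ℂ] lam.Reduced}
    (hα : ∀ f : C_c(G, ℂ), αt (lam.toReduced f) = lam.toReduced (d.twist f))
    (f : C_c(Suspension α.arrow, ℂ)) (u : ℝ) :
    αt (lam.toReduced (d.hat f (u + 1))) = lam.toReduced (d.hat f u) := by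
  rw [hα, d.twist_hat hd]

/-- The functions `f̂` are dense in the mapping torus. -/
theorem exists_norm_hat_sub_le (hd : ∀ g, d.ρ (α.arrow g) = d.ρ g)
    {αt : lam.Reduced ≃⋆ₐ[ℂ] lam.Reduced}
    (hα : ∀ f : C_c(G, ℂ), αt (lam.toReduced f) = lam.toReduced (d.twist f))
    (h : mappingTorus αt) {ε : ℝ} (hε : 0 < ε) :
    ∃ f : C_c(Suspension α.arrow, ℂ), ‖d.hatₗ f - h.1‖ ≤ ε := by
  have hH := mappingTorusExtend_add_one h
  have hHc := continuous_mappingTorusExtend h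
  have h1 : ∀ u : ℝ, ∃ f : C_c(Suspension α.arrow, ℂ),
      ‖lam.toReduced (d.hat f u) - mappingTorusExtend h u‖ < ε := by
    intro u
    obtain ⟨ψ, hψ⟩ := lam.denseRange_toReduced.exists_dist_lt (mappingTorusExtend h u) hε
    obtain ⟨f, rfl⟩ := d.hat_surjective hd u ψ
    refine ⟨f, ?_⟩
    rwa [dist_comm, dist_eq_norm] at hψ
  choose F hF using h1
  -- `F u` approximates `h` at the single time `u`, hence on an open set of times by continuity. The
  -- images of these sets cover the compact circle, and finitely many local approximants are patched
  -- there.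
  let V : ℝ → Set ℝ := fun u => {v | ‖lam.toReduced (d.hat (F u) v) - mappingTorusExtend h v‖ < ε}
  have hV : ∀ u, IsOpen (V u) := fun u =>
    isOpen_lt ((d.continuous_toReduced_hat (F u)).sub hHc).norm continuous_const
  let U : ℝ → Set (AddCircle (1 : ℝ)) := fun u => (fun v : ℝ => (v : AddCircle (1 : ℝ))) '' V u
  have hU : ∀ u, IsOpen (U u) := fun u => QuotientAddGroup.isOpenMap_coe _ (hV u)
  have hcov : (Set.univ : Set (AddCircle (1 : ℝ))) ⊆ ⋃ u, U u := by
    intro z _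
    obtain ⟨u, rfl⟩ := QuotientAddGroup.mk_surjective z
    exact Set.mem_iUnion.2 ⟨u, u, hF u, rfl⟩
  obtain ⟨T, hT⟩ := isCompact_univ.elim_finite_subcover U hU hcov
  have hcov' : (Set.univ : Set (AddCircle (1 : ℝ))) ⊆ ⋃ u : T, U u := by
    intro z hz
    obtain ⟨u, hu, hzu⟩ := Set.mem_iUnion₂.1 (hT hz)
    exact Set.mem_iUnion.2 ⟨⟨u, hu⟩, hzu⟩
  obtain ⟨p, hp⟩ := PartitionOfUnity.exists_isSubordinate isClosed_univ (fun u : T => U u)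
    (fun u => hU u) hcov'
  refine ⟨∑ u : T, Suspension.mulCircle (p u) (F u), ?_⟩
  refine (ContinuousMap.norm_le _ hε.le).2 fun t => ?_
  have hsum : ∑ u : T, p u ((t : ℝ) : AddCircle (1 : ℝ)) = 1 := by
    rw [← finsum_eq_sum_of_fintype]
    exact p.sum_eq_one (Set.mem_univ _)
  have hp0 : ∀ u, 0 ≤ p u ((t : ℝ) : AddCircle (1 : ℝ)) := fun u => p.nonneg u _
  have e1 : d.hatₗ (∑ u : T, Suspension.mulCircle (p u) (F u)) t =
      ∑ u : T, ((p u ((t : ℝ) : AddCircle (1 : ℝ)) : ℝ) : ℂ) • lam.toReduced (d.hat (F u) t) := by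
    rw [map_sum, ContinuousMap.sum_apply]
    refine Finset.sum_congr rfl fun u _ => ?_
    change lam.toReduced (d.hat _ t) = _
    rw [hat_mulCircle, toReduced_smul]
  have e2 : h.1 t =
      ∑ u : T, ((p u ((t : ℝ) : AddCircle (1 : ℝ)) : ℝ) : ℂ) • mappingTorusExtend h t := by
    rw [← Finset.sum_smul, ← Complex.ofReal_sum, hsum, Complex.ofReal_one, one_smul,
      mappingTorusExtend_coe]
  rw [ContinuousMap.sub_apply, e1, e2, ← Finset.sum_sub_distrib]
  calc _ ≤ ∑ u : T, p u ((t : ℝ) : AddCircle (1 : ℝ)) * ε := by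
        refine norm_sum_le_of_le _ fun u _ => ?_
        rw [← smul_sub, norm_smul, Complex.norm_real, Real.norm_of_nonneg (hp0 u)]
        rcases (hp0 u).eq_or_lt with h0 | h0
        · rw [← h0, zero_mul, zero_mul]
        · refine mul_le_mul_of_nonneg_left ?_ (hp0 u)
          -- Subordination only says that `t` is congruent modulo `ℤ` to some `v` where the
          -- approximation is good. This suffices, as the error is periodic: both functions satisfy
          -- the same twisted relation and automorphisms are isometric.
          obtain ⟨v, hv, hvt⟩ := hp u (subset_tsupport _ h0.ne')
          have hvt' : ((v - t : ℝ) : AddCircle (1 : ℝ)) = 0 := by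
            rw [AddCircle.coe_sub, sub_eq_zero]
            exact hvt
          obtain ⟨n, hn⟩ := (AddCircle.coe_eq_zero_iff 1).1 hvt'
          have hn' : v = t + n := by
            rw [zsmul_eq_mul, mul_one] at hn
            linarith
          have h2 := norm_sub_add_intCast (F := fun v => lam.toReduced (d.hat (F u) v))
            (d.toReduced_hat_add_one hd hα (F u)) hH n t
          rw [← h2, ← hn']
          exact hv.le
    _ = ε := by rw [← Finset.sum_mul, hsum, one_mul]

/-- The isomorphism of the reduced algebra of the suspension groupoid with the mapping torus. -/
theorem exists_mappingTorus_equiv {αt : lam.Reduced ≃⋆ₐ[ℂ] lam.Reduced}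
    (hα : ∀ f : C_c(G, ℂ), αt (lam.toReduced f) = lam.toReduced (d.twist f)) :
    ∃ Λ : (d.suspensionHaar hd).Reduced ≃⋆ₐ[ℂ] mappingTorus αt,
      Isometry (fun a => (Λ a).1) ∧
      ∀ (f : C_c(Suspension α.arrow, ℂ)) (t : unitInterval),
        (Λ ((d.suspensionHaar hd).toReduced f)).1 t = lam.toReduced (d.hat f t) := by
  obtain ⟨Φ, hΦ, hf⟩ := d.exists_isometric_hat hd
  have hmem : ∀ a, Φ a ∈ mappingTorus αt := by
    intro a
    change αt (Φ a 1) = Φ a 0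
    refine (d.suspensionHaar hd).denseRange_toReduced.induction_on
      (p := fun a => αt (Φ a 1) = Φ a 0) a ?_ fun f => ?_
    · exact isClosed_eq ((StarAlgEquiv.isometry αt).continuous.comp
        ((continuous_eval_const 1).comp hΦ.continuous))
        ((continuous_eval_const 0).comp hΦ.continuous)
    · rw [hf]
      have := d.toReduced_hat_add_one hd hα f 0
      rw [zero_add] at this
      exact this
  -- The range of the isometry is closed, and each element of the mapping torus is a limit of
  -- functions `f̂`.
  have hs : ∀ h : mappingTorus αt, ∃ a, Φ a = h.1 := by
    intro h
    have h1 : h.1 ∈ closure (Set.range Φ) := by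
      refine Metric.mem_closure_iff.2 fun ε hε => ?_
      obtain ⟨f, hfε⟩ := d.exists_norm_hat_sub_le hd hα h (half_pos hε)
      refine ⟨d.hatₗ f, ⟨_, hf f⟩, ?_⟩
      rw [dist_comm, dist_eq_norm]
      linarith
    rwa [hΦ.isClosedEmbedding.isClosed_range.closure_eq] at h1
  refine ⟨StarAlgEquiv.ofBijective (NonUnitalStarAlgHom.codRestrict Φ (mappingTorus αt) hmem)
    ⟨fun a b hab => hΦ.injective (congrArg Subtype.val hab), fun h => ?_⟩, hΦ, fun f t => ?_⟩
  · obtain ⟨a, ha⟩ := hs h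
    exact ⟨a, Subtype.ext ha⟩
  · exact DFunLike.congr_fun (hf f) t

/-- The action of `ℝ` on the reduced algebra of the suspension groupoid. -/
theorem exists_flow_action :
    ∃ θ : Multiplicative ℝ →* ((d.suspensionHaar hd).Reduced ≃⋆ₐ[ℂ] (d.suspensionHaar hd).Reduced),
      ∀ (s : ℝ) (f : C_c(Suspension α.arrow, ℂ)),
        θ (.ofAdd s) ((d.suspensionHaar hd).toReduced f) =
          (d.suspensionHaar hd).toReduced ((d.flowDensity hd s).twist f) := by
  choose θ hθ using fun s : ℝ => (d.flowDensity hd s).exists_twist_automorphism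
  refine ⟨{ toFun := fun s => θ s.toAdd, map_one' := ?_, map_mul' := fun s s' => ?_ }, hθ⟩
  -- The group law is checked on `C_c`, where it reduces to the additivity of the exponents and of
  -- the translations.
  · refine StarAlgEquiv.ext (Reduced.hom_ext fun f => ?_)
    rw [toAdd_one, hθ, flow_twist_zero]
    rfl
  · refine StarAlgEquiv.ext (Reduced.hom_ext fun f => ?_)
    rw [toAdd_mul, hθ, flow_twist_add, StarAlgEquiv.mul_apply, hθ, hθ]

end TopGroupoid.HaarSystem.Density

end

theorem mainTheorem6 {G X : Type*} [TopologicalSpace G] [TopologicalSpace X]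
    [T2Space G] [LocallyCompactSpace G] [SecondCountableTopology G]
    [MeasurableSpace G] [BorelSpace G]
    (𝒢 : TopGroupoid G X) (lam : 𝒢.HaarSystem) (α : 𝒢.Aut) (d : lam.Density α)
    (hd : ∀ g, d.ρ (α.arrow g) = d.ρ g) :
    -- the Haar system of the suspension groupoid
    ∃ lamα : α.suspension.HaarSystem,
      (∀ (x : X) (t : ℝ), lamα.meas (.mk α.base x t) =
        ((lam.meas x).withDensity fun g => ENNReal.ofReal (d.ρ g ^ (-t))).map
          fun g => .mk α.arrow g t) ∧
    -- the automorphism of `C^*_r(G, λ)` induced by `α`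
    ∃ αt : lam.Reduced ≃⋆ₐ[ℂ] lam.Reduced,
      (∀ f : C_c(G, ℂ), αt (lam.toReduced f) = lam.toReduced (d.twist f)) ∧
      (∀ αt' : lam.Reduced ≃⋆ₐ[ℂ] lam.Reduced,
        (∀ f : C_c(G, ℂ), αt' (lam.toReduced f) = lam.toReduced (d.twist f)) → αt' = αt) ∧
    -- the isomorphism with the mapping torus
    ∃ Λ : lamα.Reduced ≃⋆ₐ[ℂ] mappingTorus αt,
      (∀ (f : C_c(Suspension α.arrow, ℂ)) (t : unitInterval),
        (Λ (lamα.toReduced f)).1 t = lam.toReduced (d.hat f t)) ∧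
      (∀ Λ' : lamα.Reduced ≃⋆ₐ[ℂ] mappingTorus αt,
        (∀ (f : C_c(Suspension α.arrow, ℂ)) (t : unitInterval),
          (Λ' (lamα.toReduced f)).1 t = lam.toReduced (d.hat f t)) → Λ' = Λ) ∧
    -- the action of `ℝ` induced by the flow on the suspension groupoid
    ∃ δ : (s : ℝ) → lamα.Density (α.suspensionFlow s),
      (∀ (s : ℝ) (g : G) (t : ℝ), (δ s).ρ (.mk α.arrow g t) = d.ρ g ^ s) ∧
    ∃ θ : Multiplicative ℝ →* (lamα.Reduced ≃⋆ₐ[ℂ] lamα.Reduced),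
      (∀ (s : ℝ) (f : C_c(Suspension α.arrow, ℂ)),
        θ (.ofAdd s) (lamα.toReduced f) = lamα.toReduced ((δ s).twist f)) ∧
      (∀ a : lamα.Reduced, Continuous fun s : ℝ => θ (.ofAdd s) a) ∧
    -- the isomorphism is equivariant for the translation action on the mapping torus
      ∀ (s : ℝ) (a : lamα.Reduced) (t : unitInterval),
        (Λ (θ (.ofAdd s) a)).1 t = mappingTorusExtend (Λ a) ((t : ℝ) - s) := by
  obtain ⟨αt, hα⟩ := d.exists_twist_automorphism
  obtain ⟨Λ, hΛi, hΛ⟩ := d.exists_mappingTorus_equiv hd hα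
  obtain ⟨θ, hθ⟩ := d.exists_flow_action hd
  have heq : ∀ (s : ℝ) (a : (d.suspensionHaar hd).Reduced) (t : unitInterval),
      (Λ (θ (.ofAdd s) a)).1 t = mappingTorusExtend (Λ a) ((t : ℝ) - s) := by
    intro s a t
    -- For fixed `s` and `t` both sides are star homomorphisms in `a`: the extension at `t - s` is
    -- evaluation at the fractional part followed by a power of `αt`. So it suffices to compare them
    -- on `C_c`.
    refine TopGroupoid.HaarSystem.Reduced.hom_ext
      (Φ := (mappingTorusEval Λ t).comp
        (θ (.ofAdd s) : (d.suspensionHaar hd).Reduced →⋆ₙₐ[ℂ] (d.suspensionHaar hd).Reduced))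
      (Ψ := ((αt ^ (-⌊(t : ℝ) - s⌋) : lam.Reduced ≃⋆ₐ[ℂ] lam.Reduced) :
        lam.Reduced →⋆ₙₐ[ℂ] lam.Reduced).comp (mappingTorusEval Λ
          ⟨Int.fract ((t : ℝ) - s), Int.fract_nonneg _, (Int.fract_lt_one _).le⟩))
      (fun f => ?_) a
    change (Λ (θ (.ofAdd s) _)).1 t = mappingTorusExtend (Λ _) ((t : ℝ) - s)
    rw [hθ, hΛ, TopGroupoid.HaarSystem.Density.hat_flow_twist]
    exact (mappingTorusExtend_eq (F := fun v => lam.toReduced (d.hat f v))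
      (d.toReduced_hat_add_one hd hα f) (hΛ f) _).symm
  refine ⟨d.suspensionHaar hd, fun x t => rfl, αt, hα, fun αt' h => ?_, Λ, hΛ, fun Λ' h => ?_,
    d.flowDensity hd, fun s g t => rfl, θ, hθ, fun a => ?_, heq⟩
  · exact StarAlgEquiv.ext (TopGroupoid.HaarSystem.Reduced.hom_ext fun f => (h f).trans (hα f).symm)
  · refine StarAlgEquiv.ext fun a => Subtype.ext (ContinuousMap.ext fun t => ?_)
    exact TopGroupoid.HaarSystem.Reduced.hom_ext (Φ := mappingTorusEval Λ' t)
      (Ψ := mappingTorusEval Λ t) (fun f => (h f t).trans (hΛ f t).symm) a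
  -- As `Λ` is isometric, strong continuity means continuity of the translates in the uniform norm.
  -- By compactness of `[0, 1]` this follows from the joint continuity of the extension at `t - s`.
  · rw [hΛi.isEmbedding.continuous_iff]
    refine ContinuousMap.continuous_of_continuous_uncurry _ ?_
    have h1 : Continuous fun q : ℝ × unitInterval =>
        mappingTorusExtend (Λ a) ((q.2 : ℝ) - q.1) :=
      (continuous_mappingTorusExtend (Λ a)).comp (by fun_prop)
    exact h1.congr fun q => (heq q.1 a q.2).symm
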